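/- All knots are oriented. A virtual knot is an equivalence class of Gauss diagrams on one circle (signed arrows from the over-strand to the under-strand, one for each classical crossing) under the Reidemeister moves. Two virtual knots are homotopic if they have diagrams related by Reidemeister moves and crossing changes. The shadow of a diagram forgets over- and under-crossings. Flat virtual links (with unordered components) are the classes of shadows under the flat Reidemeister moves. Flat singular virtual knots with one double-point are the classes of one-component shadows with one crossing marked as a double-point, under the flat Reidemeister moves, where the first and second move do not involve the double-point, together with the move that interchanges the double-point with the other vertex of a bigon. Let $D$ be a diagram of a virtual knot $K$, and let $\mathrm{sign}(d)=\pm1$ be the sign of a classical crossing $d$ of $D$. Let $[D^d_{smooth}]$ be the flat virtual link obtained by the oriented smoothing of $D$ at $d$, let $[D^0_{link}]$ be the flat virtual link formed by the shadow of $D$ and an unlinked unknot, let $[D^d_{glue}]$ be the flat singular virtual knot obtained by turning $d$ into a double-point, and let $[D^0_{sing}]$ be the one obtained by introducing a small kink into $D$ and turning its crossing into a double-point. In the free abelian groups on flat virtual links and on flat singular virtual knots with one double-point, put $$\mathbf{S}(K)=\sum_d \mathrm{sign}(d)\left([D^d_{smooth}]-[D^0_{link}]\right),\qquad \mathbf{G}(K)=\sum_d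 \mathrm{sign}(d)\left([D^d_{glue}]-[D^0_{sing}]\right),$$ where $d$ runs over the classical crossings of $D$. A singular based matrix (over $\mathbb Z$) is a finite set $G$ with distinct elements $s,d\in G$ and a skew-symmetric map $b:G\times G\to\mathbb Z$. Homology of singular based matrices is the equivalence relation generated by isomorphisms, by adding an element $g$ with $b(g,\cdot)=0$, by adding an element $g$ with $b(g,\cdot)=b(s,\cdot)$, by adding two elements $g_1,g_2$ with $b(g_1,\cdot)+b(g_2,\cdot)=b(s,\cdot)$, and by replacing $d$ by an element $g\ne s$ with $b(g,\cdot)+b(d,\cdot)=b(s,\cdot)$. In a flat diagram, let each crossing be an arrow $(x,y)$ on the core circle from the preimage $x$ on the strand that crosses the other one from left to right to the preimage $y$ on that other strand, and write $xy$ for the open arc from $x$ to $y$. A flat singular virtual knot diagram with one double-point has the singular based matrix with $G=\{s\}\amalg\{\text{arrows}\}$, $d$ the double-point, $b(e,s)=xy\cdot yx$ and $b(e,f)=xy\cdot zw+\epsilon$ for arrows $e=(x,y)$, $f=(z,w)$. Here $A\cdot B$ is the number of arrows from $A$ to $B$ minus the number of arrows from $B$ to $A$, and $\epsilon=1$ if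 $z\in xy$ and $w\in yx$, $\epsilon=-1$ if $w\in xy$ and $z\in yx$, and $\epsilon=0$ otherwise. Let $K_1$ and $K_2$ be the virtual knots with four crossings whose shadows have, along the core circle, the arrow endpoints $2_t\,4_h\,3_h\,2_h\,1_h\,3_t\,4_t\,1_t$ ($t$ for tail, $h$ for head), where the crossings $1,2,3,4$ have signs $-,+,-,+$ in $K_1$ and $-,+,+,-$ in $K_2$. Theorem. $\mathbf S$ and $\mathbf G$ are well-defined invariants of virtual knots (the sums depend neither on $D$ nor on the place and type of the kink), and $\mathbf{G}$ is strictly stronger than $\mathbf{S}$: (1) If $K$ and $K'$ are homotopic virtual knots with $\mathbf{S}(K)\neq\mathbf{S}(K')$, then $\mathbf{G}(K)\neq\mathbf{G}(K')$. (2) $K_1$ and $K_2$ are homotopic, $\mathbf{S}(K_1)=\mathbf{S}(K_2)$, and $\mathbf{G}(K_1)\neq\mathbf{G}(K_2)$. Moreover, equivalent flat singular virtual knot diagrams with one double-point have homologous singular based matrices, while the singular based matrices of the diagrams obtained by gluing $K_1$ at the crossings $3$ and $4$ are not homologous. -/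

import Mathlib

namespace VirtualKnots

/-! ## Diagrams

Knot and link diagrams are encoded by Gauss diagrams: finitely many points on a disjoint union of
oriented circles, some of which are joined in pairs by arrows, one arrow for every crossing that is
not virtual. Virtual crossings leave no trace. The points that are not endpoints of arrows are
auxiliary; they may be added or removed freely, as long as a point is left on every circle, and they
make it possible to speak of circles that carry no arrow. -/

/-- An arrow with a label in `L` between two points of `P`. -/
structure Arrow (P L : Type) where
  tail : P
  head : P
  label : L
  deriving DecidableEq

/-- The image of an arrow under a map of points. -/
def Arrow.map {P Q L : Type} (f : P → Q) (a : Arrow P L) : Arrow Q L :=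
  ⟨f a.tail, f a.head, a.label⟩

/-- `x` is an endpoint of `a`. -/
def Arrow.IsEnd {P L : Type} (a : Arrow P L) (x : P) : Prop :=
  a.tail = x ∨ a.head = x

/-- An arrow diagram with labels in `L` on a disjoint union of oriented circles. The circles are the
cycles of `next`, which sends a marked point to the next one on its circle. -/
structure Diagram (L : Type) where
  Pt : Type
  [fintype : Fintype Pt]
  [decEq : DecidableEq Pt]
  next : Equiv.Perm Pt
  arrows : Finset (Arrow Pt L)
  tail_ne_head : ∀ a ∈ arrows, a.tail ≠ a.head
  disjoint : ∀ a ∈ arrows, ∀ b ∈ arrows, ∀ x, a.IsEnd x → b.IsEnd x → a = b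

attribute [instance] Diagram.fintype Diagram.decEq

namespace Diagram

variable {L : Type} [DecidableEq L]

/-- The diagram has exactly one circle. -/
def IsKnot (D : Diagram L) : Prop :=
  Nonempty D.Pt ∧ ∀ x y, D.next.SameCycle x y

/-- No arrow ends at `x`. -/
def Free (D : Diagram L) (x : D.Pt) : Prop :=
  ∀ a ∈ D.arrows, ¬ a.IsEnd x

/-- `x` and `y` are distinct, and one of the two arcs between them carries no marked point in its
interior. -/
def Adj (D : Diagram L) (x y : D.Pt) : Prop :=
  x ≠ y ∧ (D.next x = y ∨ D.next y = x)

/-- Up to an orientation preserving homeomorphism of the circles, `D'` is obtained from `D` by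
replacing the arrows in `R` by the arrows in `T`. -/
def Replace (D D' : Diagram L) (R T : Set (Arrow D.Pt L)) : Prop :=
  R ⊆ (D.arrows : Set (Arrow D.Pt L)) ∧
    ∃ e : D.Pt ≃ D'.Pt, (∀ x, D'.next (e x) = e (D.next x)) ∧
      ∀ a : Arrow D.Pt L, a.map e ∈ D'.arrows ↔ (a ∈ D.arrows ∧ a ∉ R) ∨ a ∈ T

/-- Add one marked point, `none`, and use `σ` as the new cyclic order. -/
def addPoint (D : Diagram L) (σ : Equiv.Perm (Option D.Pt)) : Diagram L where
  Pt := Option D.Pt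
  next := σ
  arrows := D.arrows.image (Arrow.map some)
  tail_ne_head := by
    intro a ha
    obtain ⟨b, hb, rfl⟩ := Finset.mem_image.1 ha
    simpa [Arrow.map] using D.tail_ne_head b hb
  disjoint := by
    intro a ha a' ha' x hx hx'
    obtain ⟨b, hb, rfl⟩ := Finset.mem_image.1 ha
    obtain ⟨b', hb', rfl⟩ := Finset.mem_image.1 ha'
    rcases x with _ | x
    · simp [Arrow.IsEnd, Arrow.map] at hx
    · have h := D.disjoint b hb b' hb' x
        (by simpa [Arrow.IsEnd, Arrow.map] using hx) (by simpa [Arrow.IsEnd, Arrow.map] using hx')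
      rw [h]

/-- The disjoint union with a circle that carries no arrow (an unlinked unknot). -/
def addCircle (D : Diagram L) : Diagram L :=
  D.addPoint (Equiv.optionCongr D.next)

/-- The permutation `σ` with a new point, `none`, inserted directly after `p`. -/
def insertAfter {P : Type} [DecidableEq P] (σ : Equiv.Perm P) (p : P) : Equiv.Perm (Option P) :=
  (Equiv.optionCongr σ).trans (Equiv.swap none (some (σ p)))

/-- Insert a new marked point, `none`, directly after `p`. -/
def subdivide (D : Diagram L) (p : D.Pt) : Diagram L :=
  D.addPoint (insertAfter D.next p)

/-- Add an arrow between two distinct free points. -/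
def addArrow (D : Diagram L) (a : Arrow D.Pt L) (hne : a.tail ≠ a.head)
    (ht : D.Free a.tail) (hh : D.Free a.head) : Diagram L where
  Pt := D.Pt
  next := D.next
  arrows := insert a D.arrows
  tail_ne_head := by
    intro b hb
    rcases Finset.mem_insert.1 hb with rfl | hb
    · exact hne
    · exact D.tail_ne_head b hb
  disjoint := by
    have key : ∀ b ∈ D.arrows, ∀ x, a.IsEnd x → ¬ b.IsEnd x := by
      rintro b hb x (rfl | rfl)
      · exact ht b hb
      · exact hh b hb
    intro b hb c hc x hx hx'
    rcases Finset.mem_insert.1 hb with hb | hb <;> rcases Finset.mem_insert.1 hc with hc | hc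
    · rw [hb, hc]
    · exact absurd hx' (key c hc x (hb ▸ hx))
    · exact absurd hx (key b hb x (hc ▸ hx'))
    · exact D.disjoint b hb c hc x hx hx'

/-- The oriented smoothing at the crossing `d`: the arc arriving at the tail of `d` is continued by
the arc leaving its head, and conversely. -/
def smooth (D : Diagram L) (d : Arrow D.Pt L) : Diagram L where
  Pt := D.Pt
  next := D.next * Equiv.swap d.tail d.head
  arrows := D.arrows.erase d
  tail_ne_head := fun a ha => D.tail_ne_head a (Finset.mem_of_mem_erase ha)
  disjoint := fun a ha b hb =>
    D.disjoint a (Finset.mem_of_mem_erase ha) b (Finset.mem_of_mem_erase hb)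

/-! ### The third move

Three strands cross pairwise and bound a triangle. Strand `i` carries the adjacent marked points
`x i` and `D.next (x i)`. The flag `s i` says that strands `i` and `i + 1` cross in such a way that
(strand `i`, strand `i + 1`) is a positively oriented frame of the plane. The frames determine, up to
a global reversal that is the move itself, which of its two crossings each strand meets first. -/

/-- The three strands of a triangle are disjoint. -/
def Strands (D : Diagram L) (x : Fin 3 → D.Pt) : Prop :=
  Function.Injective x ∧ ∀ i j, D.next (x i) ≠ x j

/-- The point of strand `i` at the crossing with strand `i + 1`. -/
def toNext (D : Diagram L) (x : Fin 3 → D.Pt) (s : Fin 3 → Bool) (i : Fin 3) : D.Pt :=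
  if s i = s (i + 2) then D.next (x i) else x i

/-- The point of strand `i` at the crossing with strand `i + 2`. -/
def toPrev (D : Diagram L) (x : Fin 3 → D.Pt) (s : Fin 3 → Bool) (i : Fin 3) : D.Pt :=
  if s i = s (i + 2) then x i else D.next (x i)

/-- The three arrows of a triangle: an arrow labelled `l i` between the point `p i` of strand `i` and
the point `q (i + 1)` of strand `i + 1`, pointing to strand `i + 1` if `o i` is true and to strand `i`
otherwise. -/
def triangle {P : Type} (o : Fin 3 → Bool) (l : Fin 3 → L) (p q : Fin 3 → P) : Set (Arrow P L) :=
  Set.range fun i => if o i then ⟨p i, q (i + 1), l i⟩ else ⟨q (i + 1), p i, l i⟩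

end Diagram

open Diagram

/-! ## Virtual knots

In a Gauss diagram an arrow points from the over-strand to the under-strand and its label is the sign
of the crossing. -/

/-- The moves on Gauss diagrams: homeomorphism, the insertion of an auxiliary point, and the three
Reidemeister moves with arbitrary orientations of the strands. -/
inductive GaussMove : Diagram ℤˣ → Diagram ℤˣ → Prop
  | homeo {D D' : Diagram ℤˣ} (h : D.Replace D' ∅ ∅) : GaussMove D D'
  | subdivide (D : Diagram ℤˣ) (p : D.Pt) : GaussMove D (D.subdivide p)
  | reidemeister1 {D D' : Diagram ℤˣ} (a b : D.Pt) (ε : ℤˣ)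
      (ha : D.Free a) (hb : D.Free b) (hab : D.Adj a b)
      (h : D.Replace D' ∅ {⟨a, b, ε⟩}) : GaussMove D D'
  | reidemeister2 {D D' : Diagram ℤˣ} (a a' b b' : D.Pt) (ε : ℤˣ)
      (hd : [a, a', b, b'].Nodup) (hf : ∀ x ∈ [a, a', b, b'], D.Free x)
      (haa : D.Adj a a') (hbb : D.Adj b b')
      (h : D.Replace D' ∅ {⟨a, b, ε⟩, ⟨a', b', -ε⟩}) : GaussMove D D'
  | reidemeister3 {D D' : Diagram ℤˣ} (x : Fin 3 → D.Pt) (hx : D.Strands x)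
      -- `o i` says that strand `i` is over strand `i + 1`; the strands lie at different heights
      (o : Fin 3 → Bool) (ho : ∃ i j, o i ≠ o j) (ε : Fin 3 → ℤˣ)
      (s : Fin 3 → Bool) (hs : ∀ i, s i = true ↔ (o i = true ↔ ε i = 1))
      (h : D.Replace D' (triangle o ε (D.toNext x s) (D.toPrev x s))
        (triangle o ε (D.toPrev x s) (D.toNext x s))) : GaussMove D D'

/-- The changing crossing move (CC). -/
def CrossingChange (D D' : Diagram ℤˣ) : Prop :=
  ∃ a ∈ D.arrows, D.Replace D' {a} {⟨a.head, a.tail, -a.label⟩}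

/-- Gauss diagrams on one circle. -/
def KnotDiagram : Type 1 := {D : Diagram ℤˣ // D.IsKnot}

/-- Virtual knots: Gauss diagrams on one circle up to the equivalence generated by the moves. -/
def VirtualKnot : Type 1 := Quot fun D D' : KnotDiagram => GaussMove D.1 D'.1

/-- The virtual knot of a diagram. -/
def VirtualKnot.mk (D : KnotDiagram) : VirtualKnot := Quot.mk _ D

/-- Two virtual knots are homotopic if they have diagrams that are related by Reidemeister moves and
crossing changes. -/
def Homotopic (K K' : VirtualKnot) : Prop :=
  ∃ D D' : KnotDiagram, VirtualKnot.mk D = K ∧ VirtualKnot.mk D' = K' ∧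
    Relation.EqvGen (fun E E' : KnotDiagram => GaussMove E.1 E'.1 ∨ CrossingChange E.1 E'.1) D D'

/-! ## Flat virtual links and flat singular virtual knots

In a flat diagram an arrow points from the strand `a` to the strand `b` if the frame (`a`, `b`) is
positively oriented in the plane. -/

/-- The flat version of an arrow of a Gauss diagram, with a new label: negative arrows are
reversed. -/
def Arrow.flat {P L : Type} (a : Arrow P ℤˣ) (l : L) : Arrow P L :=
  if a.label = 1 then ⟨a.tail, a.head, l⟩ else ⟨a.head, a.tail, l⟩

theorem Arrow.isEnd_flat {P L : Type} (a : Arrow P ℤˣ) (l : L) (x : P) :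
    (a.flat l).IsEnd x ↔ a.IsEnd x := by
  unfold Arrow.flat Arrow.IsEnd
  split_ifs
  · rfl
  · exact or_comm

/-- Forget over and under, and label the crossings by `g`. -/
def Diagram.flatten {L : Type} [DecidableEq L] (D : Diagram ℤˣ) (g : Arrow D.Pt ℤˣ → L) :
    Diagram L where
  Pt := D.Pt
  next := D.next
  arrows := D.arrows.image fun a => a.flat (g a)
  tail_ne_head := by
    intro a ha
    obtain ⟨b, hb, rfl⟩ := Finset.mem_image.1 ha
    have h := D.tail_ne_head b hb
    unfold Arrow.flat
    split_ifs
    · exact h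
    · exact h.symm
  disjoint := by
    intro a ha a' ha' x hx hx'
    obtain ⟨b, hb, rfl⟩ := Finset.mem_image.1 ha
    obtain ⟨b', hb', rfl⟩ := Finset.mem_image.1 ha'
    rw [Arrow.isEnd_flat] at hx hx'
    rw [D.disjoint b hb b' hb' x hx hx']

/-- The shadow of a virtual link diagram. -/
def Diagram.shadow (D : Diagram ℤˣ) : Diagram Unit :=
  D.flatten fun _ => ()

/-- The moves on flat virtual link diagrams. -/
inductive FlatMove : Diagram Unit → Diagram Unit → Prop
  | homeo {D D' : Diagram Unit} (h : D.Replace D' ∅ ∅) : FlatMove D D'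
  | subdivide (D : Diagram Unit) (p : D.Pt) : FlatMove D (D.subdivide p)
  | flat1 {D D' : Diagram Unit} (a b : D.Pt)
      (ha : D.Free a) (hb : D.Free b) (hab : D.Adj a b)
      (h : D.Replace D' ∅ {⟨a, b, ()⟩}) : FlatMove D D'
  | flat2 {D D' : Diagram Unit} (a a' b b' : D.Pt)
      (hd : [a, a', b, b'].Nodup) (hf : ∀ x ∈ [a, a', b, b'], D.Free x)
      (haa : D.Adj a a') (hbb : D.Adj b b')
      (h : D.Replace D' ∅ {⟨a, b, ()⟩, ⟨b', a', ()⟩}) : FlatMove D D'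
  | flat3 {D D' : Diagram Unit} (x : Fin 3 → D.Pt) (hx : D.Strands x) (s : Fin 3 → Bool)
      (h : D.Replace D' (triangle s (fun _ => ()) (D.toNext x s) (D.toPrev x s))
        (triangle s (fun _ => ()) (D.toPrev x s) (D.toNext x s))) : FlatMove D D'

/-- Flat virtual links (oriented, with unordered components). -/
def FlatLink : Type 1 := Quot FlatMove

/-- The flat virtual link of a diagram. -/
def FlatLink.mk (D : Diagram Unit) : FlatLink := Quot.mk _ D

/-- Diagrams of flat singular virtual knots with exactly one double-point: arrow diagrams on one
circle with exactly one arrow that is labelled `true`, the preferred one. -/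
structure SingularString where
  diagram : Diagram Bool
  isKnot : diagram.IsKnot
  point : Arrow diagram.Pt Bool
  mem : point ∈ diagram.arrows
  label_iff : ∀ a ∈ diagram.arrows, a.label = true ↔ a = point

/-- The moves on flat singular virtual knot diagrams: the flat moves, where the first two may not
involve the double-point, the third one may involve at most one double-point, and the move that
interchanges the double-point with the other vertex of a bigon. -/
inductive SingularMove : Diagram Bool → Diagram Bool → Prop
  | homeo {D D' : Diagram Bool} (h : D.Replace D' ∅ ∅) : SingularMove D D'
  | subdivide (D : Diagram Bool) (p : D.Pt) : SingularMove D (D.subdivide p)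
  | flat1 {D D' : Diagram Bool} (a b : D.Pt)
      (ha : D.Free a) (hb : D.Free b) (hab : D.Adj a b)
      (h : D.Replace D' ∅ {⟨a, b, false⟩}) : SingularMove D D'
  | flat2 {D D' : Diagram Bool} (a a' b b' : D.Pt)
      (hd : [a, a', b, b'].Nodup) (hf : ∀ x ∈ [a, a', b, b'], D.Free x)
      (haa : D.Adj a a') (hbb : D.Adj b b')
      (h : D.Replace D' ∅ {⟨a, b, false⟩, ⟨b', a', false⟩}) : SingularMove D D'
  | flat3 {D D' : Diagram Bool} (x : Fin 3 → D.Pt) (hx : D.Strands x) (s l : Fin 3 → Bool)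
      (hl : ∀ i j, l i = true → l j = true → i = j)
      (h : D.Replace D' (triangle s l (D.toNext x s) (D.toPrev x s))
        (triangle s l (D.toPrev x s) (D.toNext x s))) : SingularMove D D'
  | switch {D D' : Diagram Bool} (a a' b b' : D.Pt)
      (hab : D.Adj a b') (hba : D.Adj a' b)
      (h : D.Replace D' {⟨a, b, true⟩, ⟨a', b', false⟩} {⟨a, b, false⟩, ⟨a', b', true⟩}) :
      SingularMove D D'

/-- Flat singular virtual knots with one double-point. -/
def FlatSingularKnot : Type 1 :=
  Quot fun α β : SingularString => SingularMove α.diagram β.diagram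

/-- The flat singular virtual knot of a diagram. -/
def FlatSingularKnot.mk (α : SingularString) : FlatSingularKnot := Quot.mk _ α

/-! ## The invariants -/

namespace KnotDiagram

/-- The flat singular virtual knot diagram that is obtained by gluing at the crossing `d`. -/
def glue (D : KnotDiagram) (d : Arrow D.1.Pt ℤˣ) (hd : d ∈ D.1.arrows) : SingularString where
  diagram := D.1.flatten fun a => decide (a = d)
  isKnot := D.2
  point := d.flat true
  mem := Finset.mem_image.2 ⟨d, hd, congrArg d.flat (decide_eq_true rfl)⟩
  label_iff := by
    intro a ha
    obtain ⟨b, hb, rfl⟩ := Finset.mem_image.1 ha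
    constructor
    · intro h
      have hbd : b = d := by
        unfold Arrow.flat at h
        split_ifs at h <;> simpa using h
      subst hbd
      exact congrArg b.flat (decide_eq_true rfl)
    · intro h
      rw [h]
      unfold Arrow.flat
      split_ifs <;> rfl

theorem sameCycle_insertAfter {P : Type} [DecidableEq P] (f : Equiv.Perm P)
    (h : ∀ x y, f.SameCycle x y) (p : P) (x y : Option P) : (insertAfter f p).SameCycle x y := by
  set σ := insertAfter f p with hσ
  have hp : σ (some p) = none := by simp [hσ, insertAfter]
  have hn : σ none = some (f p) := by simp [hσ, insertAfter]
  have hq : ∀ x, x ≠ p → σ (some x) = some (f x) := by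
    intro x hx
    simp only [hσ, insertAfter, Equiv.trans_apply, Equiv.optionCongr_apply, Option.map_some]
    rw [Equiv.swap_apply_of_ne_of_ne]
    · simp
    · simpa using hx
  have hstep : ∀ x : P, σ.SameCycle (some x) (some (f x)) := by
    intro x
    by_cases hx : x = p
    · subst hx
      refine ⟨2, ?_⟩
      rw [zpow_ofNat, pow_two, Equiv.Perm.mul_apply, hp, hn]
    · exact ⟨1, by rw [zpow_one, hq x hx]⟩
  have hiff : ∀ x : P, σ.SameCycle (some p) (some x) := by
    intro x
    obtain ⟨n, rfl⟩ := h p x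
    induction n with
    | zero => exact Equiv.Perm.SameCycle.refl _ _
    | succ n ih =>
      rw [add_comm, zpow_add, zpow_one, Equiv.Perm.mul_apply]
      exact ih.trans (hstep _)
    | pred n ih =>
      have := hstep ((f ^ (-(n : ℤ) - 1)) p)
      rw [← Equiv.Perm.mul_apply, ← zpow_one_add, add_sub_cancel] at this
      exact ih.trans this.symm
  have hall : ∀ x : Option P, σ.SameCycle (some p) x := by
    rintro (_ | x)
    · exact ⟨1, by rw [zpow_one, hp]⟩
    · exact hiff x
  exact (hall x).symm.trans (hall y)

theorem isKnot_subdivide {D : Diagram ℤˣ} (h : D.IsKnot) (p : D.Pt) : (D.subdivide p).IsKnot :=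
  ⟨⟨(none : Option D.Pt)⟩, sameCycle_insertAfter D.next h.2 p⟩

theorem free_none {D : Diagram ℤˣ} (p : D.Pt) : (D.subdivide p).Free none := by
  intro a ha
  obtain ⟨b, hb, rfl⟩ := Finset.mem_image.1 ha
  simp [Arrow.IsEnd, Arrow.map]

theorem free_some {D : Diagram ℤˣ} (p q : D.Pt) (hq : D.Free q) :
    (D.subdivide p).Free (some q) := by
  intro a ha
  obtain ⟨b, hb, rfl⟩ := Finset.mem_image.1 ha
  have h := hq b hb
  rintro (h' | h')
  · exact h (Or.inl (Option.some_injective _ h'))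
  · exact h (Or.inr (Option.some_injective _ h'))

/-- The two new points directly after `p` of the diagram that is subdivided twice, joined by an arrow
with sign `ε` whose direction is given by `r`. -/
def kinkArrow (D : KnotDiagram) (p : D.1.Pt) (r : Bool) (ε : ℤˣ) :
    Arrow ((D.1.subdivide p).subdivide none).Pt ℤˣ :=
  if r then ⟨some none, none, ε⟩ else ⟨none, some none, ε⟩

/-- The diagram with a small kink, directly after the point `p`. -/
def kink (D : KnotDiagram) (p : D.1.Pt) (r : Bool) (ε : ℤˣ) : KnotDiagram :=
  ⟨((D.1.subdivide p).subdivide none).addArrow (D.kinkArrow p r ε)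
      (by cases r
          · exact Option.some_ne_none _ ∘ Eq.symm
          · exact Option.some_ne_none _)
      (by cases r
          · exact free_none _
          · exact free_some _ _ (free_none _))
      (by cases r
          · exact free_some _ _ (free_none _)
          · exact free_none _),
    isKnot_subdivide (isKnot_subdivide D.2 p) none⟩

/-- The flat singular virtual knot obtained by introducing a small kink and gluing at its
crossing. -/
def singZero (D : KnotDiagram) (p : D.1.Pt) (r : Bool) (ε : ℤˣ) : SingularString :=
  (D.kink p r ε).glue (D.kinkArrow p r ε) (Finset.mem_insert_self _ _)

/-- The sum over the crossings that defines the smoothing invariant. -/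
noncomputable def smoothingSum (D : KnotDiagram) : FreeAbelianGroup FlatLink :=
  ∑ d ∈ D.1.arrows, (d.label : ℤ) •
    (FreeAbelianGroup.of (FlatLink.mk (D.1.smooth d).shadow) -
      FreeAbelianGroup.of (FlatLink.mk D.1.shadow.addCircle))

/-- The sum over the crossings that defines the gluing invariant, with a kink given by `p`, `r`,
`ε`. -/
noncomputable def gluingSum (D : KnotDiagram) (p : D.1.Pt) (r : Bool) (ε : ℤˣ) :
    FreeAbelianGroup FlatSingularKnot :=
  ∑ d ∈ D.1.arrows.attach, (d.1.label : ℤ) •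
    (FreeAbelianGroup.of (FlatSingularKnot.mk (D.glue d.1 d.2)) -
      FreeAbelianGroup.of (FlatSingularKnot.mk (D.singZero p r ε)))

end KnotDiagram

/-! ## Singular based matrices -/

/-- A singular based matrix over `H`. -/
structure SingularBasedMatrix (H : Type) [AddCommGroup H] where
  G : Type
  finite : Finite G
  s : G
  d : G
  s_ne_d : s ≠ d
  b : G → G → H
  skew : ∀ g h, b g h = -b h g

namespace SingularBasedMatrix

variable {H : Type} [AddCommGroup H]

/-- `g` is an annihilating element. -/
def Annihilating (M : SingularBasedMatrix H) (g : M.G) : Prop :=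
  g ≠ M.s ∧ g ≠ M.d ∧ ∀ h, M.b g h = 0

/-- `g` is a core element. -/
def Core (M : SingularBasedMatrix H) (g : M.G) : Prop :=
  g ≠ M.s ∧ g ≠ M.d ∧ ∀ h, M.b g h = M.b M.s h

/-- The rows of `g₁` and `g₂` add up to the row of `s`. -/
def SumToCore (M : SingularBasedMatrix H) (g₁ g₂ : M.G) : Prop :=
  ∀ h, M.b g₁ h + M.b g₂ h = M.b M.s h

/-- `f` embeds `M` into `M'`, and the elements of `M'` that do not belong to `M` are those in `A`. -/
def Extends (M M' : SingularBasedMatrix H) (f : M.G → M'.G) (A : Set M'.G) : Prop :=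
  Function.Injective f ∧ f M.s = M'.s ∧ f M.d = M'.d ∧ (∀ g h, M'.b (f g) (f h) = M.b g h) ∧
    (Set.range f)ᶜ = A

/-- Isomorphisms, the elementary extensions, and the singularity switch. -/
inductive Step : SingularBasedMatrix H → SingularBasedMatrix H → Prop
  | iso {M M' : SingularBasedMatrix H} (f : M.G → M'.G) (h : M.Extends M' f ∅) : Step M M'
  | ext1 {M M' : SingularBasedMatrix H} (f : M.G → M'.G) (g : M'.G) (h : M.Extends M' f {g})
      (hg : M'.Annihilating g) : Step M M'
  | ext2 {M M' : SingularBasedMatrix H} (f : M.G → M'.G) (g : M'.G) (h : M.Extends M' f {g})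
      (hg : M'.Core g) : Step M M'
  | ext3 {M M' : SingularBasedMatrix H} (f : M.G → M'.G) (g₁ g₂ : M'.G) (hne : g₁ ≠ g₂)
      (h : M.Extends M' f {g₁, g₂}) (hg : M'.SumToCore g₁ g₂) : Step M M'
  | switch {M : SingularBasedMatrix H} (g : M.G) (hs : M.s ≠ g) (hg : M.SumToCore g M.d) :
      Step M { M with d := g, s_ne_d := hs }

/-- Homology of singular based matrices. -/
def Homologous (M M' : SingularBasedMatrix H) : Prop :=
  Relation.EqvGen Step M M'

end SingularBasedMatrix

namespace Diagram

variable {L : Type}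

/-- The marked points in the interior of the arc that leads from `x` to `y`. -/
def arc (D : Diagram L) (x y : D.Pt) : Set D.Pt :=
  {z | ∃ k : ℕ, (D.next ^ (k + 1)) x = z ∧ ∀ j ≤ k, (D.next ^ (j + 1)) x ≠ y}

/-- The number of arrows with tails in `A` and heads in `B` minus the number of arrows with tails in
`B` and heads in `A`. -/
noncomputable def dot (D : Diagram L) (A B : Set D.Pt) : ℤ :=
  ({e | e ∈ D.arrows ∧ e.tail ∈ A ∧ e.head ∈ B}.ncard : ℤ) -
    ({e | e ∈ D.arrows ∧ e.tail ∈ B ∧ e.head ∈ A}.ncard : ℤ)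

/-- `f` links `e` positively: `f` points from the right-hand arc of `e` to the left-hand one. -/
def LinksPos (D : Diagram L) (e f : Arrow D.Pt L) : Prop :=
  f.tail ∈ D.arc e.tail e.head ∧ f.head ∈ D.arc e.head e.tail

/-- `f` links `e` negatively. -/
def LinksNeg (D : Diagram L) (e f : Arrow D.Pt L) : Prop :=
  f.head ∈ D.arc e.tail e.head ∧ f.tail ∈ D.arc e.head e.tail

open Classical in
/-- The linking number of two arrows. -/
noncomputable def linking (D : Diagram L) (e f : Arrow D.Pt L) : ℤ :=
  (if D.LinksPos e f then 1 else 0) - (if D.LinksNeg e f then 1 else 0)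

/-- The matrix of a diagram on one circle; its rows and columns are indexed by the core element `none`
and the arrows. The entry at an arrow and `none` is the intersection index of the right-hand curve
with the left-hand curve of the smoothing at the arrow. -/
noncomputable def matrix (D : Diagram L) :
    Option {a // a ∈ D.arrows} → Option {a // a ∈ D.arrows} → ℤ
  | none, none => 0
  | some e, none => D.dot (D.arc e.1.tail e.1.head) (D.arc e.1.head e.1.tail)
  | none, some f => -D.dot (D.arc f.1.tail f.1.head) (D.arc f.1.head f.1.tail)
  | some e, some f =>
    D.dot (D.arc e.1.tail e.1.head) (D.arc f.1.tail f.1.head) + D.linking e.1 f.1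

theorem dot_skew (D : Diagram L) (A B : Set D.Pt) : D.dot A B = -D.dot B A := by
  unfold dot
  ring

theorem exists_first (D : Diagram L) (hD : D.IsKnot) (a b : D.Pt) :
    ∃ t : ℕ, (D.next ^ t) a = b ∧ ∀ j < t, (D.next ^ j) a ≠ b := by
  classical
  have h : ∃ t : ℕ, (D.next ^ t) a = b := (hD.2 a b).exists_nat_pow_eq
  exact ⟨Nat.find h, Nat.find_spec h, fun j hj => Nat.find_min h hj⟩

theorem link_aux (D : Diagram L) (hD : D.IsKnot) {a b c d : D.Pt} (hab : a ≠ b) (hdb : d ≠ b)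
    (hc : c ∈ D.arc a b) (hd : d ∈ D.arc b a) : b ∈ D.arc c d := by
  obtain ⟨t, ht, hmin⟩ := D.exists_first hD a b
  obtain ⟨i, rfl, hi⟩ := hc
  obtain ⟨j, rfl, hj⟩ := hd
  have hit : i + 1 < t := by
    by_contra hlt
    rcases Nat.eq_zero_or_pos t with rfl | hpos
    · exact hab ht
    · refine hi (t - 1) (by omega) ?_
      rwa [show t - 1 + 1 = t by omega]
  refine ⟨t - (i + 1) - 1, ?_, ?_⟩
  · rw [← Equiv.Perm.mul_apply, ← pow_add, ← ht]
    congr 2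
    omega
  · intro r hr heq
    rw [← Equiv.Perm.mul_apply, ← pow_add] at heq
    generalize hq : r + 1 + (i + 1) = q at heq
    have hqt : q ≤ t := by omega
    rcases hqt.lt_or_eq with hlt | rfl
    · rcases le_or_gt q (j + 1) with hle | hgt
      · have h1 : (D.next ^ (j + 1 - q)) b = a := by
          have h2 : (D.next ^ q) ((D.next ^ (j + 1 - q)) b) = (D.next ^ q) a := by
            rw [heq, ← Equiv.Perm.mul_apply, ← pow_add]
            congr 2
            omega
          exact (D.next ^ q).injective h2
        rcases Nat.eq_zero_or_pos (j + 1 - q) with h0 | hpos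
        · rw [h0] at h1
          exact hab h1.symm
        · refine hj (j + 1 - q - 1) (by omega) ?_
          rwa [show j + 1 - q - 1 + 1 = j + 1 - q by omega]
      · refine hmin (q - (j + 1)) (by omega) ?_
        have h2 : (D.next ^ (j + 1)) ((D.next ^ (q - (j + 1))) a) = (D.next ^ (j + 1)) b := by
          rw [← heq, ← Equiv.Perm.mul_apply, ← pow_add]
          congr 2
          omega
        exact (D.next ^ (j + 1)).injective h2
    · exact hdb (heq.symm.trans ht)

theorem notMem_arc_right (D : Diagram L) (a b : D.Pt) : b ∉ D.arc a b := by
  rintro ⟨k, hk, h⟩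
  exact h k le_rfl hk

theorem linksPos_imp (D : Diagram L) (hD : D.IsKnot) {e f : Arrow D.Pt L} (he : e ∈ D.arrows)
    (hf : f ∈ D.arrows) (h : D.LinksPos e f) : D.LinksNeg f e := by
  have hne := D.tail_ne_head e he
  have hef : e ≠ f := by
    rintro rfl
    obtain ⟨⟨i, hi, hi'⟩, -⟩ := h
    obtain ⟨t, ht, hmin⟩ := D.exists_first hD e.tail e.head
    have hper : ∀ m : ℕ, (D.next ^ ((i + 1) * m)) e.tail = e.tail := by
      intro m
      induction m with
      | zero => rfl
      | succ m ih => rw [mul_add, mul_one, pow_add, Equiv.Perm.mul_apply, hi, ih]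
    have hmod : (D.next ^ (t % (i + 1))) e.tail = e.head := by
      rw [← ht]
      conv_rhs => rw [← Nat.mod_add_div t (i + 1), pow_add, Equiv.Perm.mul_apply, hper]
    have hlt : t % (i + 1) < i + 1 := Nat.mod_lt t (Nat.succ_pos i)
    rcases Nat.eq_zero_or_pos (t % (i + 1)) with h0 | hpos
    · rw [h0] at hmod
      exact hne hmod
    · refine hi' (t % (i + 1) - 1) (by omega) ?_
      rwa [show t % (i + 1) - 1 + 1 = t % (i + 1) by omega]
  have hd : f.head ≠ e.head := fun h' => hef (D.disjoint e he f hf e.head (Or.inr rfl) (Or.inr h'))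
  have hc : f.tail ≠ e.tail := fun h' => hef (D.disjoint e he f hf e.tail (Or.inl rfl) (Or.inl h'))
  exact ⟨D.link_aux hD hne hd h.1 h.2, D.link_aux hD hne.symm hc h.2 h.1⟩

theorem linksNeg_imp (D : Diagram L) (hD : D.IsKnot) {e f : Arrow D.Pt L} (he : e ∈ D.arrows)
    (hf : f ∈ D.arrows) (h : D.LinksNeg e f) : D.LinksPos f e := by
  have hne := D.tail_ne_head e he
  have hef : e ≠ f := by
    rintro rfl
    exact D.notMem_arc_right _ _ h.1
  have hc : f.tail ≠ e.head := fun h' => hef (D.disjoint e he f hf e.head (Or.inr rfl) (Or.inl h'))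
  have hd : f.head ≠ e.tail := fun h' => hef (D.disjoint e he f hf e.tail (Or.inl rfl) (Or.inr h'))
  exact ⟨D.link_aux hD hne.symm hd h.2 h.1, D.link_aux hD hne hc h.1 h.2⟩

theorem linking_skew (D : Diagram L) (hD : D.IsKnot) {e f : Arrow D.Pt L} (he : e ∈ D.arrows)
    (hf : f ∈ D.arrows) : D.linking e f = -D.linking f e := by
  have h1 : D.LinksPos e f ↔ D.LinksNeg f e :=
    ⟨D.linksPos_imp hD he hf, D.linksNeg_imp hD hf he⟩
  have h2 : D.LinksNeg e f ↔ D.LinksPos f e :=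
    ⟨D.linksNeg_imp hD he hf, D.linksPos_imp hD hf he⟩
  unfold linking
  by_cases h3 : D.LinksNeg f e <;> by_cases h4 : D.LinksPos f e <;> simp [h1, h2, h3, h4]

end Diagram

/-- The singular based matrix of a singular virtual string. -/
noncomputable def SingularString.sbm (α : SingularString) : SingularBasedMatrix ℤ where
  G := Option {a // a ∈ α.diagram.arrows}
  finite := inferInstance
  s := none
  d := some ⟨α.point, α.mem⟩
  s_ne_d := by simp
  b := α.diagram.matrix
  skew := by
    rintro (_ | e) (_ | f)
    · simp [Diagram.matrix]
    · simp [Diagram.matrix]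
    · simp [Diagram.matrix]
    · simp only [Diagram.matrix]
      rw [Diagram.dot_skew, Diagram.linking_skew _ α.isKnot e.2 f.2]
      ring

/-! ## The two virtual knots

Both have the flat word `2t 4h 3h 2h 1h 3t 4t 1t` (the points `0, …, 7` of the circle, where `it` and
`ih` are the tail and the head of crossing `i` in the shadow). The signs of the crossings
`1, 2, 3, 4` are `-, +, -, +` for the first knot and `-, +, +, -` for the second one. -/

/-- The diagram on the circle with the points `0, …, 7` whose crossings `1` and `2` are the negative
arrow `4 → 7` and the positive arrow `0 → 3`, and whose crossings `3` and `4` are `c` and `c'`. -/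
def exampleArrows (c c' : Arrow (Fin 8) ℤˣ) : Finset (Arrow (Fin 8) ℤˣ) :=
  {⟨4, 7, -1⟩, ⟨0, 3, 1⟩, c, c'}

theorem isKnot_finRotate : ∀ x y : Fin 8, (finRotate 8).SameCycle x y := by
  have h : ∀ x : Fin 8, (finRotate 8).SameCycle 0 x := by
    intro x
    refine ⟨(x.val : ℤ), ?_⟩
    rw [zpow_natCast]
    revert x
    decide
  exact fun x y => (h x).symm.trans (h y)

/-- The first knot. -/
def knotOne : KnotDiagram :=
  ⟨{ Pt := Fin 8
     next := finRotate 8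
     arrows := exampleArrows ⟨2, 5, -1⟩ ⟨6, 1, 1⟩
     tail_ne_head := by decide
     disjoint := by unfold Arrow.IsEnd; decide },
    ⟨(0 : Fin 8)⟩, isKnot_finRotate⟩

/-- The second knot. -/
def knotTwo : KnotDiagram :=
  ⟨{ Pt := Fin 8
     next := finRotate 8
     arrows := exampleArrows ⟨5, 2, 1⟩ ⟨1, 6, -1⟩
     tail_ne_head := by decide
     disjoint := by unfold Arrow.IsEnd; decide },
    ⟨(0 : Fin 8)⟩, isKnot_finRotate⟩

/-- The flat singular virtual knot diagram obtained by gluing `knotOne` at crossing `3`. -/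
def knotOneGlue3 : SingularString :=
  knotOne.glue (⟨2, 5, -1⟩ : Arrow (Fin 8) ℤˣ)
    (show (⟨2, 5, -1⟩ : Arrow (Fin 8) ℤˣ) ∈ exampleArrows ⟨2, 5, -1⟩ ⟨6, 1, 1⟩ by decide)

/-- The flat singular virtual knot diagram obtained by gluing `knotOne` at crossing `4`. -/
def knotOneGlue4 : SingularString :=
  knotOne.glue (⟨6, 1, 1⟩ : Arrow (Fin 8) ℤˣ)
    (show (⟨6, 1, 1⟩ : Arrow (Fin 8) ℤˣ) ∈ exampleArrows ⟨2, 5, -1⟩ ⟨6, 1, 1⟩ by decide)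

end VirtualKnots

open VirtualKnots

set_option linter.unusedSectionVars false

/-! Well-definedness of the gluing sum rests on four facts about flat singular knots. (a) Gluing at
a small kink gives a class that depends neither on the place nor on the type of the kink
(`flatEq_kinkState_all`). A kink passes a crossing of matching direction by a second move, a third
move that carries the double-point, and a second move backwards (`flatEq_pass`); the direction of
the kink is reversed with the help of the bigon switch (`flatEq_kinkState_not`). (b) A Reidemeister
move induces a singular move between the diagrams glued at a surviving crossing, and an equivalence
between the kinked diagrams (`IsMove`, `SingularMove.kinked`). So the surviving terms of the sum do
not change. (c) Gluing at the crossing of a first move gives the class of a kink, so that crossing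
contributes zero (`glue_mk_reidemeister1`). (d) The two crossings of a second move have opposite
signs and glue to diagrams that differ by the bigon switch, so they cancel
(`glue_mk_reidemeister2`).

Smoothing the double-point is a well-defined map from flat singular knots to flat links
(`smoothed_eq_of_singularMove`). It sends a glued diagram to the smoothed one and a glued kink to
the shadow with an unlinked unknot. Hence the smoothing invariant is the image of the gluing
invariant under a homomorphism, which gives both its invariance and part (1).

For the based matrices, the arc of an arrow is replaced by the function `curve` on the marked
points, with values 2 inside the arc, 1 at its ends and 0 elsewhere. The intersection number and the
linking term then merge into one bilinear form: four times the matrix is `pairing`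
(`four_mul_matrix`). Every move becomes a computation with increments of such functions. A kink has
the zero row or the core row (`kink_row`, `kink_row'`), the two rows of a bigon add up to the core
row (`bigon_rows`), and the third move preserves the form (`IsTriangle.pairing_eq`).

The two knots differ by crossing changes at 3 and 4. These reverse the two signs and keep the
shadow, so the difference of the gluing invariants is twice the difference of the classes glued at 4
and at 3, and likewise for smoothing. The two smoothings are the same flat link
(`linkEq_smoothing`), while the two glued classes are separated by an integer invariant of the
homology class of the matrix, `SingularBasedMatrix.cubicSum`, extended linearly to the free abelian
group. -/

namespace VirtualKnots

open Diagram

/-! ### Arrows, sets of arrows with disjoint ends, and their transport along maps. -/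

section Arrows

variable {P Q R L : Type}

theorem Arrow.ext {a b : Arrow P L} (h₁ : a.tail = b.tail) (h₂ : a.head = b.head)
    (h₃ : a.label = b.label) : a = b := by
  cases a; cases b; simp_all

theorem Arrow.map_injective {f : P → Q} (hf : Function.Injective f) :
    Function.Injective (Arrow.map f : Arrow P L → Arrow Q L) := by
  intro a b h
  simp only [Arrow.map, Arrow.mk.injEq] at h
  exact Arrow.ext (hf h.1) (hf h.2.1) h.2.2

theorem Arrow.map_map (g : Q → R) (f : P → Q) (a : Arrow P L) :
    (a.map f).map g = a.map (g ∘ f) := rfl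

theorem Arrow.map_congr {f g : P → Q} {a : Arrow P L} (h : ∀ x, a.IsEnd x → f x = g x) :
    a.map f = a.map g :=
  Arrow.ext (h _ (Or.inl rfl)) (h _ (Or.inr rfl)) rfl

theorem Arrow.map_eq_self {f : P → P} {a : Arrow P L} (h : ∀ x, a.IsEnd x → f x = x) :
    a.map f = a :=
  Arrow.ext (h _ (Or.inl rfl)) (h _ (Or.inr rfl)) rfl

theorem Arrow.isEnd_map {f : P → Q} {a : Arrow P L} {y : Q} :
    (a.map f).IsEnd y ↔ ∃ x, a.IsEnd x ∧ f x = y := by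
  simp only [Arrow.IsEnd, Arrow.map]
  constructor
  · rintro (rfl | rfl)
    · exact ⟨_, Or.inl rfl, rfl⟩
    · exact ⟨_, Or.inr rfl, rfl⟩
  · rintro ⟨x, rfl | rfl, rfl⟩
    · exact Or.inl rfl
    · exact Or.inr rfl

theorem Arrow.isEnd_map_of_injective {f : P → Q} (hf : Function.Injective f) {a : Arrow P L}
    {x : P} : (a.map f).IsEnd (f x) ↔ a.IsEnd x := by
  simp [Arrow.IsEnd, Arrow.map, hf.eq_iff]

theorem Arrow.isEnd_map_equiv (f : P ≃ Q) {a : Arrow P L} {y : Q} :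
    (a.map f).IsEnd y ↔ a.IsEnd (f.symm y) := by
  conv_lhs => rw [← f.apply_symm_apply y]
  exact Arrow.isEnd_map_of_injective f.injective

/-- The arrow with ends `x` and `y` that points to `y` if `r` is true and to `x` otherwise. -/
def Arrow.dir (r : Bool) (x y : P) (l : L) : Arrow P L :=
  if r then ⟨x, y, l⟩ else ⟨y, x, l⟩

@[simp] theorem Arrow.isEnd_dir {r : Bool} {x y : P} {l : L} {z : P} :
    (Arrow.dir r x y l).IsEnd z ↔ x = z ∨ y = z := by
  cases r <;> simp [Arrow.dir, Arrow.IsEnd, or_comm]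

@[simp] theorem Arrow.label_dir {r : Bool} {x y : P} {l : L} :
    (Arrow.dir r x y l).label = l := by
  cases r <;> rfl

@[simp] theorem Arrow.map_dir {f : P → Q} {r : Bool} {x y : P} {l : L} :
    (Arrow.dir r x y l).map f = Arrow.dir r (f x) (f y) l := by
  cases r <;> rfl

theorem Arrow.dir_ne {r : Bool} {x y : P} {l : L} (h : x ≠ y) :
    (Arrow.dir r x y l).tail ≠ (Arrow.dir r x y l).head := by
  cases r
  · exact h.symm
  · exact h

theorem Arrow.dir_not (r : Bool) (x y : P) (l : L) :
    Arrow.dir (!r) x y l = Arrow.dir r y x l := by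
  cases r <;> rfl

/-- The arrows of `A` join disjoint pairs of distinct points. -/
structure Valid (A : Finset (Arrow P L)) : Prop where
  ne : ∀ a ∈ A, a.tail ≠ a.head
  disj : ∀ a ∈ A, ∀ b ∈ A, ∀ x, a.IsEnd x → b.IsEnd x → a = b

/-- No arrow of `A` ends at `x`. -/
def FreeIn (A : Finset (Arrow P L)) (x : P) : Prop :=
  ∀ a ∈ A, ¬ a.IsEnd x

theorem Diagram.valid (D : Diagram L) : Valid D.arrows := ⟨D.tail_ne_head, D.disjoint⟩

variable [DecidableEq P] [DecidableEq Q] [DecidableEq L]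

theorem Valid.map {A : Finset (Arrow P L)} (h : Valid A) {f : P → Q} (hf : Function.Injective f) :
    Valid (A.image (Arrow.map f)) := by
  constructor
  · intro a ha
    obtain ⟨b, hb, rfl⟩ := Finset.mem_image.1 ha
    exact fun h' => h.ne b hb (hf h')
  · intro a ha a' ha' x hx hx'
    obtain ⟨b, hb, rfl⟩ := Finset.mem_image.1 ha
    obtain ⟨b', hb', rfl⟩ := Finset.mem_image.1 ha'
    obtain ⟨y, hy, rfl⟩ := Arrow.isEnd_map.1 hx
    rw [Arrow.isEnd_map_of_injective hf] at hx'
    rw [h.disj b hb b' hb' y hy hx']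

theorem Valid.insert {A : Finset (Arrow P L)} (h : Valid A) {a : Arrow P L}
    (hne : a.tail ≠ a.head) (hf : ∀ x, a.IsEnd x → FreeIn A x) : Valid (insert a A) := by
  constructor
  · intro b hb
    rcases Finset.mem_insert.1 hb with rfl | hb
    · exact hne
    · exact h.ne b hb
  · intro b hb c hc x hx hx'
    rcases Finset.mem_insert.1 hb with hb | hb <;> rcases Finset.mem_insert.1 hc with hc | hc
    · rw [hb, hc]
    · exact absurd hx' (hf x (hb ▸ hx) c hc)
    · exact absurd hx (hf x (hc ▸ hx') b hb)
    · exact h.disj b hb c hc x hx hx'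

theorem Valid.insert_dir {A : Finset (Arrow P L)} (h : Valid A) {r : Bool} {x y : P} {l : L}
    (hxy : x ≠ y) (hx : FreeIn A x) (hy : FreeIn A y) :
    Valid (Insert.insert (Arrow.dir r x y l) A) := by
  refine h.insert (Arrow.dir_ne hxy) ?_
  intro z hz
  rcases Arrow.isEnd_dir.1 hz with rfl | rfl
  · exact hx
  · exact hy

theorem Valid.mono {A B : Finset (Arrow P L)} (h : Valid B) (hAB : A ⊆ B) : Valid A :=
  ⟨fun a ha => h.ne a (hAB ha), fun a ha b hb => h.disj a (hAB ha) b (hAB hb)⟩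

theorem freeIn_insert {A : Finset (Arrow P L)} {a : Arrow P L} {x : P} :
    FreeIn (insert a A) x ↔ ¬ a.IsEnd x ∧ FreeIn A x := by
  simp [FreeIn]

theorem freeIn_image {A : Finset (Arrow P L)} (e : P ≃ Q) {y : Q} :
    FreeIn (A.image (Arrow.map e)) y ↔ FreeIn A (e.symm y) := by
  simp [FreeIn, Arrow.isEnd_map_equiv]

theorem freeIn_image_of_injective {A : Finset (Arrow P L)} {f : P → Q} (hf : Function.Injective f)
    {x : P} : FreeIn (A.image (Arrow.map f)) (f x) ↔ FreeIn A x := by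
  simp [FreeIn, Arrow.isEnd_map_of_injective hf]

theorem freeIn_image_of_notMem_range {A : Finset (Arrow P L)} {f : P → Q} {y : Q}
    (hy : ∀ x, f x ≠ y) : FreeIn (A.image (Arrow.map f)) y := by
  intro a ha
  obtain ⟨b, -, rfl⟩ := Finset.mem_image.1 ha
  rw [Arrow.isEnd_map]
  rintro ⟨x, -, hx⟩
  exact hy x hx

theorem FreeIn.mono {A B : Finset (Arrow P L)} {x : P} (h : FreeIn B x) (hAB : A ⊆ B) :
    FreeIn A x := fun a ha => h a (hAB ha)

theorem image_map_congr {A : Finset (Arrow P L)} {f g : P → Q}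
    (h : ∀ x, ¬ FreeIn A x → f x = g x) : A.image (Arrow.map f) = A.image (Arrow.map g) := by
  refine Finset.image_congr fun a ha => Arrow.map_congr fun x hx => h x ?_
  exact fun hf => hf a ha hx

theorem image_map_id {A : Finset (Arrow P L)} : A.image (Arrow.map (fun x : P => x)) = A :=
  Finset.image_id

theorem image_map_eq_self {A : Finset (Arrow P L)} {f : P → P}
    (h : ∀ x, ¬ FreeIn A x → f x = x) : A.image (Arrow.map f) = A :=
  (image_map_congr h).trans image_map_id

theorem image_map_swap_eq_self {A : Finset (Arrow P L)} {x y : P} (hx : FreeIn A x)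
    (hy : FreeIn A y) : A.image (Arrow.map (Equiv.swap x y)) = A := by
  refine image_map_eq_self fun z hz => Equiv.swap_apply_of_ne_of_ne ?_ ?_
  · rintro rfl; exact hz hx
  · rintro rfl; exact hz hy

theorem image_map_map {S : Type} [DecidableEq S] {A : Finset (Arrow P L)} (g : Q → S) (f : P → Q) :
    (A.image (Arrow.map f)).image (Arrow.map g) = A.image (Arrow.map (g ∘ f)) := by
  rw [Finset.image_image]; rfl

end Arrows

/-! ### Isotopy: sliding arrow ends and moving free marked points. -/

section Isotopy

variable {L : Type} [DecidableEq L]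

/-- The diagram with the points `P`, the cyclic order `σ` and the arrows `A`. -/
abbrev ofPerm {P : Type} [Fintype P] [DecidableEq P] (σ : Equiv.Perm P) (A : Finset (Arrow P L))
    (h : Valid A) : Diagram L where
  Pt := P
  next := σ
  arrows := A
  tail_ne_head := h.ne
  disjoint := h.disj

/-- The equivalence generated by homeomorphisms and the insertion of auxiliary points. -/
def Isotopic : Diagram L → Diagram L → Prop :=
  Relation.EqvGen fun D D' => D.Replace D' ∅ ∅ ∨ ∃ p, D' = D.subdivide p

theorem replace_empty {D D' : Diagram L} (e : D.Pt ≃ D'.Pt)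
    (hn : ∀ x, D'.next (e x) = e (D.next x)) (hA : D'.arrows = D.arrows.image (Arrow.map e)) :
    D.Replace D' ∅ ∅ := by
  refine ⟨Set.empty_subset _, e, hn, fun a => ?_⟩
  rw [hA]
  simp [(Arrow.map_injective e.injective).eq_iff]

theorem Isotopic.homeo {D D' : Diagram L} (h : D.Replace D' ∅ ∅) : Isotopic D D' :=
  Relation.EqvGen.rel _ _ (Or.inl h)

theorem Isotopic.of_equiv {D D' : Diagram L} (e : D.Pt ≃ D'.Pt)
    (hn : ∀ x, D'.next (e x) = e (D.next x)) (hA : D'.arrows = D.arrows.image (Arrow.map e)) :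
    Isotopic D D' :=
  Isotopic.homeo (replace_empty e hn hA)

theorem Isotopic.subdivide (D : Diagram L) (p : D.Pt) : Isotopic D (D.subdivide p) :=
  Relation.EqvGen.rel _ _ (Or.inr ⟨p, rfl⟩)

theorem Isotopic.refl (D : Diagram L) : Isotopic D D := Relation.EqvGen.refl _

theorem Isotopic.symm {D D' : Diagram L} (h : Isotopic D D') : Isotopic D' D :=
  Relation.EqvGen.symm _ _ h

theorem Isotopic.trans {D D' D'' : Diagram L} (h : Isotopic D D') (h' : Isotopic D' D'') :
    Isotopic D D'' :=
  Relation.EqvGen.trans _ _ _ h h'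

variable {P : Type} [DecidableEq P]

@[simp] theorem insertAfter_none (σ : Equiv.Perm P) (p : P) :
    insertAfter σ p none = some (σ p) := by
  simp [insertAfter]

theorem insertAfter_self (σ : Equiv.Perm P) (p : P) : insertAfter σ p (some p) = none := by
  simp [insertAfter]

theorem insertAfter_of_ne (σ : Equiv.Perm P) {p x : P} (h : x ≠ p) :
    insertAfter σ p (some x) = some (σ x) := by
  simp only [insertAfter, Equiv.trans_apply, Equiv.optionCongr_apply, Option.map_some]
  rw [Equiv.swap_apply_of_ne_of_ne] <;> simp [h]

theorem insertAfter_some (σ : Equiv.Perm P) (p x : P) :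
    insertAfter σ p (some x) = if x = p then none else some (σ x) := by
  split_ifs with h
  · rw [h, insertAfter_self]
  · exact insertAfter_of_ne σ h

variable [Fintype P]

/-- A free point may be taken out after `p` and put back after `q`, possibly on another circle.
Adding a point after `q` in the old order and a point after `p` in the new order leads to the same
diagram, up to exchanging `y` with the added point. -/
theorem isotopic_relocate {σ τ : Equiv.Perm P} {A : Finset (Arrow P L)} (h : Valid A) {y p q : P}
    (hy : FreeIn A y) (hσp : σ p = y) (hpq : p ≠ q) (hpy : p ≠ y) (hqy : q ≠ y) (hτq : τ q = y)
    (hτy : τ y = σ q) (hτp : τ p = σ y) (hτ : ∀ u, u ≠ p → u ≠ q → u ≠ y → τ u = σ u) :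
    Isotopic (ofPerm σ A h) (ofPerm τ A h) := by
  refine (Isotopic.subdivide (ofPerm σ A h) q).trans
    (Isotopic.trans ?_ (Isotopic.subdivide (ofPerm τ A h) p).symm)
  have hσy : σ y ≠ y := fun h' => hpy (σ.injective (hσp.trans h'.symm))
  have hσq : σ q ≠ y := fun h' => hpq (σ.injective (hσp.trans h'.symm))
  refine Isotopic.of_equiv (Equiv.swap (none : Option P) (some y)) ?_ ?_
  · change ∀ u : Option P, insertAfter τ p (Equiv.swap none (some y) u) =
      Equiv.swap none (some y) (insertAfter σ q u)
    rintro (_ | u)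
    · rw [Equiv.swap_apply_left, insertAfter_none, insertAfter_of_ne _ hpy.symm, hτy,
        Equiv.swap_apply_of_ne_of_ne] <;> simp [hσq]
    · by_cases hu : u = y
      · subst hu
        rw [Equiv.swap_apply_right, insertAfter_none, insertAfter_of_ne _ hqy.symm, hτp,
          Equiv.swap_apply_of_ne_of_ne] <;> simp [hσy]
      · rw [Equiv.swap_apply_of_ne_of_ne (by simp) (by simpa using hu)]
        by_cases hup : u = p
        · subst hup
          rw [insertAfter_self, insertAfter_of_ne _ hpq, hσp, Equiv.swap_apply_right]
        · by_cases huq : u = q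
          · subst huq
            rw [insertAfter_self, insertAfter_of_ne _ hup, hτq, Equiv.swap_apply_left]
          · rw [insertAfter_of_ne _ hup, insertAfter_of_ne _ huq, hτ u hup huq hu,
              Equiv.swap_apply_of_ne_of_ne] <;> simp
            intro h'
            exact hup (σ.injective (h'.trans hσp.symm))
  · refine (image_map_swap_eq_self ?_ ?_).symm
    · exact freeIn_image_of_notMem_range fun x => Option.some_ne_none x
    · exact (freeIn_image_of_injective (Option.some_injective _)).2 hy

/-- An arrow end slides from `x` to the free point after it. With one more point in front of `x` on
one side and one more point behind `y` on the other, the slide is only a renaming of points. -/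
theorem isotopic_slide {σ : Equiv.Perm P} {A : Finset (Arrow P L)} (h : Valid A) {x y : P}
    (hxy : σ x = y) (hne : y ≠ x) (hy : FreeIn A y) :
    Isotopic (ofPerm σ A h)
      (ofPerm σ (A.image (Arrow.map (Equiv.swap x y))) (h.map (Equiv.swap x y).injective)) := by
  obtain ⟨w, hw⟩ := σ.surjective x
  have hwx : w ≠ x := by rintro rfl; exact hne (hxy.symm.trans hw)
  refine (Isotopic.subdivide (ofPerm σ A h) w).trans
    (Isotopic.trans ?_ (Isotopic.subdivide _ y).symm)
  -- This cycle sends the new point to `x`, `x` to `y` and `y` to the new point, so it takes the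
  -- order `w`, new, `x`, `y` to the order `w`, `x`, `y`, new.
  refine Isotopic.of_equiv
    ((Equiv.swap (none : Option P) (some y)).trans (Equiv.swap (some x) (some y))) ?_ ?_
  · change ∀ u : Option P, insertAfter σ y
        (Equiv.swap (some x) (some y) (Equiv.swap none (some y) u)) =
      Equiv.swap (some x) (some y) (Equiv.swap none (some y) (insertAfter σ w u))
    rintro (_ | u)
    · rw [insertAfter_none, Equiv.swap_apply_left, Equiv.swap_apply_right,
        insertAfter_of_ne _ hne.symm, hw, hxy,
        Equiv.swap_apply_of_ne_of_ne (a := none) (x := some x) (by simp) (by simpa using hne.symm),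
        Equiv.swap_apply_left]
    · by_cases hux : u = x
      · subst hux
        rw [Equiv.swap_apply_of_ne_of_ne (a := none) (x := some u) (by simp)
          (by simpa using hne.symm), Equiv.swap_apply_left, insertAfter_self,
          insertAfter_of_ne _ hwx.symm, hxy, Equiv.swap_apply_right,
          Equiv.swap_apply_of_ne_of_ne (by simp) (by simp)]
      · by_cases huy : u = y
        · subst huy
          have h1 : σ u ≠ u := by
            intro h'; exact hne (σ.injective (h'.trans hxy.symm))
          rw [Equiv.swap_apply_right, Equiv.swap_apply_of_ne_of_ne (x := none) (by simp) (by simp),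
            insertAfter_none]
          by_cases huw : u = w
          · subst huw
            rw [insertAfter_self, Equiv.swap_apply_left, Equiv.swap_apply_right, hw]
          · have h2 : σ u ≠ x := by
              intro h'; exact huw (σ.injective (h'.trans hw.symm))
            rw [insertAfter_of_ne _ huw, Equiv.swap_apply_of_ne_of_ne (a := none) (by simp)
              (by simpa using h1), Equiv.swap_apply_of_ne_of_ne] <;> simp [h1, h2]
        · rw [Equiv.swap_apply_of_ne_of_ne (a := none) (x := some u) (by simp)
            (by simpa using huy), Equiv.swap_apply_of_ne_of_ne (by simpa using hux)
            (by simpa using huy), insertAfter_of_ne _ huy]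
          by_cases huw : u = w
          · subst huw
            rw [insertAfter_self, Equiv.swap_apply_left, Equiv.swap_apply_right, hw]
          · have h2 : σ u ≠ x := by
              intro h'; exact huw (σ.injective (h'.trans hw.symm))
            have h3 : σ u ≠ y := by
              intro h'; exact hux (σ.injective (h'.trans hxy.symm))
            rw [insertAfter_of_ne _ huw, Equiv.swap_apply_of_ne_of_ne (a := none) (by simp)
              (by simpa using h3), Equiv.swap_apply_of_ne_of_ne] <;> simp [h2, h3]
  · change Finset.image (Arrow.map (some : P → Option P)) (Finset.image _ A) =
      Finset.image (Arrow.map ((Equiv.swap (none : Option P) (some y)).trans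
        (Equiv.swap (some x) (some y)))) (Finset.image (Arrow.map (some : P → Option P)) A)
    rw [image_map_map, image_map_map]
    refine image_map_congr fun u hu => ?_
    have huy : u ≠ y := by rintro rfl; exact hu hy
    change some (Equiv.swap x y u) =
      Equiv.swap (some x) (some y) (Equiv.swap none (some y) (some u))
    rw [Equiv.swap_apply_of_ne_of_ne (a := none) (x := some u) (by simp) (by simpa using huy)]
    by_cases hux : u = x
    · subst hux; simp
    · rw [Equiv.swap_apply_of_ne_of_ne hux huy, Equiv.swap_apply_of_ne_of_ne] <;> simp [hux, huy]

/-- All points that are passed are free, so the composite of the single slides agrees on the arrows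
with one transposition of the start and the target. -/
theorem isotopic_slide_pow {σ : Equiv.Perm P} {A : Finset (Arrow P L)} (h : Valid A) {x : P}
    (k : ℕ) (hk : ∀ j < k, (σ ^ (j + 1)) x ≠ x ∧ FreeIn A ((σ ^ (j + 1)) x)) :
    Isotopic (ofPerm σ A h) (ofPerm σ (A.image (Arrow.map (Equiv.swap x ((σ ^ k) x))))
      (h.map (Equiv.swap x ((σ ^ k) x)).injective)) := by
  induction k with
  | zero =>
    have : A.image (Arrow.map (Equiv.swap x ((σ ^ 0) x))) = A :=
      image_map_eq_self fun z _ => by simp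
    simp only [this]
    exact Isotopic.refl _
  | succ k ih =>
    refine (ih fun j hj => hk j (by omega)).trans ?_
    obtain ⟨h1, h2⟩ := hk k (by omega)
    set y := (σ ^ k) x with hy
    have hz : σ y = (σ ^ (k + 1)) x := by rw [pow_succ', Equiv.Perm.mul_apply]
    set z := (σ ^ (k + 1)) x
    have hzy : z ≠ y := by
      intro h'
      rw [h'] at hz
      rcases Nat.eq_zero_or_pos k with rfl | hpos
      · exact h1 (h'.trans (by rw [hy]; rfl))
      · have h3 : σ x = x := by
          have : (σ ^ k) (σ x) = (σ ^ k) x := by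
            rw [← Equiv.Perm.mul_apply, ← pow_succ, pow_succ', Equiv.Perm.mul_apply]
            exact hz
          exact (σ ^ k).injective this
        exact (hk 0 (by omega)).1 (by simpa using h3)
    have hf : FreeIn (A.image (Arrow.map (Equiv.swap x y))) z := by
      rw [freeIn_image, Equiv.symm_swap, Equiv.swap_apply_of_ne_of_ne h1 hzy]
      exact h2
    have key := isotopic_slide (h.map (Equiv.swap x y).injective) hz hzy hf
    have heq : (A.image (Arrow.map (Equiv.swap x y))).image (Arrow.map (Equiv.swap y z)) =
        A.image (Arrow.map (Equiv.swap x z)) := by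
      rw [image_map_map]
      refine image_map_congr fun u hu => ?_
      have huz : u ≠ z := by rintro rfl; exact hu h2
      by_cases hux : u = x
      · subst hux; simp
      · have huy : u ≠ y := by
          rintro rfl
          rcases Nat.eq_zero_or_pos k with rfl | hpos
          · exact hux rfl
          · obtain ⟨m, rfl⟩ := Nat.exists_eq_succ_of_ne_zero hpos.ne'
            exact hu (hk m (by omega)).2
        simp only [Function.comp]
        rw [Equiv.swap_apply_of_ne_of_ne hux huy, Equiv.swap_apply_of_ne_of_ne huy huz,
          Equiv.swap_apply_of_ne_of_ne hux huz]
    simp only [heq] at key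
    exact key

/-- An order-preserving embedding that carries all arrows and meets every circle only forgets
auxiliary points. Induction on the number `n` of missing points: subdividing `E` once accounts for
one of them. -/
theorem isotopic_of_embedding {D : Diagram L} (n : ℕ) {E : Diagram L}
    (hn : Fintype.card D.Pt = Fintype.card E.Pt + n) (f : E.Pt → D.Pt)
    (hf : Function.Injective f) (hA : D.arrows = E.arrows.image (Arrow.map f))
    (hN : ∀ x, ∃ k, (D.next ^ (k + 1)) (f x) = f (E.next x) ∧
      ∀ j < k, (D.next ^ (j + 1)) (f x) ∉ Set.range f)
    (hC : ∀ y, ∃ x k, (D.next ^ k) (f x) = y) : Isotopic E D := by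
  induction n generalizing E with
  | zero =>
    have hb : Function.Bijective f := (Fintype.bijective_iff_injective_and_card f).2 ⟨hf, hn.symm⟩
    refine Isotopic.of_equiv (Equiv.ofBijective f hb) (fun x => ?_) hA
    obtain ⟨k, hk, hk'⟩ := hN x
    rcases Nat.eq_zero_or_pos k with rfl | hpos
    · simpa using hk
    · exact absurd (hb.2 _) (hk' 0 hpos)
  | succ n ih =>
    -- If every successor of a point of the range were in the range, the range would be everything
    -- by `hC`, against the count of points.
    have hex : ∃ x, D.next (f x) ∉ Set.range f := by
      by_contra hcon
      push Not at hcon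
      have hall : ∀ y, y ∈ Set.range f := by
        intro y
        obtain ⟨x, k, rfl⟩ := hC y
        induction k with
        | zero => exact ⟨x, rfl⟩
        | succ k ihk =>
          obtain ⟨z, hz⟩ := ihk
          rw [pow_succ', Equiv.Perm.mul_apply, ← hz]
          exact hcon z
      have := Fintype.card_le_of_surjective f hall
      omega
    obtain ⟨x, hx⟩ := hex
    refine (Isotopic.subdivide E x).trans (ih ?_ (fun o => o.elim (D.next (f x)) f) ?_ ?_ ?_ ?_)
    · rw [hn]
      have : Fintype.card (E.subdivide x).Pt = Fintype.card (Option E.Pt) := by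
        apply Fintype.card_congr
        exact Equiv.refl _
      rw [this, Fintype.card_option]
      omega
    · rintro (_ | u) (_ | v) huv
      · rfl
      · exact absurd ⟨v, huv.symm⟩ hx
      · exact absurd ⟨u, huv⟩ hx
      · exact congrArg some (hf huv)
    · rw [hA]
      exact (image_map_map (fun o : Option E.Pt => o.elim (D.next (f x)) f) some).symm
    -- The point that has just been added can be met on the way from `f u` to the next point of the
    -- range only if `u = x`, and then at the first step.
    · have hfirst : ∀ u k, (∀ j < k, (D.next ^ (j + 1)) (f u) ∉ Set.range f) → ∀ j < k,
          (D.next ^ (j + 1)) (f u) = D.next (f x) → j = 0 ∧ u = x := by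
        intro u k hk j hj h'
        rw [pow_succ', Equiv.Perm.mul_apply] at h'
        have h'' := D.next.injective h'
        rcases Nat.eq_zero_or_pos j with rfl | hpos
        · exact ⟨rfl, hf h''⟩
        · obtain ⟨m, rfl⟩ := Nat.exists_eq_succ_of_ne_zero hpos.ne'
          exact absurd ⟨x, h''.symm⟩ (hk m (by omega))
      rintro (_ | u)
      · change ∃ k, (D.next ^ (k + 1)) (D.next (f x)) =
          (insertAfter E.next x none).elim (D.next (f x)) f ∧ _
        rw [insertAfter_none]
        obtain ⟨k, hk, hk'⟩ := hN x
        rcases Nat.eq_zero_or_pos k with rfl | hpos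
        · exact absurd ⟨E.next x, by simpa using hk.symm⟩ hx
        · obtain ⟨m, rfl⟩ := Nat.exists_eq_succ_of_ne_zero hpos.ne'
          refine ⟨m, ?_, ?_⟩
          · rw [← Equiv.Perm.mul_apply, ← pow_succ]
            exact hk
          · intro j hj
            change (D.next ^ (j + 1)) (D.next (f x)) ∉ _
            rw [← Equiv.Perm.mul_apply, ← pow_succ]
            rintro ⟨_ | v, hv⟩
            · have := (hfirst x _ hk' (j + 1) (by omega) hv.symm).1
              omega
            · exact hk' (j + 1) (by omega) ⟨v, hv⟩
      · change ∃ k, (D.next ^ (k + 1)) (f u) =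
          (insertAfter E.next x (some u)).elim (D.next (f x)) f ∧ _
        by_cases hu : u = x
        · subst hu
          rw [insertAfter_self]
          exact ⟨0, by simp, by simp⟩
        · rw [insertAfter_of_ne _ hu]
          obtain ⟨k, hk, hk'⟩ := hN u
          refine ⟨k, hk, fun j hj => ?_⟩
          rintro ⟨_ | v, hv⟩
          · exact hu (hfirst u k hk' j hj hv.symm).2
          · exact hk' j hj ⟨v, hv⟩
    · intro y
      obtain ⟨u, k, hk⟩ := hC y
      exact ⟨some u, k, hk⟩

end Isotopy

/-! ### Replacement of arrows, subdivision, and the third move as a transport. -/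

section Replace

variable {L : Type} [DecidableEq L]

/-- Splits a move into a change of arrows on fixed points and a homeomorphism, so that later
arguments about a move can keep the circles fixed. -/
theorem Diagram.Replace.exists_inPlace {D D' : Diagram L} {R T : Set (Arrow D.Pt L)}
    (h : D.Replace D' R T) : ∃ (A : Finset (Arrow D.Pt L)) (hA : Valid A),
      (∀ a, a ∈ A ↔ (a ∈ D.arrows ∧ a ∉ R) ∨ a ∈ T) ∧
        (ofPerm D.next A hA).Replace D' ∅ ∅ := by
  obtain ⟨-, e, hn, hA⟩ := h
  refine ⟨D'.arrows.image (Arrow.map e.symm), D'.valid.map e.symm.injective, fun a => ?_, ?_⟩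
  · rw [← hA, Finset.mem_image]
    constructor
    · rintro ⟨b, hb, rfl⟩
      rw [Arrow.map_map, e.self_comp_symm]
      exact hb
    · intro h'
      refine ⟨_, h', ?_⟩
      rw [Arrow.map_map, e.symm_comp_self]
      rfl
  · refine replace_empty e hn ?_
    change D'.arrows = Finset.image (Arrow.map e) (Finset.image (Arrow.map e.symm) D'.arrows)
    rw [image_map_map, e.self_comp_symm]
    exact image_map_id.symm

theorem replace_inPlace {P : Type} [Fintype P] [DecidableEq P] {σ : Equiv.Perm P}
    {A B : Finset (Arrow P L)} (hA : Valid A) (hB : Valid B) {R T : Set (Arrow P L)}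
    (hR : R ⊆ A) (h : ∀ a, a ∈ B ↔ (a ∈ A ∧ a ∉ R) ∨ a ∈ T) :
    (ofPerm σ A hA).Replace (ofPerm σ B hB) R T :=
  ⟨hR, Equiv.refl _, fun _ => rfl, h⟩

theorem Diagram.Replace.isKnot_iff {D D' : Diagram L} {R T : Set (Arrow D.Pt L)}
    (h : D.Replace D' R T) : D.IsKnot ↔ D'.IsKnot := by
  obtain ⟨-, e, hn, -⟩ := h
  have hpow : ∀ (k : ℕ) x, (D'.next ^ k) (e x) = e ((D.next ^ k) x) := by
    intro k x
    induction k with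
    | zero => rfl
    | succ k ih => rw [pow_succ', pow_succ', Equiv.Perm.mul_apply, Equiv.Perm.mul_apply, ih, hn]
  constructor
  · rintro ⟨⟨x⟩, h⟩
    refine ⟨⟨e x⟩, fun y z => ?_⟩
    obtain ⟨k, hk⟩ := (h (e.symm y) (e.symm z)).exists_nat_pow_eq
    refine ⟨k, ?_⟩
    have := hpow k (e.symm y)
    rw [hk] at this
    simpa using this
  · rintro ⟨⟨x⟩, h⟩
    refine ⟨⟨e.symm x⟩, fun y z => ?_⟩
    obtain ⟨k, hk⟩ := (h (e y) (e z)).exists_nat_pow_eq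
    refine ⟨k, ?_⟩
    rw [hpow] at hk
    simpa using hk

theorem isKnot_subdivide_iff {D : Diagram L} (p : D.Pt) : (D.subdivide p).IsKnot ↔ D.IsKnot := by
  constructor
  · rintro ⟨-, h⟩
    refine ⟨⟨p⟩, ?_⟩
    -- `getD p` collapses the new point onto `p`; a walk in the subdivided circle then projects to a
    -- walk in the old one.
    have key : ∀ (k : ℕ) (x : D.Pt), ∀ y : Option D.Pt,
        ((insertAfter D.next p) ^ k) (some x) = y → D.next.SameCycle x (y.getD p) := by
      intro k x
      induction k with
      | zero => rintro y rfl; exact Equiv.Perm.SameCycle.refl _ _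
      | succ k ih =>
        rintro y rfl
        have h' := ih _ rfl
        rw [pow_succ', Equiv.Perm.mul_apply]
        generalize ((insertAfter D.next p) ^ k) (some x) = u at h'
        rcases u with _ | u
        · rw [insertAfter_none]
          simpa using h'
        · rw [insertAfter_some]
          split_ifs with hu
          · subst hu; simpa using h'
          · simpa using h'
    intro x y
    obtain ⟨k, hk⟩ := (h (some x) (some y)).exists_nat_pow_eq
    exact key k x _ hk
  · exact fun h => ⟨⟨(none : Option D.Pt)⟩, KnotDiagram.sameCycle_insertAfter D.next h.2 p⟩

/-- The permutation that interchanges the two points of every strand of a triangle. -/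
theorem exists_strandSwap {P : Type} (σ : Equiv.Perm P) {ι : Type} {x : ι → P}
    (hx : ∀ i j, σ (x i) ≠ x j) : ∃ τ : Equiv.Perm P, (∀ i, τ (x i) = σ (x i)) ∧
      (∀ i, τ (σ (x i)) = x i) ∧ ∀ u, (∀ i, u ≠ x i ∧ u ≠ σ (x i)) → τ u = u := by
  classical
  -- The hypothesis keeps the first and the second points of the strands apart, so the two branches
  -- do not interfere and `f` is an involution.
  let f : P → P := fun u => if u ∈ Set.range x then σ u else
    if σ.symm u ∈ Set.range x then σ.symm u else u
  have h1 : ∀ i, f (x i) = σ (x i) := fun i => if_pos ⟨i, rfl⟩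
  have h2 : ∀ i, f (σ (x i)) = x i := by
    intro i
    have : σ (x i) ∉ Set.range x := by rintro ⟨j, hj⟩; exact hx i j hj.symm
    simp only [f, if_neg this, σ.symm_apply_apply]
    exact if_pos ⟨i, rfl⟩
  have h3 : ∀ u, (∀ i, u ≠ x i ∧ u ≠ σ (x i)) → f u = u := by
    intro u hu
    have ha : u ∉ Set.range x := by rintro ⟨j, hj⟩; exact (hu j).1 hj.symm
    have hb : σ.symm u ∉ Set.range x := by
      rintro ⟨j, hj⟩; exact (hu j).2 (by rw [hj, σ.apply_symm_apply])
    simp only [f, if_neg ha, if_neg hb]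
  have hinv : Function.Involutive f := by
    intro u
    by_cases ha : u ∈ Set.range x
    · obtain ⟨i, rfl⟩ := ha
      rw [h1, h2]
    · by_cases hb : σ.symm u ∈ Set.range x
      · obtain ⟨i, hi⟩ := hb
        obtain rfl : σ (x i) = u := by rw [hi, σ.apply_symm_apply]
        rw [h2, h1]
      · have : f u = u := h3 u fun i =>
          ⟨fun h => ha ⟨i, h.symm⟩, fun h => hb ⟨i, by rw [h, σ.symm_apply_apply]⟩⟩
        rw [this, this]
  exact ⟨hinv.toPerm f, h1, h2, h3⟩

theorem toNext_or {D : Diagram L} (x : Fin 3 → D.Pt) (s : Fin 3 → Bool) (i : Fin 3) :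
    (D.toNext x s i = x i ∧ D.toPrev x s i = D.next (x i)) ∨
      (D.toNext x s i = D.next (x i) ∧ D.toPrev x s i = x i) := by
  unfold Diagram.toNext Diagram.toPrev
  split_ifs <;> simp

theorem isEnd_triangle {P : Type} {b : Bool} {u v : P} {l : L} {z : P} :
    (if b then (⟨u, v, l⟩ : Arrow P L) else ⟨v, u, l⟩).IsEnd z ↔ u = z ∨ v = z :=
  Arrow.isEnd_dir (r := b)

/-- The third move exchanges the two crossings on each of its strands. Hence the new set of arrows
is the image of the whole old one under the involution `τ`, and the move becomes a bijection of
crossings. -/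
theorem arrows_of_triangle {D D' : Diagram L} {x : Fin 3 → D.Pt}
    {s o : Fin 3 → Bool} {l : Fin 3 → L} {τ : Equiv.Perm D.Pt} (h1 : ∀ i, τ (x i) = D.next (x i))
    (h2 : ∀ i, τ (D.next (x i)) = x i)
    (h3 : ∀ u, (∀ i, u ≠ x i ∧ u ≠ D.next (x i)) → τ u = u) (e : D.Pt ≃ D'.Pt)
    (hR : triangle o l (D.toNext x s) (D.toPrev x s) ⊆ (D.arrows : Set (Arrow D.Pt L)))
    (hA : ∀ a : Arrow D.Pt L, a.map e ∈ D'.arrows ↔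
      (a ∈ D.arrows ∧ a ∉ triangle o l (D.toNext x s) (D.toPrev x s)) ∨
        a ∈ triangle o l (D.toPrev x s) (D.toNext x s)) :
    D'.arrows = D.arrows.image (Arrow.map (τ.trans e)) := by
  have hn : ∀ i, τ (D.toNext x s i) = D.toPrev x s i := by
    intro i
    rcases toNext_or x s i with h | h <;> simp [h.1, h.2, h1, h2]
  have hp : ∀ i, τ (D.toPrev x s i) = D.toNext x s i := by
    intro i
    rcases toNext_or x s i with h | h <;> simp [h.1, h.2, h1, h2]
  have htri : ∀ i, (if o i then (⟨D.toNext x s i, D.toPrev x s (i + 1), l i⟩ : Arrow D.Pt L)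
      else ⟨D.toPrev x s (i + 1), D.toNext x s i, l i⟩).map τ =
      if o i then ⟨D.toPrev x s i, D.toNext x s (i + 1), l i⟩
      else ⟨D.toNext x s (i + 1), D.toPrev x s i, l i⟩ := by
    intro i
    split_ifs <;> simp [Arrow.map, hn, hp]
  have hfix : ∀ a ∈ D.arrows, a ∉ triangle o l (D.toNext x s) (D.toPrev x s) → a.map τ = a := by
    intro a ha haR
    refine Arrow.map_eq_self fun u hu => h3 u fun i => ?_
    have hN : D.toNext x s i ≠ u := by
      intro h
      have hm : _ ∈ triangle o l (D.toNext x s) (D.toPrev x s) := ⟨i, rfl⟩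
      exact haR (D.disjoint _ ha _ (hR hm) u hu (isEnd_triangle.2 (Or.inl h)) ▸ hm)
    -- The point of strand `i` facing the previous strand is the second end of the arrow with index
    -- `i + 2`, because `i + 2 + 1 = i` in `Fin 3`.
    have hP : D.toPrev x s i ≠ u := by
      intro h
      have hm : _ ∈ triangle o l (D.toNext x s) (D.toPrev x s) := ⟨i + 2, rfl⟩
      have hi : i + 2 + 1 = i := by rw [add_assoc]; exact add_zero i
      refine haR (D.disjoint _ ha _ (hR hm) u hu (isEnd_triangle.2 (Or.inr ?_)) ▸ hm)
      rw [hi, h]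
    rcases toNext_or x s i with h | h
    · exact ⟨h.1 ▸ hN.symm, h.2 ▸ hP.symm⟩
    · exact ⟨h.2 ▸ hP.symm, h.1 ▸ hN.symm⟩
  ext c
  obtain ⟨a, rfl⟩ : ∃ a : Arrow D.Pt L, a.map e = c :=
    ⟨c.map e.symm, by rw [Arrow.map_map, e.self_comp_symm]; rfl⟩
  rw [hA, Finset.mem_image]
  constructor
  · rintro (⟨ha, haR⟩ | ⟨i, rfl⟩)
    · refine ⟨a, ha, ?_⟩
      conv_rhs => rw [← hfix a ha haR]
      rfl
    · refine ⟨_, hR ⟨i, rfl⟩, ?_⟩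
      beta_reduce
      rw [← htri]
      rfl
  · rintro ⟨b, hb, hba⟩
    have hba' : b.map τ = a := Arrow.map_injective e.injective hba
    by_cases hbR : b ∈ triangle o l (D.toNext x s) (D.toPrev x s)
    · right
      obtain ⟨i, rfl⟩ := hbR
      exact ⟨i, by beta_reduce; rw [← htri]; exact hba'⟩
    · left
      rw [hfix b hb hbR] at hba'
      exact hba' ▸ ⟨hb, hbR⟩

end Replace

/-! ### Equivalence of diagrams and the passage to flat singular knots. -/

section Strings

/-- The equivalence of arrow diagrams with preferred arrows that is generated by the moves. -/
def SingularEquiv : Diagram Bool → Diagram Bool → Prop := Relation.EqvGen SingularMove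

theorem SingularMove.equiv {D D' : Diagram Bool} (h : SingularMove D D') : SingularEquiv D D' :=
  Relation.EqvGen.rel _ _ h

theorem SingularEquiv.symm {D D' : Diagram Bool} (h : SingularEquiv D D') : SingularEquiv D' D :=
  Relation.EqvGen.symm _ _ h

theorem SingularEquiv.trans {D D' D'' : Diagram Bool} (h : SingularEquiv D D')
    (h' : SingularEquiv D' D'') : SingularEquiv D D'' :=
  Relation.EqvGen.trans _ _ _ h h'

theorem SingularEquiv.refl (D : Diagram Bool) : SingularEquiv D D := Relation.EqvGen.refl _

theorem Isotopic.singularEquiv {D D' : Diagram Bool} (h : Isotopic D D') : SingularEquiv D D' := by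
  induction h with
  | rel D D' h =>
    rcases h with h | ⟨p, rfl⟩
    · exact (SingularMove.homeo h).equiv
    · exact (SingularMove.subdivide D p).equiv
  | refl D => exact SingularEquiv.refl D
  | symm D D' _ ih => exact ih.symm
  | trans D D' D'' _ _ ih ih' => exact ih.trans ih'

/-- The preferred arrows. -/
def Diagram.preferred (D : Diagram Bool) : Finset (Arrow D.Pt Bool) :=
  D.arrows.filter fun a => a.label = true

theorem mem_preferred {D : Diagram Bool} {a : Arrow D.Pt Bool} :
    a ∈ D.preferred ↔ a ∈ D.arrows ∧ a.label = true := by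
  simp [Diagram.preferred]

/-- One circle and exactly one preferred arrow. -/
def Diagram.IsString (D : Diagram Bool) : Prop :=
  D.IsKnot ∧ D.preferred.card = 1

theorem preferred_card_of_image {D D' : Diagram Bool} {f : D.Pt → D'.Pt}
    (hf : Function.Injective f) (hA : ∀ a, a.label = true →
      (a ∈ D'.arrows ↔ a ∈ D.arrows.image (Arrow.map f))) :
    D'.preferred.card = D.preferred.card := by
  rw [← Finset.card_image_of_injective D.preferred (Arrow.map_injective hf)]
  congr 1
  ext a
  rw [mem_preferred, Finset.mem_image]
  constructor
  · rintro ⟨ha, hl⟩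
    rw [hA a hl, Finset.mem_image] at ha
    obtain ⟨b, hb, rfl⟩ := ha
    exact ⟨b, mem_preferred.2 ⟨hb, hl⟩, rfl⟩
  · rintro ⟨b, hb, rfl⟩
    rw [mem_preferred] at hb
    exact ⟨(hA _ hb.2).2 (Finset.mem_image_of_mem _ hb.1), hb.2⟩

theorem preferred_card_of_replace {D D' : Diagram Bool} {T : Set (Arrow D.Pt Bool)}
    (h : D.Replace D' ∅ T) (hT : ∀ a ∈ T, a.label = false) :
    D'.preferred.card = D.preferred.card := by
  obtain ⟨-, e, -, hA⟩ := h
  refine preferred_card_of_image e.injective fun a ha => ?_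
  obtain ⟨b, rfl⟩ : ∃ b : Arrow D.Pt Bool, b.map e = a :=
    ⟨a.map e.symm, by rw [Arrow.map_map, e.self_comp_symm]; rfl⟩
  rw [hA, Finset.mem_image]
  constructor
  · rintro (⟨hb, -⟩ | hb)
    · exact ⟨b, hb, rfl⟩
    · exact absurd (hT b hb) (by change b.label = true at ha; simp [ha])
  · rintro ⟨c, hc, hcb⟩
    obtain rfl := Arrow.map_injective e.injective hcb
    exact Or.inl ⟨hc, by simp⟩

/-- A chain of moves that starts at a one-circle diagram with one double-point therefore stays among
such diagrams, and intermediate diagrams need not be certified one by one. -/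
theorem SingularMove.isString_iff {D D' : Diagram Bool} (h : SingularMove D D') :
    D.IsString ↔ D'.IsString := by
  have key : ∀ {R T : Set (Arrow D.Pt Bool)}, D.Replace D' R T →
      D'.preferred.card = D.preferred.card → (D.IsString ↔ D'.IsString) := by
    intro R T h hc
    unfold Diagram.IsString
    rw [h.isKnot_iff, hc]
  cases h with
  | homeo h => exact key h (preferred_card_of_replace h (by simp))
  | subdivide p =>
    unfold Diagram.IsString
    rw [isKnot_subdivide_iff,
      preferred_card_of_image (D := D) (D' := D.subdivide p) (Option.some_injective _)
        fun a _ => Iff.rfl]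
  | flat1 a b ha hb hab h => exact key h (preferred_card_of_replace h (by simp))
  | flat2 a a' b b' hd hf haa hbb h => exact key h (preferred_card_of_replace h (by simp))
  | flat3 x hx s l hl h =>
    refine key h ?_
    obtain ⟨hR, e, -, hA⟩ := h
    obtain ⟨τ, h1, h2, h3⟩ := exists_strandSwap D.next hx.2
    refine preferred_card_of_image (τ.trans e).injective fun a _ => ?_
    rw [arrows_of_triangle h1 h2 h3 e hR hA]
  | switch a a' b b' hab hba h =>
    refine key h ?_
    obtain ⟨hR, e, -, hA⟩ := h
    have h1 : (⟨a, b, true⟩ : Arrow D.Pt Bool) ∈ D.arrows := hR (Or.inl rfl)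
    have h2 : (⟨a', b', false⟩ : Arrow D.Pt Bool) ∈ D.arrows := hR (Or.inr rfl)
    -- This makes the switch exchange one preferred arrow for another one that was not yet
    -- preferred, so the number is kept.
    have h3 : (⟨a', b', true⟩ : Arrow D.Pt Bool) ∉ D.arrows := by
      intro h
      simpa using D.disjoint _ h _ h2 a' (Or.inl rfl) (Or.inl rfl)
    have h4 : D'.preferred = (insert (⟨a', b', true⟩ : Arrow D.Pt Bool)
        (D.preferred.erase ⟨a, b, true⟩)).image (Arrow.map e) := by
      ext c
      obtain ⟨d, rfl⟩ : ∃ d : Arrow D.Pt Bool, d.map e = c :=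
        ⟨c.map e.symm, by rw [Arrow.map_map, e.self_comp_symm]; rfl⟩
      rw [(Arrow.map_injective e.injective).mem_finset_image, mem_preferred, hA, Finset.mem_insert,
        Finset.mem_erase, mem_preferred]
      obtain ⟨t, h, l⟩ := d
      cases l <;> simp [Arrow.map]
      tauto
    rw [h4, Finset.card_image_of_injective _ (Arrow.map_injective e.injective),
      Finset.card_insert_of_notMem, Finset.card_erase_of_mem (mem_preferred.2 ⟨h1, rfl⟩)]
    · have : 0 < D.preferred.card := Finset.card_pos.2 ⟨_, mem_preferred.2 ⟨h1, rfl⟩⟩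
      omega
    · exact fun h => h3 (mem_preferred.1 (Finset.mem_of_mem_erase h)).1

theorem SingularString.isString (α : SingularString) : α.diagram.IsString := by
  refine ⟨α.isKnot, Finset.card_eq_one.2 ⟨α.point, ?_⟩⟩
  ext a
  rw [mem_preferred, Finset.mem_singleton]
  constructor
  · rintro ⟨h1, h2⟩
    exact (α.label_iff a h1).1 h2
  · rintro rfl
    exact ⟨α.mem, (α.label_iff _ α.mem).2 rfl⟩

theorem Diagram.IsString.exists_string {D : Diagram Bool} (h : D.IsString) :
    ∃ α : SingularString, α.diagram = D := by
  obtain ⟨hK, hc⟩ := h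
  obtain ⟨p, hp⟩ := Finset.card_eq_one.1 hc
  have hmem : ∀ a, a ∈ D.arrows ∧ a.label = true ↔ a = p := by
    intro a
    rw [← mem_preferred, hp, Finset.mem_singleton]
  exact ⟨⟨D, hK, p, ((hmem p).2 rfl).1, fun a ha =>
    ⟨fun h => (hmem a).1 ⟨ha, h⟩, fun h => ((hmem a).2 h).2⟩⟩, rfl⟩

theorem Diagram.replace_refl (D : Diagram Bool) : D.Replace D ∅ ∅ :=
  replace_empty (Equiv.refl _) (fun _ => rfl) image_map_id.symm

/-- Both claims are proved together: transitivity needs the first one to turn the middle diagram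
into a string. -/
theorem SingularEquiv.mk_eq {D D' : Diagram Bool} (h : SingularEquiv D D') :
    (D.IsString ↔ D'.IsString) ∧ ∀ α β : SingularString, α.diagram = D → β.diagram = D' →
      FlatSingularKnot.mk α = FlatSingularKnot.mk β := by
  induction h with
  | rel D D' h =>
    refine ⟨h.isString_iff, ?_⟩
    rintro α β rfl rfl
    exact Quot.sound h
  | refl D =>
    refine ⟨Iff.rfl, fun α β hα hβ => Quot.sound ?_⟩
    rw [hα, hβ]
    exact SingularMove.homeo D.replace_refl
  | symm D D' _ ih => exact ⟨ih.1.symm, fun α β hα hβ => (ih.2 β α hβ hα).symm⟩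
  | trans D D' D'' _ _ ih ih' =>
    refine ⟨ih.1.trans ih'.1, fun α β hα hβ => ?_⟩
    obtain ⟨γ, hγ⟩ := (ih.1.1 (hα ▸ α.isString)).exists_string
    exact (ih.2 α γ hα hγ).trans (ih'.2 γ β hγ hβ)

theorem FlatSingularKnot.mk_eq_mk {α β : SingularString}
    (h : SingularEquiv α.diagram β.diagram) : FlatSingularKnot.mk α = FlatSingularKnot.mk β :=
  h.mk_eq.2 α β rfl rfl

end Strings

/-! ### Moves on a fixed circle, and the passage of a double-point past a crossing. -/

section Moves

variable {P : Type} [Fintype P] [DecidableEq P]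

/-- Equivalence of two sets of arrows on the same circles. -/
def FlatEq (σ : Equiv.Perm P) (A B : Finset (Arrow P Bool)) : Prop :=
  ∃ hA hB, SingularEquiv (ofPerm σ A hA) (ofPerm σ B hB)

variable {σ : Equiv.Perm P} {A B C : Finset (Arrow P Bool)}

theorem FlatEq.symm (h : FlatEq σ A B) : FlatEq σ B A := by
  obtain ⟨hA, hB, h⟩ := h
  exact ⟨hB, hA, h.symm⟩

theorem FlatEq.trans (h : FlatEq σ A B) (h' : FlatEq σ B C) : FlatEq σ A C := by
  obtain ⟨hA, hB, h⟩ := h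
  obtain ⟨hB', hC, h'⟩ := h'
  exact ⟨hA, hC, h.trans h'⟩

theorem FlatEq.right (h : FlatEq σ A B) : Valid B := h.symm.choose

theorem flatEq_refl (hA : Valid A) : FlatEq σ A A := ⟨hA, hA, SingularEquiv.refl _⟩

theorem flatEq_slide (hA : Valid A) {x : P} (k : ℕ)
    (hk : ∀ j < k, (σ ^ (j + 1)) x ≠ x ∧ FreeIn A ((σ ^ (j + 1)) x)) :
    FlatEq σ A (A.image (Arrow.map (Equiv.swap x ((σ ^ k) x)))) :=
  ⟨_, _, (isotopic_slide_pow hA k hk).singularEquiv⟩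

theorem notMem_of_freeIn {L : Type} {A : Finset (Arrow P L)} {a : Arrow P L} {x : P}
    (h : FreeIn A x) (ha : a.IsEnd x) : a ∉ A :=
  fun h' => h a h' ha

theorem dir_notMem {L : Type} {A : Finset (Arrow P L)} {r : Bool} {x y : P} {l : L}
    (h : FreeIn A x) : Arrow.dir r x y l ∉ A :=
  notMem_of_freeIn h (by simp)

theorem flatEq_flat1 (hA : Valid A) {r : Bool} {x y : P} (hx : FreeIn A x) (hy : FreeIn A y)
    (hxy : x ≠ y) (h : σ x = y ∨ σ y = x) : FlatEq σ A (insert (Arrow.dir r x y false) A) := by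
  have hB : Valid (insert (Arrow.dir r x y false) A) := hA.insert_dir hxy hx hy
  refine ⟨hA, hB, SingularMove.equiv ?_⟩
  cases r
  · refine SingularMove.flat1 (D := ofPerm σ A hA) y x hy hx ⟨hxy.symm, h.symm⟩
      (replace_inPlace hA hB (Set.empty_subset _) fun a => ?_)
    simp [Arrow.dir, or_comm]
  · refine SingularMove.flat1 (D := ofPerm σ A hA) x y hx hy ⟨hxy, h⟩
      (replace_inPlace hA hB (Set.empty_subset _) fun a => ?_)
    simp [Arrow.dir, or_comm]

theorem flatEq_flat2 (hA : Valid A) {r : Bool} {a a' b b' : P} (hd : [a, a', b, b'].Nodup)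
    (hf : ∀ x ∈ [a, a', b, b'], FreeIn A x) (haa : σ a = a' ∨ σ a' = a)
    (hbb : σ b = b' ∨ σ b' = b) :
    FlatEq σ A (insert (Arrow.dir r a b false) (insert (Arrow.dir (!r) a' b' false) A)) := by
  have hd' := hd
  simp only [List.nodup_cons, List.mem_cons, List.not_mem_nil, or_false, not_or] at hd'
  have hfa := hf a (by simp)
  have hfa' := hf a' (by simp)
  have hfb := hf b (by simp)
  have hfb' := hf b' (by simp)
  have hB : Valid (insert (Arrow.dir r a b false) (insert (Arrow.dir (!r) a' b' false) A)) := by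
    refine Valid.insert_dir (hA.insert_dir ?_ hfa' hfb') ?_ ?_ ?_
    · grind
    · grind
    · rw [freeIn_insert, Arrow.isEnd_dir]; grind
    · rw [freeIn_insert, Arrow.isEnd_dir]; grind
  refine ⟨hA, hB, SingularMove.equiv ?_⟩
  cases r
  · refine SingularMove.flat2 (D := ofPerm σ A hA) b b' a a' ?_ ?_ ⟨?_, hbb⟩ ⟨?_, haa⟩
      (replace_inPlace hA hB (Set.empty_subset _) fun c => ?_)
    · change [b, b', a, a'].Nodup
      simp only [List.nodup_cons, List.mem_cons, List.not_mem_nil, or_false, not_or]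
      grind
    · intro x hx
      exact hf x (by simp at hx ⊢; tauto)
    · grind
    · grind
    · simp only [Arrow.dir, Finset.mem_insert, Set.mem_insert_iff, Set.mem_singleton_iff,
        Set.mem_empty_iff_false]
      simp
      tauto
  · refine SingularMove.flat2 (D := ofPerm σ A hA) a a' b b' hd hf ⟨?_, haa⟩ ⟨?_, hbb⟩
      (replace_inPlace hA hB (Set.empty_subset _) fun c => ?_)
    · grind
    · grind
    · simp only [Arrow.dir, Finset.mem_insert, Set.mem_insert_iff, Set.mem_singleton_iff,
        Set.mem_empty_iff_false]
      simp
      tauto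

theorem flatEq_switch (hA : Valid A) {r : Bool} {a a' b b' : P} (hd : [a, a', b, b'].Nodup)
    (hf : ∀ x ∈ [a, a', b, b'], FreeIn A x) (hab : σ a = b' ∨ σ b' = a)
    (hba : σ a' = b ∨ σ b = a') :
    FlatEq σ (insert (Arrow.dir r a b true) (insert (Arrow.dir r a' b' false) A))
      (insert (Arrow.dir r a b false) (insert (Arrow.dir r a' b' true) A)) := by
  have hd' := hd
  simp only [List.nodup_cons, List.mem_cons, List.not_mem_nil, or_false, not_or] at hd'
  have hfa := hf a (by simp)
  have hfa' := hf a' (by simp)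
  have hfb := hf b (by simp)
  have hfb' := hf b' (by simp)
  have hV : ∀ l l', Valid (insert (Arrow.dir r a b l) (insert (Arrow.dir r a' b' l') A)) := by
    intro l l'
    refine Valid.insert_dir (hA.insert_dir ?_ hfa' hfb') ?_ ?_ ?_
    · grind
    · grind
    · rw [freeIn_insert, Arrow.isEnd_dir]; grind
    · rw [freeIn_insert, Arrow.isEnd_dir]; grind
  have h1 : Arrow.dir r a b true ∉ A := dir_notMem hfa
  have h2 : Arrow.dir r a' b' false ∉ A := dir_notMem hfa'
  refine ⟨hV _ _, hV _ _, SingularMove.equiv ?_⟩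
  have hne : b ≠ b' ∧ a ≠ a' ∧ a ≠ b' ∧ a' ≠ b := by grind
  cases r
  · refine SingularMove.switch (D := ofPerm σ _ (hV true false)) b b' a a'
      ⟨hne.2.2.2.symm, hba.symm⟩
      ⟨hne.2.2.1.symm, hab.symm⟩
      (replace_inPlace (hV _ _) (hV _ _) ?_ fun c => ?_)
    · intro c; simp [Arrow.dir]; tauto
    · simp only [Arrow.dir, Finset.mem_insert, Set.mem_insert_iff, Set.mem_singleton_iff] at h1 h2 ⊢
      by_cases hc : c ∈ A
      · have : c ≠ ⟨b, a, true⟩ := by rintro rfl; exact h1 hc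
        have : c ≠ ⟨b', a', false⟩ := by rintro rfl; exact h2 hc
        simp_all
      · simp [hc]
        tauto
  · refine SingularMove.switch (D := ofPerm σ _ (hV true false)) a a' b b' ⟨hne.2.2.1, hab⟩
      ⟨hne.2.2.2, hba⟩
      (replace_inPlace (hV _ _) (hV _ _) ?_ fun c => ?_)
    · intro c; simp [Arrow.dir]; tauto
    · simp only [Arrow.dir, Finset.mem_insert, Set.mem_insert_iff, Set.mem_singleton_iff] at h1 h2 ⊢
      by_cases hc : c ∈ A
      · have : c ≠ ⟨a, b, true⟩ := by rintro rfl; exact h1 hc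
        have : c ≠ ⟨a', b', false⟩ := by rintro rfl; exact h2 hc
        simp_all
      · simp [hc]
        tauto

theorem triangle_eq {L : Type} (o : Fin 3 → Bool) (l : Fin 3 → L) (p q : Fin 3 → P) :
    triangle o l p q = {Arrow.dir (o 0) (p 0) (q 1) (l 0), Arrow.dir (o 1) (p 1) (q 2) (l 1),
      Arrow.dir (o 2) (p 2) (q 0) (l 2)} := by
  ext a
  constructor
  · rintro ⟨i, rfl⟩
    fin_cases i
    · exact Or.inl rfl
    · exact Or.inr (Or.inl rfl)
    · exact Or.inr (Or.inr rfl)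
  · rintro (rfl | rfl | rfl)
    · exact ⟨0, rfl⟩
    · exact ⟨1, rfl⟩
    · exact ⟨2, rfl⟩

/-- The double-point at `p₁`, `p₄` moves over the crossing end that follows it, which reappears in
front at `p₁`. The strand through the `q` points is pushed across the loop by a second move, a third
move and a second move backwards. The third move fits only when the two arrows have the same
direction `r`. -/
theorem flatEq_pass (hA : Valid A) {r : Bool} {p₁ p₂ p₃ p₄ p₅ q₁ q₂ q₃ : P}
    (hd : [p₁, p₂, p₃, p₄, p₅, q₁, q₂, q₃].Nodup)
    (hf : ∀ x ∈ [p₁, p₂, p₃, p₄, p₅, q₁, q₂, q₃], FreeIn A x) (h₁ : σ p₁ = p₂) (h₂ : σ p₂ = p₃)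
    (h₃ : σ p₃ = p₄) (h₄ : σ p₄ = p₅) (k₁ : σ q₁ = q₂) (k₂ : σ q₂ = q₃) :
    FlatEq σ (insert (Arrow.dir r p₁ p₄ true) (insert (Arrow.dir r p₅ q₃ false) A))
      (insert (Arrow.dir r p₂ p₅ true) (insert (Arrow.dir r p₁ q₃ false) A)) := by
  simp only [List.nodup_cons, List.mem_cons, List.not_mem_nil, or_false, not_or] at hd
  simp only [List.mem_cons, List.not_mem_nil, or_false, forall_eq_or_imp, forall_eq] at hf
  obtain ⟨f1, f2, f3, f4, f5, g1, g2, g3⟩ := hf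
  have hS : Valid (insert (Arrow.dir r p₁ p₄ true) (insert (Arrow.dir r p₅ q₃ false) A)) := by
    refine Valid.insert_dir (hA.insert_dir ?_ f5 g3) ?_ ?_ ?_ <;>
      try rw [freeIn_insert, Arrow.isEnd_dir]
    all_goals grind
  have hT : Valid (insert (Arrow.dir r p₂ p₅ true) (insert (Arrow.dir r p₁ q₃ false) A)) := by
    refine Valid.insert_dir (hA.insert_dir ?_ f1 g3) ?_ ?_ ?_ <;>
      try rw [freeIn_insert, Arrow.isEnd_dir]
    all_goals grind
  -- The auxiliary bigon joins `p₂`, `p₃` inside the loop to `q₂`, `q₁` on the other strand of the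
  -- crossing.
  have step1 := flatEq_flat2 (σ := σ) hS (r := r) (a := p₂) (a' := p₃) (b := q₂) (b' := q₁)
    (by simp only [List.nodup_cons, List.mem_cons, List.not_mem_nil, or_false, not_or]; grind)
    (by simp only [List.mem_cons, List.not_mem_nil, or_false, forall_eq_or_imp, forall_eq,
          freeIn_insert, Arrow.isEnd_dir]; grind)
    (Or.inl h₂) (Or.inr k₁)
  -- After the third move the crossing at `p₂` has moved to `p₄` and forms a bigon with the one at
  -- `p₃` from the other side.
  have step3 := flatEq_flat2 (σ := σ) hT (r := r) (a := p₄) (a' := p₃) (b := q₂) (b' := q₁)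
    (by simp only [List.nodup_cons, List.mem_cons, List.not_mem_nil, or_false, not_or]; grind)
    (by simp only [List.mem_cons, List.not_mem_nil, or_false, forall_eq_or_imp, forall_eq,
          freeIn_insert, Arrow.isEnd_dir]; grind)
    (Or.inr h₃) (Or.inr k₁)
  refine (step1.trans ?_).trans step3.symm
  refine ⟨step1.right, step3.right, SingularMove.equiv ?_⟩
  -- The strands start at `p₁`, `p₄` and `q₂`. With the flags `r, r, !r` the three arrows are the
  -- double-point, the crossing to be passed and one side of the auxiliary bigon; only the first of
  -- them is a double-point.
  refine SingularMove.flat3 (D := ofPerm σ _ step1.right) ![p₁, p₄, q₂] ⟨?_, ?_⟩ ![r, r, !r]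
    ![true, false, false] ?_ (replace_inPlace step1.right step3.right ?_ ?_)
  · intro i j
    fin_cases i <;> fin_cases j <;> simp <;> grind
  · intro i j
    fin_cases i <;> fin_cases j <;> simp [h₁, h₄, k₂] <;> grind
  · intro i j
    fin_cases i <;> fin_cases j <;> simp
  · rw [triangle_eq]
    intro a
    simp [Diagram.toNext, Diagram.toPrev, h₁, h₄, k₂, Arrow.dir_not]
    tauto
  · intro a
    rw [triangle_eq, triangle_eq]
    have n1 : Arrow.dir r p₁ p₄ true ∉ A := dir_notMem f1
    have n2 : Arrow.dir r p₅ q₃ false ∉ A := dir_notMem f5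
    have n3 : Arrow.dir r p₂ q₂ false ∉ A := dir_notMem f2
    have m : ∀ {r' x y l}, ¬ (x = p₃ ∨ y = p₃) →
        Arrow.dir (!r) p₃ q₁ false ≠ (Arrow.dir r' x y l : Arrow P Bool) := by
      intro r' x y l h h'
      have : (Arrow.dir (!r) p₃ q₁ false : Arrow P Bool).IsEnd p₃ := by simp
      rw [h', Arrow.isEnd_dir] at this
      exact h this
    have m1 : Arrow.dir (!r) p₃ q₁ false ≠ Arrow.dir r p₁ p₄ true := m (by grind)
    have m2 : Arrow.dir (!r) p₃ q₁ false ≠ Arrow.dir r p₅ q₃ false := m (by grind)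
    have m3 : Arrow.dir (!r) p₃ q₁ false ≠ Arrow.dir r p₂ q₂ false := m (by grind)
    have hm : Arrow.dir (!(!r)) p₂ q₂ false = (Arrow.dir r p₂ q₂ false : Arrow P Bool) := by simp
    simp only [Diagram.toNext, Diagram.toPrev, Finset.mem_insert, Set.mem_insert_iff,
      Set.mem_singleton_iff]
    simp [h₁, h₄, k₂, Arrow.dir_not r q₂ p₂, Arrow.dir_not r q₃ p₁]
    by_cases hc : a ∈ A
    · have : a ≠ Arrow.dir r p₁ p₄ true := by rintro rfl; exact n1 hc
      have : a ≠ Arrow.dir r p₅ q₃ false := by rintro rfl; exact n2 hc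
      have : a ≠ Arrow.dir r p₂ q₂ false := by rintro rfl; exact n3 hc
      simp_all
    · by_cases h3 : a = Arrow.dir (!r) p₃ q₁ false
      · subst h3
        simp [m1, m2, m3]
      · simp only [hc, h3]
        tauto

end Moves

/-! ### A circle with room for moves, and the independence of the kink. -/

section Blow

variable {P : Type} [Fintype P] [DecidableEq P]

/-- Every point is replaced by ten consecutive ones. -/
def blow (σ : Equiv.Perm P) : Equiv.Perm (P × Fin 10) :=
  (Equiv.prodCongrRight fun _ => finRotate 10).trans
    (Equiv.prodCongrLeft fun i => if i = 0 then σ else 1)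

theorem blow_apply (σ : Equiv.Perm P) (x : P) (i : Fin 10) :
    blow σ (x, i) = (if i = 9 then σ x else x, i + 1) := by
  have h : ∀ i : Fin 10, i + 1 = 0 ↔ i = 9 := by decide
  simp only [blow, Equiv.trans_apply, Equiv.prodCongrRight_apply, Equiv.prodCongrLeft_apply,
    finRotate_apply, h]
  split_ifs <;> simp

theorem blow_pow (σ : Equiv.Perm P) (x : P) (i : Fin 10) (n : ℕ) :
    (blow σ ^ n) (x, i) = ((σ ^ ((i.val + n) / 10)) x, Fin.ofNat 10 (i.val + n)) := by
  induction n with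
  | zero =>
    rw [add_zero, Nat.div_eq_of_lt i.isLt]
    simp
  | succ n ih =>
    rw [pow_succ', Equiv.Perm.mul_apply, ih, blow_apply]
    have h9 : Fin.ofNat 10 (i.val + n) = 9 ↔ (i.val + n) % 10 = 9 := by
      rw [Fin.ext_iff]; rfl
    have hs : Fin.ofNat 10 (i.val + n) + 1 = Fin.ofNat 10 (i.val + (n + 1)) := by
      rw [Fin.ext_iff, Fin.val_add]
      simp [Fin.ofNat]
      omega
    rw [hs]
    simp only [h9]
    split_ifs with h
    · rw [show (i.val + (n + 1)) / 10 = (i.val + n) / 10 + 1 by omega, pow_succ',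
        Equiv.Perm.mul_apply]
    · rw [show (i.val + (n + 1)) / 10 = (i.val + n) / 10 by omega]

theorem blow_pow_of_lt (σ : Equiv.Perm P) (x : P) (i : Fin 10) (n : ℕ) (h : i.val + n < 10) :
    (blow σ ^ n) (x, i) = (x, ⟨i.val + n, h⟩) := by
  rw [blow_pow, Nat.div_eq_of_lt h]
  simp [Fin.ext_iff, Nat.mod_eq_of_lt h]

theorem flatEq_slide_left {σ : Equiv.Perm P} {A : Finset (Arrow P Bool)} {r l : Bool} {x y z : P}
    (hV : Valid (insert (Arrow.dir r x y l) A)) (hx : FreeIn A x) (hxy : x ≠ y) (k : ℕ)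
    (hz : (σ ^ k) x = z)
    (hk : ∀ j < k, (σ ^ (j + 1)) x ≠ x ∧ (σ ^ (j + 1)) x ≠ y ∧ FreeIn A ((σ ^ (j + 1)) x)) :
    FlatEq σ (insert (Arrow.dir r x y l) A) (insert (Arrow.dir r z y l) A) := by
  have hA : Valid A := hV.mono (Finset.subset_insert _ _)
  have hzA : FreeIn A z ∧ z ≠ y := by
    rcases Nat.eq_zero_or_pos k with rfl | hpos
    · rw [← hz]; exact ⟨hx, hxy⟩
    · obtain ⟨m, rfl⟩ := Nat.exists_eq_succ_of_ne_zero hpos.ne'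
      rw [← hz]
      exact ⟨(hk m (by omega)).2.2, (hk m (by omega)).2.1⟩
  have key := flatEq_slide (σ := σ) hV (x := x) k (by
    intro j hj
    obtain ⟨h1, h2, h3⟩ := hk j hj
    refine ⟨h1, ?_⟩
    rw [freeIn_insert, Arrow.isEnd_dir]
    exact ⟨by rintro (h | h); exacts [h1 h.symm, h2 h.symm], h3⟩)
  rwa [hz, Finset.image_insert, image_map_swap_eq_self hx hzA.1, Arrow.map_dir,
    Equiv.swap_apply_left, Equiv.swap_apply_of_ne_of_ne hxy.symm hzA.2.symm] at key

theorem flatEq_slide_right {σ : Equiv.Perm P} {A : Finset (Arrow P Bool)} {r l : Bool} {x y z : P}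
    (hV : Valid (insert (Arrow.dir r x y l) A)) (hy : FreeIn A y) (hxy : x ≠ y) (k : ℕ)
    (hz : (σ ^ k) y = z)
    (hk : ∀ j < k, (σ ^ (j + 1)) y ≠ y ∧ (σ ^ (j + 1)) y ≠ x ∧ FreeIn A ((σ ^ (j + 1)) y)) :
    FlatEq σ (insert (Arrow.dir r x y l) A) (insert (Arrow.dir r x z l) A) := by
  have := flatEq_slide_left (σ := σ) (r := !r) (l := l) (x := y) (y := x) (z := z) (A := A)
    (by rwa [Arrow.dir_not]) hy hxy.symm k hz hk
  rwa [Arrow.dir_not, Arrow.dir_not] at this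

/-- The arrows of `B` at the first of the ten points. -/
def blowArrows (B : Finset (Arrow P Bool)) : Finset (Arrow (P × Fin 10) Bool) :=
  B.image (Arrow.map fun x => (x, 0))

theorem injective_zero : Function.Injective fun x : P => (x, (0 : Fin 10)) :=
  fun _ _ h => (Prod.mk.inj h).1

theorem Valid.blow {B : Finset (Arrow P Bool)} (h : Valid B) : Valid (blowArrows B) :=
  h.map injective_zero

theorem freeIn_blow_zero {B : Finset (Arrow P Bool)} {x : P} :
    FreeIn (blowArrows B) (x, 0) ↔ FreeIn B x :=
  freeIn_image_of_injective injective_zero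

theorem freeIn_blow {B : Finset (Arrow P Bool)} {x : P} {i : Fin 10} (hi : i ≠ 0) :
    FreeIn (blowArrows B) (x, i) :=
  freeIn_image_of_notMem_range fun _ h => hi (Prod.mk.inj h).2.symm

/-- The arrows of `B` together with a preferred arrow between two of the points that replace `p`. -/
def kinkState (B : Finset (Arrow P Bool)) (p : P) (r : Bool) (i j : Fin 10) :
    Finset (Arrow (P × Fin 10) Bool) :=
  insert (Arrow.dir r (p, i) (p, j) true) (blowArrows B)

variable {σ : Equiv.Perm P} {B : Finset (Arrow P Bool)}

theorem valid_kinkState (hB : Valid B) (p : P) (r : Bool) {i j : Fin 10} (hi : i ≠ 0)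
    (hij : i < j) : Valid (kinkState B p r i j) :=
  hB.blow.insert_dir (by simpa using hij.ne) (freeIn_blow hi) (freeIn_blow (by omega))

theorem flatEq_kinkState (hB : Valid B) (p : P) (r : Bool) {i j : Fin 10} (hi : i ≠ 0)
    (hij : i < j) : FlatEq (blow σ) (kinkState B p r 1 2) (kinkState B p r i j) := by
  have h1 : (1 : Fin 10) < j := by omega
  -- The later end moves first; the way of the earlier end is then free.
  have s1 : FlatEq (blow σ) (kinkState B p r 1 2) (kinkState B p r 1 j) := by
    refine flatEq_slide_right (valid_kinkState hB p r (by decide) (by decide))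
      (freeIn_blow (by decide)) (by simp) (j.val - 2) ?_ ?_
    · rw [blow_pow_of_lt _ _ _ _ (by change 2 + _ < 10; omega)]
      ext <;> simp
      omega
    · intro m hm
      rw [blow_pow_of_lt _ _ _ _ (by change 2 + _ < 10; omega)]
      have hv : ((2 : Fin 10) : ℕ) = 2 := rfl
      refine ⟨?_, ?_, freeIn_blow ?_⟩
      · simp only [ne_eq, Prod.mk.injEq, Fin.ext_iff, hv]; omega
      · simp only [ne_eq, Prod.mk.injEq, Fin.ext_iff, hv, Fin.val_one]; omega
      · simp only [ne_eq, Fin.ext_iff, hv, Fin.val_zero]; omega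
  refine s1.trans ?_
  refine flatEq_slide_left (valid_kinkState hB p r (by decide) h1)
      (freeIn_blow (by decide)) (by simpa using h1.ne) (i.val - 1) ?_ ?_
  · rw [blow_pow_of_lt _ _ _ _ (by change 1 + _ < 10; omega)]
    ext <;> simp
    omega
  · intro m hm
    rw [blow_pow_of_lt _ _ _ _ (by change 1 + _ < 10; omega)]
    refine ⟨?_, ?_, freeIn_blow ?_⟩
    · simp only [ne_eq, Prod.mk.injEq, Fin.ext_iff, Fin.val_one]; omega
    · simp only [ne_eq, Prod.mk.injEq, Fin.ext_iff, Fin.val_one]; omega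
    · simp only [ne_eq, Fin.ext_iff, Fin.val_one, Fin.val_zero]; omega

/-- An ordinary kink is created inside the loop of the double-point and widened until the two
crossings bound a bigon. After the switch the inner crossing, which has the other direction, is the
double-point. Pulling it past the outer crossing leaves that crossing as a removable kink. -/
theorem flatEq_kinkState_not (hB : Valid B) (p : P) (r : Bool) :
    FlatEq (blow σ) (kinkState B p r 1 2) (kinkState B p (!r) 1 2) := by
  have hs : ∀ i : Fin 10, i ≠ 9 → blow σ (p, i) = (p, i + 1) := by
    intro i hi
    rw [blow_apply, if_neg hi]
  have hfree : ∀ i : Fin 10, i ≠ 0 → FreeIn (blowArrows B) (p, i) := fun i hi => freeIn_blow hi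
  have e1 := flatEq_kinkState (σ := σ) hB p r (i := 3) (j := 8) (by decide) (by decide)
  have e2 : FlatEq (blow σ) (kinkState B p r 3 8)
      (insert (Arrow.dir r (p, 5) (p, 4) false) (kinkState B p r 3 8)) := by
    refine flatEq_flat1 e1.right ?_ ?_ (by simp) (Or.inr (hs _ (by decide)))
    · simp [kinkState, freeIn_insert, hfree]
    · simp [kinkState, freeIn_insert, hfree]
  -- Widening the ordinary kink to `7`, `4` makes `3`, `4` and `7`, `8` adjacent, the two sides of a
  -- bigon.
  have e3 : FlatEq (blow σ) (insert (Arrow.dir r (p, 5) (p, 4) false) (kinkState B p r 3 8))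
      (insert (Arrow.dir r (p, 7) (p, 4) false) (kinkState B p r 3 8)) := by
    refine flatEq_slide_left e2.right ?_ (by simp) 2 ?_ ?_
    · simp [kinkState, freeIn_insert, hfree]
    · rw [blow_pow_of_lt _ _ _ _ (by decide)]; rfl
    · intro j hj
      interval_cases j
      · rw [blow_pow_of_lt _ _ _ _ (by decide)]
        simp [kinkState, freeIn_insert, hfree, Fin.ext_iff]
      · rw [blow_pow_of_lt _ _ _ _ (by decide)]
        simp [kinkState, freeIn_insert, hfree, Fin.ext_iff]
  have e4 := flatEq_switch (σ := blow σ) hB.blow (r := r) (a := (p, 3)) (a' := (p, 7))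
    (b := (p, 8)) (b' := (p, 4)) (by simp) (by simp [hfree]) (Or.inl (hs _ (by decide)))
    (Or.inl (hs _ (by decide)))
  -- Read with the direction `!r`, the double-point has the ends `4`, `7`, and the crossing to be
  -- passed has the end `8` behind it and its other end at `3`.
  have e5 := flatEq_pass (σ := blow σ) hB.blow (r := !r) (p₁ := (p, 4)) (p₂ := (p, 5))
    (p₃ := (p, 6)) (p₄ := (p, 7)) (p₅ := (p, 8)) (q₁ := (p, 1)) (q₂ := (p, 2)) (q₃ := (p, 3))
    (by simp) (by simp [hfree]) (hs _ (by decide)) (hs _ (by decide)) (hs _ (by decide))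
    (hs _ (by decide)) (hs _ (by decide)) (hs _ (by decide))
  -- The crossing that was passed now joins the adjacent points `4` and `3`, so a first move removes
  -- it.
  have e6 : FlatEq (blow σ) (kinkState B p (!r) 5 8)
      (insert (Arrow.dir (!r) (p, 4) (p, 3) false) (kinkState B p (!r) 5 8)) := by
    refine flatEq_flat1 (valid_kinkState hB p _ (by decide) (by decide)) ?_ ?_ (by simp)
      (Or.inr (hs _ (by decide)))
    · simp [kinkState, freeIn_insert, hfree]
    · simp [kinkState, freeIn_insert, hfree]
  have e7 := flatEq_kinkState (σ := σ) hB p (!r) (i := 5) (j := 8) (by decide) (by decide)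
  have h34 : insert (Arrow.dir r (p, 7) (p, 4) false) (kinkState B p r 3 8) =
      insert (Arrow.dir r (p, 3) (p, 8) true)
        (insert (Arrow.dir r (p, 7) (p, 4) false) (blowArrows B)) := Finset.insert_comm _ _ _
  have h45 : insert (Arrow.dir r (p, 3) (p, 8) false)
      (insert (Arrow.dir r (p, 7) (p, 4) true) (blowArrows B)) =
      insert (Arrow.dir (!r) (p, 4) (p, 7) true)
        (insert (Arrow.dir (!r) (p, 8) (p, 3) false) (blowArrows B)) := by
    rw [Arrow.dir_not, Arrow.dir_not, Finset.insert_comm]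
  have h56 : insert (Arrow.dir (!r) (p, 5) (p, 8) true)
      (insert (Arrow.dir (!r) (p, 4) (p, 3) false) (blowArrows B)) =
      insert (Arrow.dir (!r) (p, 4) (p, 3) false) (kinkState B p (!r) 5 8) :=
    Finset.insert_comm _ _ _
  rw [← h34] at e4
  rw [← h45, h56] at e5
  exact (((((e1.trans e2).trans e3).trans e4).trans e5).trans e6.symm).trans e7.symm

theorem flatEq_kinkState_type (hB : Valid B) (p : P) (r r' : Bool) :
    FlatEq (blow σ) (kinkState B p r 1 2) (kinkState B p r' 1 2) := by
  by_cases h : r' = r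
  · rw [h]
    exact flatEq_refl (valid_kinkState hB p r (by decide) (by decide))
  · rw [show r' = !r by cases r <;> cases r' <;> simp_all]
    exact flatEq_kinkState_not hB p r

theorem flatEq_kinkState_next_of_free (hB : Valid B) (p : P) (r : Bool) (hp : σ p ≠ p)
    (hz : FreeIn B (σ p)) :
    FlatEq (blow σ) (kinkState B p r 1 2) (kinkState B (σ p) r 1 2) := by
  have hf : ∀ (x : P) (i : Fin 10), FreeIn B x ∨ i ≠ 0 → FreeIn (blowArrows B) (x, i) := by
    intro x i h
    by_cases hi : i = 0
    · subst hi; exact freeIn_blow_zero.2 (h.resolve_right (by simp))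
    · exact freeIn_blow hi
  have s1 : FlatEq (blow σ) (kinkState B p r 1 2)
      (insert (Arrow.dir r (p, 1) (σ p, 2) true) (blowArrows B)) := by
    refine flatEq_slide_right (valid_kinkState hB p r (by decide) (by decide))
      (freeIn_blow (by decide)) (by simp) 10 ?_ ?_
    · rw [blow_pow]; simp
    · intro j hj
      rw [blow_pow]
      interval_cases j <;> simp [hf, hz, hp, Fin.ofNat, Fin.ext_iff]
  refine s1.trans ?_
  refine flatEq_slide_left s1.right (freeIn_blow (by decide)) (by simp) 10 ?_ ?_
  · rw [blow_pow]; simp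
  · intro j hj
    rw [blow_pow]
    interval_cases j <;> simp [hf, hz, hp, Ne.symm hp, Fin.ofNat, Fin.ext_iff]

/-- The kink is placed directly in front of the block of `σ p`, with its type chosen so that
`flatEq_pass` applies. After the pass the three displaced ends slide forward to their final
positions. -/
theorem flatEq_kinkState_next_of_end (hB : Valid B) (p w : P) (r : Bool) (hp : σ p ≠ p)
    (hfp : FreeIn B (σ p)) (hfw : FreeIn B w) (hw : w ≠ σ p) :
    FlatEq (blow σ) (kinkState (insert (Arrow.dir r (σ p) w false) B) p r 1 2)
      (kinkState (insert (Arrow.dir r (σ p) w false) B) (σ p) r 1 2) := by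
  have hB' : Valid (insert (Arrow.dir r (σ p) w false) B) := hB.insert_dir hw.symm hfp hfw
  -- The last points of the block of `v` lie directly before the other end of the crossing and serve
  -- as `q₁` and `q₂`.
  obtain ⟨v, rfl⟩ := σ.surjective w
  have hvp : v ≠ p := fun h => hw (by rw [h])
  have hs : ∀ x (i : Fin 10), i ≠ 9 → blow σ (x, i) = (x, i + 1) := by
    intro x i hi
    rw [blow_apply, if_neg hi]
  have hs9 : ∀ x, blow σ (x, 9) = (σ x, 0) := fun x => by rw [blow_apply, if_pos rfl]; rfl
  have hf : ∀ (x : P) (i : Fin 10), FreeIn B x ∨ i ≠ 0 → FreeIn (blowArrows B) (x, i) := by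
    intro x i h
    by_cases hi : i = 0
    · subst hi; exact freeIn_blow_zero.2 (h.resolve_right (by simp))
    · exact freeIn_blow hi
  have hins : ∀ x i j, kinkState (insert (Arrow.dir r (σ p) (σ v) false) B) x r i j =
      insert (Arrow.dir r (x, i) (x, j) true)
        (insert (Arrow.dir r (σ p, 0) (σ v, 0) false) (blowArrows B)) := by
    intro x i j
    rw [kinkState, blowArrows, Finset.image_insert, Arrow.map_dir]
    rfl
  have e1 := flatEq_kinkState (σ := σ) hB' p r (i := 6) (j := 9) (by decide) (by decide)
  have e2 := flatEq_pass (σ := blow σ) hB.blow (r := r) (p₁ := (p, 6)) (p₂ := (p, 7))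
    (p₃ := (p, 8)) (p₄ := (p, 9)) (p₅ := (σ p, 0)) (q₁ := (v, 8)) (q₂ := (v, 9)) (q₃ := (σ v, 0))
    (by simp [hvp.symm, hw.symm]) (by simp [hf, hfp, hfw]) (hs _ _ (by decide)) (hs _ _ (by decide))
    (hs _ _ (by decide)) (hs9 p) (hs _ _ (by decide)) (hs9 v)
  rw [← hins] at e2
  have e3 : FlatEq (blow σ) (insert (Arrow.dir r (p, 7) (σ p, 0) true)
        (insert (Arrow.dir r (p, 6) (σ v, 0) false) (blowArrows B)))
      (insert (Arrow.dir r (p, 7) (σ p, 2) true)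
        (insert (Arrow.dir r (p, 6) (σ v, 0) false) (blowArrows B))) := by
    refine flatEq_slide_right e2.right ?_ (by simp) 2 ?_ ?_
    · simp [freeIn_insert, hf, hfp, hw]
    · rw [blow_pow]; simp
    · intro j hj
      rw [blow_pow]
      interval_cases j <;> simp [freeIn_insert, hf, hp, hp.symm, Fin.ofNat, Fin.ext_iff]
  have e4 : FlatEq (blow σ) (insert (Arrow.dir r (p, 7) (σ p, 2) true)
        (insert (Arrow.dir r (p, 6) (σ v, 0) false) (blowArrows B)))
      (insert (Arrow.dir r (σ p, 1) (σ p, 2) true)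
        (insert (Arrow.dir r (p, 6) (σ v, 0) false) (blowArrows B))) := by
    refine flatEq_slide_left e3.right ?_ (by simp) 4 ?_ ?_
    · simp [freeIn_insert, hf]
    · rw [blow_pow]; simp
    · intro j hj
      rw [blow_pow]
      interval_cases j <;>
        simp [freeIn_insert, hf, hfp, hw, hp, hp.symm, Fin.ofNat, Fin.ext_iff]
  have e5 : FlatEq (blow σ) (insert (Arrow.dir r (σ p, 1) (σ p, 2) true)
        (insert (Arrow.dir r (p, 6) (σ v, 0) false) (blowArrows B)))
      (insert (Arrow.dir r (σ p, 1) (σ p, 2) true)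
        (insert (Arrow.dir r (σ p, 0) (σ v, 0) false) (blowArrows B))) := by
    rw [Finset.insert_comm, Finset.insert_comm (Arrow.dir r (σ p, 1) (σ p, 2) true)]
    refine flatEq_slide_left ?_ ?_ (by simp) 4 ?_ ?_
    · rw [Finset.insert_comm]; exact e4.right
    · simp [freeIn_insert, hf, hp]
    · rw [blow_pow]; simp
    · intro j hj
      rw [blow_pow]
      interval_cases j <;>
        simp [freeIn_insert, hf, hfp, hw.symm, hp, Fin.ofNat, Fin.ext_iff]
  rw [← hins] at e5
  exact (((e1.trans e2).trans e3).trans e4).trans e5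

/-- At a crossing end the kink first takes the type that can pass and then changes back. The
crossing must not be preferred, since the third move used in the pass carries only one double-point.
-/
theorem flatEq_kinkState_next (hB : Valid B) (hl : ∀ a ∈ B, a.label = false) (p : P)
    (r r' : Bool) : FlatEq (blow σ) (kinkState B p r 1 2) (kinkState B (σ p) r' 1 2) := by
  -- A fixed point is alone on its circle: there is nothing to pass.
  by_cases hp : σ p = p
  · rw [hp]; exact flatEq_kinkState_type hB p r r'
  by_cases hz : FreeIn B (σ p)
  · exact (flatEq_kinkState_next_of_free hB p r hp hz).trans (flatEq_kinkState_type hB _ r r')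
  · simp only [FreeIn, not_forall, not_not] at hz
    obtain ⟨a, ha, hza⟩ := hz
    obtain ⟨s, w, hw, rfl⟩ : ∃ s w, w ≠ σ p ∧ a = Arrow.dir s (σ p) w false := by
      have hne := hB.ne a ha
      have hla := hl a ha
      obtain ⟨t, h, l⟩ := a
      simp only [Arrow.IsEnd] at hza hne hla
      subst hla
      rcases hza with rfl | rfl
      · exact ⟨true, h, hne.symm, rfl⟩
      · exact ⟨false, t, hne, rfl⟩
    have hB' : Valid (B.erase (Arrow.dir s (σ p) w false)) := hB.mono (Finset.erase_subset _ _)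
    have hfree : ∀ x, (Arrow.dir s (σ p) w false).IsEnd x →
        FreeIn (B.erase (Arrow.dir s (σ p) w false)) x := by
      intro x hx b hb hbx
      exact Finset.ne_of_mem_erase hb (hB.disj b (Finset.mem_of_mem_erase hb) _ ha x hbx hx)
    have key := flatEq_kinkState_next_of_end hB' p w s hp (hfree _ (by simp)) (hfree _ (by simp)) hw
    rw [Finset.insert_erase ha] at key
    exact ((flatEq_kinkState_type hB p r s).trans key).trans (flatEq_kinkState_type hB _ s r')

theorem flatEq_kinkState_all (hB : Valid B) (hl : ∀ a ∈ B, a.label = false)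
    (hσ : ∀ x y, σ.SameCycle x y) (p p' : P) (r r' : Bool) :
    FlatEq (blow σ) (kinkState B p r 1 2) (kinkState B p' r' 1 2) := by
  obtain ⟨n, rfl⟩ := (hσ p p').exists_nat_pow_eq
  induction n generalizing r' with
  | zero => exact flatEq_kinkState_type hB p r r'
  | succ n ih =>
    rw [pow_succ', Equiv.Perm.mul_apply]
    exact (ih r').trans (flatEq_kinkState_next hB hl _ r' r')

end Blow

/-! ### Diagrams with a glued kink, and moves in their presence. -/

section Kinked

variable {P : Type} [Fintype P] [DecidableEq P]

/-- The inclusion of the points into those of the diagram that is subdivided twice. -/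
def twice (x : P) : Option (Option P) := some (some x)

theorem twice_injective : Function.Injective (twice : P → Option (Option P)) :=
  fun _ _ h => Option.some_injective _ (Option.some_injective _ h)

/-- Two new points after `p`. -/
def insertTwo (σ : Equiv.Perm P) (p : P) : Equiv.Perm (Option (Option P)) :=
  insertAfter (insertAfter σ p) none

theorem insertTwo_none (σ : Equiv.Perm P) (p : P) : insertTwo σ p none = twice (σ p) := by
  rw [insertTwo, insertAfter_none, insertAfter_none]; rfl

theorem insertTwo_some_none (σ : Equiv.Perm P) (p : P) : insertTwo σ p (some none) = none :=
  insertAfter_self _ _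

theorem insertTwo_self (σ : Equiv.Perm P) (p : P) : insertTwo σ p (twice p) = some none := by
  rw [insertTwo, twice, insertAfter_of_ne _ (by simp), insertAfter_self]

theorem insertTwo_of_ne (σ : Equiv.Perm P) {p x : P} (h : x ≠ p) :
    insertTwo σ p (twice x) = twice (σ x) := by
  rw [insertTwo, twice, insertAfter_of_ne _ (by simp), insertAfter_of_ne _ h]; rfl

/-- The arrows of `B` and a preferred arrow between the two new points. -/
def kinkArrows (B : Finset (Arrow P Bool)) (r : Bool) : Finset (Arrow (Option (Option P)) Bool) :=
  insert (Arrow.dir r (some none) none true) (B.image (Arrow.map twice))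

theorem valid_kinkArrows {B : Finset (Arrow P Bool)} (hB : Valid B) (r : Bool) :
    Valid (kinkArrows B r) := by
  refine (hB.map twice_injective).insert_dir (by simp) ?_ ?_
  · exact freeIn_image_of_notMem_range fun x => by simp [twice]
  · exact freeIn_image_of_notMem_range fun x => by simp [twice]

/-- The diagram with a small kink directly after `p`, whose crossing is preferred. -/
abbrev Diagram.kinked (D : Diagram Bool) (p : D.Pt) (r : Bool) : Diagram Bool :=
  ofPerm (insertTwo D.next p) (kinkArrows D.arrows r) (valid_kinkArrows D.valid r)

/-- The blown-up circle is the kinked one with more auxiliary points: old points go to position `0`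
of their block, the two kink points to positions `1` and `2` of the block of `p`. -/
theorem isotopic_kinked (D : Diagram Bool) (p : D.Pt) (r : Bool) :
    Isotopic (D.kinked p r) (ofPerm (blow D.next) (kinkState D.arrows p r 1 2)
      (valid_kinkState D.valid p r (by decide) (by decide))) := by
  let f : Option (Option D.Pt) → D.Pt × Fin 10
    | none => (p, 2)
    | some none => (p, 1)
    | some (some x) => (x, 0)
  have hrange : ∀ x i, i ≠ 0 → (x = p → i ≠ 1 ∧ i ≠ 2) → (x, i) ∉ Set.range f := by
    rintro x i hi h ⟨_ | _ | y, hy⟩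
    · obtain ⟨rfl, rfl⟩ := Prod.mk.inj hy
      exact (h rfl).2 rfl
    · obtain ⟨rfl, rfl⟩ := Prod.mk.inj hy
      exact (h rfl).1 rfl
    · obtain ⟨rfl, rfl⟩ := Prod.mk.inj hy
      exact hi rfl
  have hcard : 0 < Fintype.card D.Pt := Fintype.card_pos_iff.2 ⟨p⟩
  -- There are ten times as many points as in `D` on one side and two more than in `D` on the other.
  refine isotopic_of_embedding (9 * Fintype.card D.Pt - 2) ?_ f ?_ ?_ ?_ ?_
  · change Fintype.card (D.Pt × Fin 10) = Fintype.card (Option (Option D.Pt)) + _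
    rw [Fintype.card_prod, Fintype.card_option, Fintype.card_option, Fintype.card_fin]
    omega
  · rintro (_ | _ | x) (_ | _ | y) h <;> simp_all [f]
  · change kinkState D.arrows p r 1 2 = Finset.image (Arrow.map f) (kinkArrows D.arrows r)
    rw [kinkState, kinkArrows, Finset.image_insert, Arrow.map_dir, image_map_map]
    rfl
  · change ∀ x : Option (Option D.Pt), ∃ k, (blow D.next ^ (k + 1)) (f x) =
      f (insertTwo D.next p x) ∧
      ∀ j < k, (blow D.next ^ (j + 1)) (f x) ∉ Set.range f
    rintro (_ | _ | x)
    · rw [insertTwo_none]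
      refine ⟨7, ?_, ?_⟩
      · change (blow D.next ^ 8) (p, 2) = (D.next p, 0)
        rw [blow_pow]; simp
      · intro j hj
        change (blow D.next ^ (j + 1)) (p, 2) ∉ _
        rw [blow_pow_of_lt _ _ _ _ (by change 2 + (j + 1) < 10; omega)]
        refine hrange _ _ ?_ fun _ => ?_
        · simp [Fin.ext_iff]
        · simp [Fin.ext_iff]; omega
    · rw [insertTwo_some_none]
      refine ⟨0, ?_, by simp⟩
      change (blow D.next ^ 1) (p, 1) = (p, 2)
      rw [blow_pow]; simp
    · by_cases hx : x = p
      · subst hx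
        change ∃ k, _ = f (insertTwo D.next x (twice x)) ∧ _
        rw [insertTwo_self]
        refine ⟨0, ?_, by simp⟩
        change (blow D.next ^ 1) (x, 0) = (x, 1)
        rw [blow_pow]; simp; rfl
      · change ∃ k, _ = f (insertTwo D.next p (twice x)) ∧ _
        rw [insertTwo_of_ne _ hx]
        refine ⟨9, ?_, ?_⟩
        · change (blow D.next ^ 10) (x, 0) = (D.next x, 0)
          rw [blow_pow]; simp
        · intro j hj
          change (blow D.next ^ (j + 1)) (x, 0) ∉ _
          rw [blow_pow_of_lt _ _ _ _ (by change 0 + (j + 1) < 10; omega)]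
          refine hrange _ _ ?_ fun h => absurd h hx
          simp [Fin.ext_iff]
  · rintro ⟨y, i⟩
    refine ⟨twice y, i.val, ?_⟩
    change (blow D.next ^ i.val) (y, 0) = (y, i)
    rw [blow_pow_of_lt _ _ _ _ (by change 0 + i.val < 10; omega)]
    simp

theorem singularEquiv_kinked {D : Diagram Bool} (hl : ∀ a ∈ D.arrows, a.label = false)
    (hD : D.IsKnot) (p p' : D.Pt) (r r' : Bool) :
    SingularEquiv (D.kinked p r) (D.kinked p' r') := by
  obtain ⟨_, _, h⟩ := flatEq_kinkState_all D.valid hl hD.2 p p' r r'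
  exact ((isotopic_kinked D p r).singularEquiv.trans h).trans
    (isotopic_kinked D p' r').symm.singularEquiv

/-- The kink lives on new points and the replaced arrows on old ones, so the two operations commute;
`p'` is the image of `p`. -/
theorem replace_kinked {D D' : Diagram Bool} {R T : Set (Arrow D.Pt Bool)}
    (h : D.Replace D' R T) (p : D.Pt) (r : Bool) : ∃ p', (D.kinked p r).Replace (D'.kinked p' r)
      (Arrow.map twice '' R) (Arrow.map twice '' T) := by
  obtain ⟨hR, e, hn, hA⟩ := h
  refine ⟨e p, ?_, Equiv.optionCongr (Equiv.optionCongr e), ?_, ?_⟩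
  · rintro _ ⟨a, ha, rfl⟩
    exact Finset.mem_coe.2 (Finset.mem_insert_of_mem (Finset.mem_image_of_mem _ (hR ha)))
  · change ∀ x : Option (Option D.Pt), insertTwo D'.next (e p)
      (Equiv.optionCongr (Equiv.optionCongr e) x) =
        Equiv.optionCongr (Equiv.optionCongr e) (insertTwo D.next p x)
    rintro (_ | _ | x)
    · rw [insertTwo_none]
      change insertTwo D'.next (e p) none = twice (e (D.next p))
      rw [insertTwo_none, hn]
    · rw [insertTwo_some_none]
      exact insertTwo_some_none _ _
    · change insertTwo D'.next (e p) (twice (e x)) =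
        Equiv.optionCongr (Equiv.optionCongr e) (insertTwo D.next p (twice x))
      by_cases hx : x = p
      · subst hx; rw [insertTwo_self, insertTwo_self]; rfl
      · rw [insertTwo_of_ne _ hx, insertTwo_of_ne _ (by simpa using hx), hn]; rfl
  · intro a
    change a.map (Equiv.optionCongr (Equiv.optionCongr e)) ∈ insert _ (Finset.image _ _) ↔
      (a ∈ insert _ (Finset.image _ _) ∧ _) ∨ _
    have he : Function.Injective (Equiv.optionCongr (Equiv.optionCongr e)) := Equiv.injective _
    have h1 : a.map (Equiv.optionCongr (Equiv.optionCongr e)) =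
        Arrow.dir r (some none) none true ↔ a = Arrow.dir r (some none) none true := by
      constructor
      · intro h
        refine Arrow.map_injective he (h.trans ?_)
        rw [Arrow.map_dir]; rfl
      · rintro rfl
        rw [Arrow.map_dir]; rfl
    have hnot : ∀ b : Arrow D.Pt Bool, b.map twice ≠ Arrow.dir r (some none) none true := by
      intro b h
      have : (b.map twice).IsEnd (none : Option (Option D.Pt)) := by rw [h]; simp
      obtain ⟨x, -, hx⟩ := Arrow.isEnd_map.1 this
      simp [twice] at hx
    by_cases hk : a = Arrow.dir r (some none) none true
    · have h2 : a ∉ Arrow.map twice '' R := by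
        rintro ⟨b, -, hb⟩; exact hnot b (hb.trans hk)
      simp [hk, hk ▸ h2]
    · by_cases ha : ∃ b : Arrow D.Pt Bool, b.map twice = a
      · obtain ⟨b, rfl⟩ := ha
        have h2 : (b.map twice).map (Equiv.optionCongr (Equiv.optionCongr e)) =
          (b.map e).map twice := rfl
        rw [Finset.mem_insert, Finset.mem_insert, h1, h2,
          (Arrow.map_injective twice_injective).mem_finset_image,
          (Arrow.map_injective twice_injective).mem_finset_image,
          (Arrow.map_injective twice_injective).mem_set_image,
          (Arrow.map_injective twice_injective).mem_set_image, hA]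
        simp [hk]
      · have h2 : ∀ S : Set (Arrow D.Pt Bool), a ∉ Arrow.map twice '' S := by
          rintro S ⟨b, -, hb⟩; exact ha ⟨b, hb⟩
        have h3 : a ∉ D.arrows.image (Arrow.map twice) := by
          intro h
          obtain ⟨b, -, hb⟩ := Finset.mem_image.1 h
          exact ha ⟨b, hb⟩
        have h4 : a.map (Equiv.optionCongr (Equiv.optionCongr e)) ∉
            D'.arrows.image (Arrow.map twice) := by
          intro h
          obtain ⟨b, -, hb⟩ := Finset.mem_image.1 h
          refine ha ⟨b.map e.symm, Arrow.map_injective he (Eq.trans ?_ hb)⟩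
          change (b.map e.symm).map (twice ∘ e) = b.map twice
          rw [Arrow.map_map, Function.comp_assoc, e.self_comp_symm]
          rfl
        rw [Finset.mem_insert, Finset.mem_insert, h1]
        simp only [hk, h2, h3, h4]
        simp

theorem free_kinked {D : Diagram Bool} {p : D.Pt} {r : Bool} {x : D.Pt} (hx : D.Free x) :
    (D.kinked p r).Free (twice x) := by
  change FreeIn (kinkArrows D.arrows r) _
  rw [kinkArrows, freeIn_insert, Arrow.isEnd_dir, freeIn_image_of_injective twice_injective]
  exact ⟨by simp [twice], hx⟩

/-- A kink inserted after `p` separates only `p` from its successor, which is why `p` is excluded as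
the first point of the pair. -/
theorem adj_kinked {D : Diagram Bool} {p : D.Pt} {r : Bool} {x y : D.Pt} (hne : x ≠ y)
    (h : (D.next x = y ∧ x ≠ p) ∨ (D.next y = x ∧ y ≠ p)) :
    (D.kinked p r).Adj (twice x) (twice y) := by
  refine ⟨twice_injective.ne hne, ?_⟩
  rcases h with ⟨h, hp⟩ | ⟨h, hp⟩
  · left
    exact (insertTwo_of_ne _ hp).trans (congrArg twice h)
  · right
    exact (insertTwo_of_ne _ hp).trans (congrArg twice h)

/-- A move between diagrams without double-points can be performed in the presence of a kink that
lies away from it. The place of the kink is free by `singularEquiv_kinked`, so it suffices to find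
one good place for each move. -/
theorem SingularMove.kinked {D D' : Diagram Bool} (h : SingularMove D D') (hD : Nonempty D.Pt)
    (hl : ∀ a ∈ D.arrows, a.label = false) (r : Bool) :
    ∃ p p', SingularEquiv (D.kinked p r) (D'.kinked p' r) := by
  cases h with
  | homeo h =>
    obtain ⟨p⟩ := hD
    obtain ⟨p', h'⟩ := replace_kinked h p r
    rw [Set.image_empty] at h'
    exact ⟨p, p', (SingularMove.homeo h').equiv⟩
  | subdivide q =>
    refine ⟨q, (some q : Option D.Pt),
      ((SingularMove.subdivide _ (none : Option (Option D.Pt))).equiv).trans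
      (SingularMove.homeo ?_).equiv⟩
    -- the points `q`, `k`, `l`, `n` follow each other in both diagrams
    let f : Option (Option (Option D.Pt)) → Option (Option (Option D.Pt))
      | none => some (some none)
      | some none => none
      | some (some none) => some none
      | some (some (some x)) => some (some (some x))
    let g : Option (Option (Option D.Pt)) → Option (Option (Option D.Pt))
      | some (some none) => none
      | none => some none
      | some none => some (some none)
      | some (some (some x)) => some (some (some x))
    have hfg : Function.LeftInverse g f := by rintro (_ | _ | _ | x) <;> rfl
    have hgf : Function.RightInverse g f := by rintro (_ | _ | _ | x) <;> rfl
    refine replace_empty ⟨f, g, hfg, hgf⟩ ?_ ?_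
    · change ∀ x : Option (Option (Option D.Pt)),
        insertTwo (insertAfter D.next q) (some q) (f x) =
          f (insertAfter (insertTwo D.next q) none x)
      rintro (_ | _ | _ | x)
      · rw [insertAfter_none, insertTwo_none]
        change insertTwo (insertAfter D.next q) (some q) (twice none) = _
        rw [insertTwo_of_ne _ (by simp), insertAfter_none]
        rfl
      · rw [insertAfter_self]
        change insertTwo (insertAfter D.next q) (some q) none = _
        rw [insertTwo_none, insertAfter_self]
        rfl
      · rw [insertAfter_of_ne _ (by simp), insertTwo_some_none]
        exact (congrArg (fun u => f (some u)) (insertTwo_some_none D.next q)).symm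
      · rw [insertAfter_of_ne (insertTwo D.next q) (x := some (some x)) (by simp)]
        change insertTwo (insertAfter D.next q) (some q) (twice (some x)) =
          f (some (insertTwo D.next q (twice x)))
        by_cases hx : x = q
        · subst hx
          rw [insertTwo_self, insertTwo_self]
        · rw [insertTwo_of_ne _ (by simpa using hx), insertTwo_of_ne _ hx, insertAfter_of_ne _ hx]
          rfl
    · change insert _ (Finset.image (Arrow.map twice) (Finset.image (Arrow.map some) D.arrows)) =
        Finset.image (Arrow.map f) (Finset.image (Arrow.map some)
          (insert _ (Finset.image (Arrow.map twice) D.arrows)))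
      rw [Finset.image_insert, Finset.image_insert, image_map_map, image_map_map, image_map_map,
        Arrow.map_dir, Arrow.map_dir]
      rfl
  | flat1 a b ha hb hab h =>
    -- The kink goes behind the later of the two points.
    obtain ⟨p, hp⟩ : ∃ p, (D.next a = b ∧ a ≠ p) ∨ (D.next b = a ∧ b ≠ p) := by
      rcases hab.2 with h | h
      · exact ⟨b, Or.inl ⟨h, hab.1⟩⟩
      · exact ⟨a, Or.inr ⟨h, hab.1.symm⟩⟩
    obtain ⟨p', h'⟩ := replace_kinked h p r
    rw [Set.image_empty, Set.image_singleton] at h'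
    exact ⟨p, p', (SingularMove.flat1 _ _ (free_kinked ha) (free_kinked hb)
      (adj_kinked hab.1 hp) h').equiv⟩
  | flat2 a a' b b' hd hf haa hbb h =>
    have hd' := hd
    simp only [List.nodup_cons, List.mem_cons, List.not_mem_nil, or_false, not_or] at hd'
    -- Behind the later point of the pair `a`, `a'` the kink cannot separate `b` from `b'` either.
    obtain ⟨p, hp, hpb, hpb'⟩ : ∃ p, ((D.next a = a' ∧ a ≠ p) ∨ (D.next a' = a ∧ a' ≠ p)) ∧
        b ≠ p ∧ b' ≠ p := by
      rcases haa.2 with h | h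
      · exact ⟨a', Or.inl ⟨h, haa.1⟩, by grind⟩
      · exact ⟨a, Or.inr ⟨h, haa.1.symm⟩, by grind⟩
    obtain ⟨p', h'⟩ := replace_kinked h p r
    rw [Set.image_empty, Set.image_pair] at h'
    refine ⟨p, p', (SingularMove.flat2 (twice a) (twice a') (twice b) (twice b') ?_ ?_
      (adj_kinked haa.1 hp) (adj_kinked hbb.1 ?_) h').equiv⟩
    · exact (List.nodup_map_iff twice_injective).2 hd
    · simp only [List.mem_cons, List.not_mem_nil, or_false, forall_eq_or_imp, forall_eq] at hf ⊢
      exact ⟨free_kinked hf.1, free_kinked hf.2.1, free_kinked hf.2.2.1, free_kinked hf.2.2.2⟩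
    · rcases hbb.2 with h | h
      · exact Or.inl ⟨h, hpb⟩
      · exact Or.inr ⟨h, hpb'⟩
  | flat3 x hx s l hl h =>
    -- The second point of a strand is never the first point of a strand, so no strand is cut by the
    -- kink.
    obtain ⟨p', h'⟩ := replace_kinked h (D.next (x 0)) r
    have hxp : ∀ i, insertTwo D.next (D.next (x 0)) (twice (x i)) = twice (D.next (x i)) :=
      fun i => insertTwo_of_ne _ (hx.2 0 i).symm
    have hN : (D.kinked (D.next (x 0)) r).toNext (fun i => twice (x i)) s =
        fun i => twice (D.toNext x s i) := by
      funext i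
      change (if _ then insertTwo D.next (D.next (x 0)) (twice (x i)) else twice (x i)) = _
      rw [hxp, Diagram.toNext]
      split_ifs <;> rfl
    have hP : (D.kinked (D.next (x 0)) r).toPrev (fun i => twice (x i)) s =
        fun i => twice (D.toPrev x s i) := by
      funext i
      change (if _ then twice (x i) else insertTwo D.next (D.next (x 0)) (twice (x i))) = _
      rw [hxp, Diagram.toPrev]
      split_ifs <;> rfl
    have htri : ∀ u v : Fin 3 → D.Pt, Arrow.map twice '' triangle s l u v =
        triangle s l (fun i => twice (u i)) (fun i => twice (v i)) := by
      intro u v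
      rw [triangle, triangle, ← Set.range_comp]
      congr 1
      funext i
      simp only [Function.comp]
      split_ifs <;> rfl
    refine ⟨D.next (x 0), p', (SingularMove.flat3 (fun i => twice (x i)) ⟨?_, ?_⟩ s l hl ?_).equiv⟩
    · exact twice_injective.comp hx.1
    · intro i j
      change insertTwo D.next (D.next (x 0)) (twice (x i)) ≠ twice (x j)
      rw [hxp]
      exact twice_injective.ne (hx.2 i j)
    · rw [hN, hP]
      rw [htri, htri] at h'
      exact h'
  | switch a a' b b' hab hba h =>
    -- The switch needs a double-point, and there is none.
    have := hl _ (h.1 (Or.inl rfl))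
    simp at this

end Kinked

/-! ### From moves of Gauss diagrams to moves of flat diagrams. -/

section Flatten

theorem Arrow.map_flat {P Q L : Type} (f : P → Q) (a : Arrow P ℤˣ) (l : L) :
    (a.flat l).map f = (a.map f).flat l := by
  unfold Arrow.flat
  split_ifs with h h' h'
  · rfl
  · exact absurd h h'
  · exact absurd h' h
  · rfl

@[simp] theorem Arrow.label_flat {P L : Type} (a : Arrow P ℤˣ) (l : L) : (a.flat l).label = l := by
  unfold Arrow.flat
  split_ifs <;> rfl

variable {L : Type} [DecidableEq L]

theorem eq_of_flat_eq {D : Diagram ℤˣ} {a b : Arrow D.Pt ℤˣ} (ha : a ∈ D.arrows)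
    (hb : b ∈ D.arrows) {l l' : L} (h : a.flat l = b.flat l') : a = b := by
  refine D.disjoint a ha b hb a.tail (Or.inl rfl) ?_
  rw [← Arrow.isEnd_flat b l', ← h, Arrow.isEnd_flat]
  exact Or.inl rfl

theorem valid_flat (D : Diagram ℤˣ) (g : Arrow D.Pt ℤˣ → L) :
    Valid (D.arrows.image fun a => a.flat (g a)) :=
  (D.flatten g).valid

/-- The diagram `D.flatten g`, in a form that unfolds. -/
abbrev Diagram.flat (D : Diagram ℤˣ) (g : Arrow D.Pt ℤˣ → L) : Diagram L :=
  ofPerm D.next (D.arrows.image fun a => a.flat (g a)) (valid_flat D g)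

/-- Arrows of a diagram have disjoint ends, so flattening is injective on them and commutes with
removal. The labels have to agree only on the arrows that are kept; the others take the labels given
by `g` and `g'`. -/
theorem replace_flatten {D D' : Diagram ℤˣ} {R T : Set (Arrow D.Pt ℤˣ)} (hR : R ⊆ D.arrows)
    (e : D.Pt ≃ D'.Pt) (hn : ∀ x, D'.next (e x) = e (D.next x))
    (hA : ∀ a : Arrow D.Pt ℤˣ, a.map e ∈ D'.arrows ↔ (a ∈ D.arrows ∧ a ∉ R) ∨ a ∈ T)
    (g : Arrow D.Pt ℤˣ → L) (g' : Arrow D'.Pt ℤˣ → L)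
    (hg : ∀ a ∈ D.arrows, a ∉ R → g' (a.map e) = g a) :
    (D.flat g).Replace (D'.flat g') ((fun a => a.flat (g a)) '' R)
      ((fun a => a.flat (g' (a.map e))) '' T) := by
  refine ⟨?_, e, hn, fun c => ?_⟩
  · rintro _ ⟨a, ha, rfl⟩
    exact Finset.mem_coe.2 (Finset.mem_image_of_mem (fun a : Arrow D.Pt ℤˣ => a.flat (g a)) (hR ha))
  · change c.map e ∈ Finset.image (fun a : Arrow D'.Pt ℤˣ => a.flat (g' a)) D'.arrows ↔
      (c ∈ Finset.image (fun a : Arrow D.Pt ℤˣ => a.flat (g a)) D.arrows ∧ _) ∨ _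
    rw [Finset.mem_image, Finset.mem_image]
    constructor
    · rintro ⟨a', ha', h⟩
      obtain ⟨a, rfl⟩ : ∃ a : Arrow D.Pt ℤˣ, a.map e = a' :=
        ⟨a'.map e.symm, by rw [Arrow.map_map, e.self_comp_symm]; rfl⟩
      rw [← Arrow.map_flat] at h
      obtain rfl := Arrow.map_injective e.injective h
      rcases (hA a).1 ha' with ⟨ha, haR⟩ | haT
      · left
        rw [hg a ha haR]
        refine ⟨⟨a, ha, rfl⟩, ?_⟩
        rintro ⟨b, hb, hba⟩
        exact haR (eq_of_flat_eq (hR hb) ha hba ▸ hb)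
      · exact Or.inr ⟨a, haT, rfl⟩
    · rintro (⟨⟨a, ha, rfl⟩, haR⟩ | ⟨a, haT, rfl⟩)
      · have haR' : a ∉ R := fun h => haR ⟨a, h, rfl⟩
        exact ⟨a.map e, (hA a).2 (Or.inl ⟨ha, haR'⟩), by rw [hg a ha haR', Arrow.map_flat]⟩
      · exact ⟨a.map e, (hA a).2 (Or.inr haT), by rw [Arrow.map_flat]⟩

theorem flatten_subdivide (D : Diagram ℤˣ) (p : D.Pt) (g : Arrow D.Pt ℤˣ → L)
    (g' : Arrow (D.subdivide p).Pt ℤˣ → L) (hg : ∀ a ∈ D.arrows, g' (a.map some) = g a) :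
    ((D.flat g).subdivide p).Replace ((D.subdivide p).flat g') ∅ ∅ := by
  refine replace_empty (Equiv.refl _) (fun _ => rfl) ?_
  change Finset.image (fun a : Arrow (Option D.Pt) ℤˣ => a.flat (g' a))
    (Finset.image (Arrow.map some) D.arrows) = Finset.image (Arrow.map fun x => x)
      (Finset.image (Arrow.map some) (Finset.image (fun a => a.flat (g a)) D.arrows))
  rw [image_map_id, Finset.image_image, Finset.image_image]
  refine Finset.image_congr fun a ha => ?_
  have h : (a.map some).flat (g' (a.map some)) = (a.map (some : D.Pt → Option D.Pt)).flat (g a) :=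
    congrArg _ (hg a ha)
  exact h.trans (Arrow.map_flat _ _ _).symm

theorem Arrow.flat_mk {P : Type} (a b : P) (ε : ℤˣ) (l : L) :
    (⟨a, b, ε⟩ : Arrow P ℤˣ).flat l = Arrow.dir (decide (ε = 1)) a b l := by
  unfold Arrow.flat Arrow.dir
  simp

theorem unit_neg_eq_one {ε : ℤˣ} : -ε = 1 ↔ ¬ ε = 1 := by
  rcases Int.units_eq_one_or ε with rfl | rfl <;> decide

theorem SingularMove.flat1_dir {D D' : Diagram Bool} {r : Bool} {a b : D.Pt}
    (ha : D.Free a) (hb : D.Free b) (hab : D.Adj a b)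
    (h : D.Replace D' ∅ {Arrow.dir r a b false}) : SingularMove D D' := by
  cases r
  · exact SingularMove.flat1 b a hb ha ⟨hab.1.symm, hab.2.symm⟩ h
  · exact SingularMove.flat1 a b ha hb hab h

theorem SingularMove.flat2_dir {D D' : Diagram Bool} {r : Bool} {a a' b b' : D.Pt}
    (hd : [a, a', b, b'].Nodup) (hf : ∀ x ∈ [a, a', b, b'], D.Free x) (haa : D.Adj a a')
    (hbb : D.Adj b b')
    (h : D.Replace D' ∅ {Arrow.dir r a b false, Arrow.dir (!r) a' b' false}) :
    SingularMove D D' := by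
  cases r
  · refine SingularMove.flat2 b b' a a' ?_ ?_ hbb haa h
    · simp only [List.nodup_cons, List.mem_cons, List.not_mem_nil, or_false, not_or] at hd ⊢
      grind
    · intro x hx
      exact hf x (by simp at hx ⊢; tauto)
  · exact SingularMove.flat2 a a' b b' hd hf haa hbb h

theorem free_flatten {D : Diagram ℤˣ} {g : Arrow D.Pt ℤˣ → L} {x : D.Pt} (hx : D.Free x) :
    (D.flat g).Free x := by
  intro a ha
  obtain ⟨b, hb, rfl⟩ := Finset.mem_image.1 ha
  rw [Arrow.isEnd_flat]
  exact hx b hb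

/-- The flag `s` combines height and sign so that it is the direction of the flat arrow. Thus the
third move of Gauss diagrams flattens to the flat one with the same flags. -/
theorem flat_triangle {P : Type} {o s : Bool} {ε : ℤˣ} (hs : s = true ↔ (o = true ↔ ε = 1))
    (p q : P) (l : L) : (if o then (⟨p, q, ε⟩ : Arrow P ℤˣ) else ⟨q, p, ε⟩).flat l =
      if s then ⟨p, q, l⟩ else ⟨q, p, l⟩ := by
  by_cases hε : ε = 1 <;> cases o <;> cases s <;> simp_all [Arrow.flat]

/-- The three arrows of a triangle are distinct; so a labelling with at most one preferred crossing
prefers at most one of them, as the singular third move demands. -/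
theorem triangle_injective {D : Diagram L} {x : Fin 3 → D.Pt} (hx : D.Strands x)
    {s o : Fin 3 → Bool} {M : Type} [DecidableEq M] {l : Fin 3 → M} {i j : Fin 3}
    (h : (if o i then (⟨D.toNext x s i, D.toPrev x s (i + 1), l i⟩ : Arrow D.Pt M)
        else ⟨D.toPrev x s (i + 1), D.toNext x s i, l i⟩) =
      if o j then ⟨D.toNext x s j, D.toPrev x s (j + 1), l j⟩
        else ⟨D.toPrev x s (j + 1), D.toNext x s j, l j⟩) : i = j := by
  have hi := isEnd_triangle (b := o i) (u := D.toNext x s i) (v := D.toPrev x s (i + 1))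
    (l := l i) (z := D.toNext x s i) |>.2 (Or.inl rfl)
  rw [h, isEnd_triangle] at hi
  have hne : ∀ i j, x i = x j → i = j := fun i j h => hx.1 h
  have hne' : ∀ i j, D.next (x i) = D.next (x j) → i = j := fun i j h => hx.1 (D.next.injective h)
  have h1 := toNext_or x s i
  have h2 := toNext_or x s j
  have h3 := toNext_or x s (j + 1)
  have hx2 := hx.2
  have hij : D.toPrev x s (j + 1) = D.toNext x s i → i = j + 1 := by
    intro h
    rcases h1 with ⟨h1, -⟩ | ⟨h1, -⟩ <;> rcases h3 with ⟨-, h3⟩ | ⟨-, h3⟩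
    · exact absurd (h3.symm.trans (h.trans h1)) (hx2 _ _)
    · exact (hne _ _ (h3.symm.trans (h.trans h1))).symm
    · exact (hne' _ _ (h3.symm.trans (h.trans h1))).symm
    · exact absurd (h3.symm.trans (h.trans h1)).symm (hx2 _ _)
  rcases hi with hi | hi
  · rcases h1 with ⟨h1, -⟩ | ⟨h1, -⟩ <;> rcases h2 with ⟨h2, -⟩ | ⟨h2, -⟩
    · exact (hne _ _ (h2.symm.trans (hi.trans h1))).symm
    · exact absurd (h2.symm.trans (hi.trans h1)) (hx2 _ _)
    · exact absurd (h2.symm.trans (hi.trans h1)).symm (hx2 _ _)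
    · exact (hne' _ _ (h2.symm.trans (hi.trans h1))).symm
  · have := hij hi
    subst this
    rcases h1 with ⟨h1, h1'⟩ | ⟨h1, h1'⟩
    · rw [h1, h1'] at hi
      exact absurd hi (hx2 _ _)
    · rw [h1, h1'] at hi
      exact absurd hi.symm (hx2 _ _)

/-- The part of a move of Gauss diagrams that concerns the arrows: up to the homeomorphism `f`, the
diagrams have the same arrows, apart from those in `N`, which are new. -/
def IsMove (D D' : Diagram ℤˣ) (f : D.Pt → D'.Pt) (N : Finset (Arrow D.Pt ℤˣ)) : Prop :=
  D'.arrows = (D.arrows ∪ N).image (Arrow.map f) ∧ Disjoint D.arrows N ∧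
    ∀ (g : Arrow D.Pt ℤˣ → Bool) (g' : Arrow D'.Pt ℤˣ → Bool),
      (∀ a ∈ D.arrows, ∀ b ∈ D.arrows, g a = true → g b = true → a = b) →
      (∀ a ∈ D.arrows, g' (a.map f) = g a) → (∀ a ∈ N, g' (a.map f) = false) →
      ∃ E, SingularMove (D.flat g) E ∧ E.Replace (D'.flat g') ∅ ∅

theorem isMove_of_singularMove {D D' : Diagram ℤˣ} {f : D.Pt → D'.Pt}
    {N : Finset (Arrow D.Pt ℤˣ)} (h₁ : D'.arrows = (D.arrows ∪ N).image (Arrow.map f))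
    (h₂ : Disjoint D.arrows N) (h₃ : ∀ (g : Arrow D.Pt ℤˣ → Bool) (g' : Arrow D'.Pt ℤˣ → Bool),
      (∀ a ∈ D.arrows, ∀ b ∈ D.arrows, g a = true → g b = true → a = b) →
      (∀ a ∈ D.arrows, g' (a.map f) = g a) → (∀ a ∈ N, g' (a.map f) = false) →
      SingularMove (D.flat g) (D'.flat g')) : IsMove D D' f N :=
  ⟨h₁, h₂, fun g g' hg hg' hN => ⟨_, h₃ g g' hg hg' hN, Diagram.replace_refl _⟩⟩

theorem arrows_of_replace {D D' : Diagram ℤˣ} {N : Finset (Arrow D.Pt ℤˣ)} (e : D.Pt ≃ D'.Pt)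
    (hA : ∀ a : Arrow D.Pt ℤˣ, a.map e ∈ D'.arrows ↔
      (a ∈ D.arrows ∧ a ∉ (∅ : Set (Arrow D.Pt ℤˣ))) ∨ a ∈ (N : Set (Arrow D.Pt ℤˣ))) :
    D'.arrows = (D.arrows ∪ N).image (Arrow.map e) := by
  ext c
  obtain ⟨a, rfl⟩ : ∃ a : Arrow D.Pt ℤˣ, a.map e = c :=
    ⟨c.map e.symm, by rw [Arrow.map_map, e.self_comp_symm]; rfl⟩
  rw [hA, (Arrow.map_injective e.injective).mem_finset_image, Finset.mem_union]
  simp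

theorem isMove_homeo {D D' : Diagram ℤˣ} (h : D.Replace D' ∅ ∅) :
    ∃ f, Function.Injective f ∧ IsMove D D' f ∅ := by
  obtain ⟨hR, e, hn, hA⟩ := h
  refine ⟨e, e.injective, isMove_of_singularMove (arrows_of_replace e (by simpa using hA))
    (Finset.disjoint_empty_right _) fun g g' _ hg' _ => ?_⟩
  have := replace_flatten hR e hn hA g g' fun a ha _ => hg' a ha
  rw [Set.image_empty, Set.image_empty] at this
  exact SingularMove.homeo this

/-- Flattening and subdividing are compared through a homeomorphism that is the identity on points.
This is the purpose of the intermediate diagram in `IsMove`. -/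
theorem isMove_subdivide (D : Diagram ℤˣ) (p : D.Pt) :
    IsMove D (D.subdivide p) (some : D.Pt → Option D.Pt) ∅ := by
  refine ⟨?_, Finset.disjoint_empty_right _, fun g g' _ hg' _ =>
    ⟨_, SingularMove.subdivide _ p, flatten_subdivide D p g g' hg'⟩⟩
  rw [Finset.union_empty]
  rfl

theorem isMove_reidemeister1 {D D' : Diagram ℤˣ} {a b : D.Pt} {ε : ℤˣ} (ha : D.Free a)
    (hb : D.Free b) (hab : D.Adj a b) (h : D.Replace D' ∅ {⟨a, b, ε⟩}) :
    ∃ f : D.Pt ≃ D'.Pt, IsMove D D' f {⟨a, b, ε⟩} ∧ ∀ x, D'.next (f x) = f (D.next x) := by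
  obtain ⟨hR, e, hn, hA⟩ := h
  refine ⟨e, isMove_of_singularMove (arrows_of_replace e (by simpa using hA)) ?_
    fun g g' _ hg' hN => ?_, hn⟩
  · rw [Finset.disjoint_singleton_right]
    exact fun h => ha _ h (Or.inl rfl)
  · have := replace_flatten hR e hn hA g g' fun a ha _ => hg' a ha
    rw [Set.image_empty, Set.image_singleton, hN _ (Finset.mem_singleton_self _),
      Arrow.flat_mk] at this
    exact SingularMove.flat1_dir (free_flatten ha) (free_flatten hb) hab this

theorem isMove_reidemeister2 {D D' : Diagram ℤˣ} {a a' b b' : D.Pt} {ε : ℤˣ}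
    (hd : [a, a', b, b'].Nodup) (hf : ∀ x ∈ [a, a', b, b'], D.Free x)
    (haa : D.Adj a a') (hbb : D.Adj b b')
    (h : D.Replace D' ∅ {⟨a, b, ε⟩, ⟨a', b', -ε⟩}) :
    ∃ f : D.Pt ≃ D'.Pt, IsMove D D' f {⟨a, b, ε⟩, ⟨a', b', -ε⟩} ∧
      ∀ x, D'.next (f x) = f (D.next x) := by
  obtain ⟨hR, e, hn, hA⟩ := h
  refine ⟨e, isMove_of_singularMove (arrows_of_replace e (by simpa using hA)) ?_
    fun g g' _ hg' hN => ?_, hn⟩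
  · rw [Finset.disjoint_insert_right, Finset.disjoint_singleton_right]
    exact ⟨fun h => hf a (by simp) _ h (Or.inl rfl), fun h => hf a' (by simp) _ h (Or.inl rfl)⟩
  · have := replace_flatten hR e hn hA g g' fun a ha _ => hg' a ha
    rw [Set.image_empty, Set.image_pair, hN _ (by simp), hN _ (by simp),
      Arrow.flat_mk, Arrow.flat_mk, decide_eq_decide.2 unit_neg_eq_one, decide_not] at this
    exact SingularMove.flat2_dir hd (fun x hx => free_flatten (hf x hx)) haa hbb this

/-- No crossing is created: the strand exchange followed by the homeomorphism matches all crossings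
of the two diagrams, so the set of new arrows is empty. -/
theorem isMove_reidemeister3 {D D' : Diagram ℤˣ} {x : Fin 3 → D.Pt} (hx : D.Strands x)
    {o : Fin 3 → Bool} {ε : Fin 3 → ℤˣ} {s : Fin 3 → Bool}
    (hs : ∀ i, s i = true ↔ (o i = true ↔ ε i = 1))
    (h : D.Replace D' (triangle o ε (D.toNext x s) (D.toPrev x s))
      (triangle o ε (D.toPrev x s) (D.toNext x s))) :
    ∃ f, Function.Injective f ∧ IsMove D D' f ∅ := by
  obtain ⟨hR, e, hn, hA⟩ := h
  obtain ⟨τ, h1, h2, h3⟩ := exists_strandSwap D.next hx.2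
  have harr := arrows_of_triangle h1 h2 h3 e hR hA
  refine ⟨τ.trans e, (τ.trans e).injective, isMove_of_singularMove
    (by rw [Finset.union_empty]; exact harr) (Finset.disjoint_empty_right _)
    fun g g' hg hg' _ => ?_⟩
  have hτn : ∀ i, τ (D.toNext x s i) = D.toPrev x s i := by
    intro i
    rcases toNext_or x s i with h | h <;> simp [h.1, h.2, h1, h2]
  have hτp : ∀ i, τ (D.toPrev x s i) = D.toNext x s i := by
    intro i
    rcases toNext_or x s i with h | h <;> simp [h.1, h.2, h1, h2]
  have hfix : ∀ a ∈ D.arrows, a ∉ triangle o ε (D.toNext x s) (D.toPrev x s) → a.map τ = a := by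
    intro a ha haR
    refine Arrow.map_eq_self fun u hu => h3 u fun i => ?_
    have hN : D.toNext x s i ≠ u := by
      intro h
      have hm : _ ∈ triangle o ε (D.toNext x s) (D.toPrev x s) := ⟨i, rfl⟩
      exact haR (D.disjoint _ ha _ (hR hm) u hu (isEnd_triangle.2 (Or.inl h)) ▸ hm)
    have hP : D.toPrev x s i ≠ u := by
      intro h
      have hm : _ ∈ triangle o ε (D.toNext x s) (D.toPrev x s) := ⟨i + 2, rfl⟩
      have hi : i + 2 + 1 = i := by rw [add_assoc]; exact add_zero i
      refine haR (D.disjoint _ ha _ (hR hm) u hu (isEnd_triangle.2 (Or.inr ?_)) ▸ hm)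
      rw [hi, h]
    rcases toNext_or x s i with h | h
    · exact ⟨h.1 ▸ hN.symm, h.2 ▸ hP.symm⟩
    · exact ⟨h.2 ▸ hP.symm, h.1 ▸ hN.symm⟩
  have hrep := replace_flatten hR e hn hA g g' fun a ha haR => by
    rw [← hg' a ha]
    conv_lhs => rw [← hfix a ha haR]
    rfl
  let c : Fin 3 → Arrow D.Pt ℤˣ := fun i =>
    if o i then ⟨D.toNext x s i, D.toPrev x s (i + 1), ε i⟩
      else ⟨D.toPrev x s (i + 1), D.toNext x s i, ε i⟩
  have hc : ∀ i, c i ∈ D.arrows := fun i => hR ⟨i, rfl⟩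
  have hcτ : ∀ i, (c i).map τ = if o i then ⟨D.toPrev x s i, D.toNext x s (i + 1), ε i⟩
      else ⟨D.toNext x s (i + 1), D.toPrev x s i, ε i⟩ := by
    intro i
    simp only [c]
    split_ifs <;> simp [Arrow.map, hτn, hτp]
  refine SingularMove.flat3 (D := D.flat g) x hx s (fun i => g (c i)) ?_ ?_
  · intro i j hi hj
    exact triangle_injective hx (hg _ (hc i) _ (hc j) hi hj)
  · convert hrep using 1
    · rw [triangle, triangle, ← Set.range_comp]
      congr 1
      funext i
      exact (flat_triangle (hs i) _ _ _).symm
    · rw [triangle, triangle, ← Set.range_comp]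
      congr 1
      funext i
      simp only [Function.comp]
      rw [flat_triangle (hs i), ← hcτ, ← hg' _ (hc i)]
      rfl

end Flatten

/-! ### Invariance of the gluing sum. -/

section Gluing

/-- The flat diagram of a knot without preferred crossings. -/
abbrev KnotDiagram.plain (D : KnotDiagram) : Diagram Bool := D.1.flat fun _ => false

theorem KnotDiagram.label_plain (D : KnotDiagram) : ∀ a ∈ D.plain.arrows, a.label = false := by
  intro a ha
  obtain ⟨b, -, rfl⟩ := Finset.mem_image.1 ha
  exact Arrow.label_flat _ _

/-- Of the direction and the sign of the kink only the direction of its flat arrow is left, which is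
`r'`. Together with `singularEquiv_kinked` this makes the class independent of all choices. -/
theorem singularEquiv_singZero (D : KnotDiagram) (p : D.1.Pt) (r : Bool) (ε : ℤˣ) :
    ∃ r', SingularEquiv (D.singZero p r ε).diagram (D.plain.kinked p r') := by
  obtain ⟨k, hk⟩ : ∃ k : Arrow (Option (Option D.1.Pt)) ℤˣ, k = D.kinkArrow p r ε := ⟨_, rfl⟩
  obtain ⟨r', hr'⟩ : ∃ r', k.flat true = Arrow.dir r' (some none) none true := by
    subst hk
    cases r
    · refine ⟨!decide (ε = 1), ?_⟩
      rw [Arrow.dir_not]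
      exact Arrow.flat_mk _ _ _ _
    · exact ⟨decide (ε = 1), Arrow.flat_mk _ _ _ _⟩
  have hend : k.IsEnd none := by
    subst hk
    cases r
    · exact Or.inl rfl
    · exact Or.inr rfl
  refine ⟨r', (SingularMove.homeo (replace_empty (D := (D.singZero p r ε).diagram)
    (D' := D.plain.kinked p r') (Equiv.refl (Option (Option D.1.Pt))) (fun _ => rfl) ?_)).equiv⟩
  have harr : (D.singZero p r ε).diagram.arrows =
      Finset.image (fun a : Arrow (Option (Option D.1.Pt)) ℤˣ => a.flat (decide (a = k)))
        (insert k (Finset.image (Arrow.map some) (Finset.image (Arrow.map some) D.1.arrows))) := by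
    subst hk
    rfl
  refine Eq.trans ?_ (image_map_id (A := (D.singZero p r ε).diagram.arrows)).symm
  refine Eq.trans ?_ harr.symm
  change kinkArrows (D.1.arrows.image fun a => a.flat false) r' = _
  rw [Finset.image_insert, kinkArrows, decide_eq_true rfl, hr',
    Finset.image_image, Finset.image_image, Finset.image_image]
  congr 1
  refine Finset.image_congr fun a _ => ?_
  have hne : (a.map some).map some ≠ k := by
    intro h
    rw [← h] at hend
    obtain ⟨x, -, hx⟩ := Arrow.isEnd_map.1 hend
    cases hx
  simp only [Function.comp]
  rw [decide_eq_false hne, Arrow.map_flat]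
  rfl

theorem singZero_mk_eq (D : KnotDiagram) (p p' : D.1.Pt) (r r' : Bool) (ε ε' : ℤˣ) :
    FlatSingularKnot.mk (D.singZero p r ε) = FlatSingularKnot.mk (D.singZero p' r' ε') := by
  obtain ⟨s, hs⟩ := singularEquiv_singZero D p r ε
  obtain ⟨s', hs'⟩ := singularEquiv_singZero D p' r' ε'
  exact FlatSingularKnot.mk_eq_mk
    ((hs.trans (singularEquiv_kinked D.label_plain D.2 p p' s s')).trans hs'.symm)

/-- The flat singular virtual knot obtained by gluing at a small kink. -/
noncomputable def KnotDiagram.zeroClass (D : KnotDiagram) : FlatSingularKnot :=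
  FlatSingularKnot.mk (D.singZero D.2.1.some true 1)

theorem mk_eq_zeroClass {D : KnotDiagram} {α : SingularString} (p : D.1.Pt) (r : Bool)
    (h : SingularEquiv α.diagram (D.plain.kinked p r)) :
    FlatSingularKnot.mk α = D.zeroClass := by
  obtain ⟨s, hs⟩ := singularEquiv_singZero D D.2.1.some true 1
  exact FlatSingularKnot.mk_eq_mk
    ((h.trans (singularEquiv_kinked D.label_plain D.2 _ _ _ _)).trans hs.symm)

/-- With no crossing preferred, the move is one of plain shadows, and `SingularMove.kinked` carries
it to the kinked diagrams. -/
theorem zeroClass_eq_of_isMove {D D' : KnotDiagram} {f : D.1.Pt → D'.1.Pt}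
    {N : Finset (Arrow D.1.Pt ℤˣ)} (h : IsMove D.1 D'.1 f N) : D.zeroClass = D'.zeroClass := by
  obtain ⟨E, hE, hE'⟩ := h.2.2 (fun _ => false) (fun _ => false) (by simp) (by simp) (by simp)
  obtain ⟨p, p', h1⟩ := hE.kinked D.2.1 D.label_plain true
  obtain ⟨p'', h2⟩ := replace_kinked hE' p' true
  rw [Set.image_empty] at h2
  obtain ⟨s, hs⟩ := singularEquiv_singZero D p true 1
  rw [← mk_eq_zeroClass (α := D.singZero p true 1) p s hs]
  refine mk_eq_zeroClass p'' true ?_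
  exact ((hs.trans (singularEquiv_kinked D.label_plain D.2 _ _ _ _)).trans h1).trans
    (SingularMove.homeo h2).equiv

theorem glue_mk_eq_of_isMove {D D' : KnotDiagram} {f : D.1.Pt → D'.1.Pt}
    (hf : Function.Injective f) {N : Finset (Arrow D.1.Pt ℤˣ)} (h : IsMove D.1 D'.1 f N)
    {a : Arrow D.1.Pt ℤˣ} (ha : a ∈ D.1.arrows) (ha' : a.map f ∈ D'.1.arrows) :
    FlatSingularKnot.mk (D.glue a ha) = FlatSingularKnot.mk (D'.glue (a.map f) ha') := by
  obtain ⟨E, hE, hE'⟩ := h.2.2 (fun b => decide (b = a)) (fun b => decide (b = a.map f))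
    (by intro b _ c _ hb hc; simp at hb hc; rw [hb, hc])
    (by intro b _; simp [(Arrow.map_injective hf).eq_iff])
    (by
      intro b hb
      simp only [(Arrow.map_injective hf).eq_iff, decide_eq_false_iff_not]
      rintro rfl
      exact Finset.disjoint_left.1 h.2.1 ha hb)
  exact FlatSingularKnot.mk_eq_mk (hE.equiv.trans (SingularMove.homeo hE').equiv)

/-- A double-point on two adjacent points is a small kink: after two points are added behind it, its
ends slide onto them. -/
theorem singularEquiv_kinked_of_adj {D : Diagram Bool} {a b : D.Pt} (ha : D.Free a) (hb : D.Free b)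
    (hab : D.Adj a b) (r : Bool) (hV : Valid (insert (Arrow.dir r a b true) D.arrows)) :
    ∃ p r', SingularEquiv (ofPerm D.next _ hV) (D.kinked p r') := by
  have key : ∀ {a b : D.Pt} {r : Bool} (hV : Valid (insert (Arrow.dir r a b true) D.arrows)),
      D.Free a → D.Free b → a ≠ b → D.next a = b →
      SingularEquiv (ofPerm D.next _ hV) (D.kinked b r) := by
    intro a b r hV ha hb hne hab
    have hsub := ((Isotopic.subdivide (ofPerm D.next _ hV) b).trans
      (Isotopic.subdivide _ (none : Option D.Pt))).singularEquiv
    have hfree : ∀ x, D.Free x → FreeIn (D.arrows.image (Arrow.map twice)) (twice x) :=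
      fun x hx => (freeIn_image_of_injective twice_injective).2 hx
    have hfree' : ∀ x : Option (Option D.Pt), (∀ y, twice y ≠ x) →
        FreeIn (D.arrows.image (Arrow.map twice)) x := fun x hx => freeIn_image_of_notMem_range hx
    have hV2 : Valid (insert (Arrow.dir r (twice a) (twice b) true)
        (D.arrows.image (Arrow.map twice))) :=
      (D.valid.map twice_injective).insert_dir (twice_injective.ne hne) (hfree a ha) (hfree b hb)
    have s1 : FlatEq (insertTwo D.next b)
        (insert (Arrow.dir r (twice a) (twice b) true) (D.arrows.image (Arrow.map twice)))
        (insert (Arrow.dir r (twice a) none true) (D.arrows.image (Arrow.map twice))) := by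
      refine flatEq_slide_right hV2 (hfree b hb) (twice_injective.ne hne) 2 ?_ ?_
      · rw [pow_two, Equiv.Perm.mul_apply, insertTwo_self, insertTwo_some_none]
      · intro j hj
        interval_cases j
        · rw [pow_one, insertTwo_self]
          exact ⟨by simp [twice], by simp [twice], hfree' _ (by simp [twice])⟩
        · rw [pow_two, Equiv.Perm.mul_apply, insertTwo_self, insertTwo_some_none]
          exact ⟨by simp [twice], by simp [twice], hfree' _ (by simp [twice])⟩
    have s2 : FlatEq (insertTwo D.next b)
        (insert (Arrow.dir r (twice a) none true) (D.arrows.image (Arrow.map twice)))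
        (insert (Arrow.dir r (some none) none true) (D.arrows.image (Arrow.map twice))) := by
      refine flatEq_slide_left s1.right (hfree a ha) (by simp [twice]) 2 ?_ ?_
      · rw [pow_two, Equiv.Perm.mul_apply, insertTwo_of_ne _ hne, hab, insertTwo_self]
      · intro j hj
        interval_cases j
        · rw [pow_one, insertTwo_of_ne _ hne, hab]
          exact ⟨twice_injective.ne hne.symm, by simp [twice], hfree _ hb⟩
        · rw [pow_two, Equiv.Perm.mul_apply, insertTwo_of_ne _ hne, hab, insertTwo_self]
          exact ⟨by simp [twice], by simp, hfree' _ (by simp [twice])⟩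
    obtain ⟨_, _, h⟩ := s1.trans s2
    refine hsub.trans (SingularEquiv.trans (SingularMove.homeo ?_).equiv h)
    refine replace_empty (Equiv.refl _) (fun _ => rfl) ?_
    change insert (Arrow.dir r (twice a) (twice b) true) (D.arrows.image (Arrow.map twice)) =
      Finset.image (Arrow.map fun x => x) (Finset.image (Arrow.map some)
        (Finset.image (Arrow.map some) (insert (Arrow.dir r a b true) D.arrows)))
    rw [image_map_id, image_map_map, Finset.image_insert, Arrow.map_dir]
    rfl
  rcases hab.2 with h | h
  · exact ⟨b, r, key hV ha hb hab.1 h⟩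
  · refine ⟨a, !r, ?_⟩
    have := key (a := b) (b := a) (r := !r) (by rwa [Arrow.dir_not]) hb ha hab.1.symm h
    simp only [Arrow.dir_not] at this
    exact this

theorem isotopic_flat {D D' : Diagram ℤˣ} {A : Finset (Arrow D.Pt ℤˣ)} (e : D.Pt ≃ D'.Pt)
    (hn : ∀ x, D'.next (e x) = e (D.next x)) (hA : D'.arrows = A.image (Arrow.map e))
    (g : Arrow D.Pt ℤˣ → Bool) (g' : Arrow D'.Pt ℤˣ → Bool) (hg : ∀ a ∈ A, g' (a.map e) = g a)
    (hV : Valid (A.image fun a => a.flat (g a))) :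
    Isotopic (ofPerm D.next _ hV) (D'.flat g') := by
  refine Isotopic.of_equiv e hn ?_
  change Finset.image (fun a => a.flat (g' a)) D'.arrows =
    Finset.image (Arrow.map e) (Finset.image _ A)
  rw [hA, Finset.image_image, Finset.image_image]
  refine Finset.image_congr fun a ha => ?_
  simp only [Function.comp]
  rw [hg a ha, Arrow.map_flat]

/-- The crossing of a first move, turned into a double-point, is a small kink of the old diagram.
Hence its summand in the gluing sum vanishes. -/
theorem glue_mk_reidemeister1 {D D' : KnotDiagram} {a b : D.1.Pt} {ε : ℤˣ} (ha : D.1.Free a)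
    (hb : D.1.Free b) (hab : D.1.Adj a b) (f : D.1.Pt ≃ D'.1.Pt)
    (hn : ∀ x, D'.1.next (f x) = f (D.1.next x)) (h : IsMove D.1 D'.1 f {⟨a, b, ε⟩})
    (hmem : (⟨a, b, ε⟩ : Arrow D.1.Pt ℤˣ).map f ∈ D'.1.arrows) :
    FlatSingularKnot.mk (D'.glue _ hmem) = D'.zeroClass := by
  rw [← zeroClass_eq_of_isMove h]
  have hnot : (⟨a, b, ε⟩ : Arrow D.1.Pt ℤˣ) ∉ D.1.arrows := fun h => ha _ h (Or.inl rfl)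
  have hpa : D.plain.Free a := free_flatten (g := fun _ => false) ha
  have hpb : D.plain.Free b := free_flatten (g := fun _ => false) hb
  have hV : Valid (insert (Arrow.dir (decide (ε = 1)) a b true) D.plain.arrows) :=
    D.plain.valid.insert_dir hab.1 hpa hpb
  obtain ⟨p, r', h1⟩ := singularEquiv_kinked_of_adj hpa hpb hab (decide (ε = 1)) hV
  refine mk_eq_zeroClass p r' (SingularEquiv.trans (SingularEquiv.symm ?_) h1)
  have hA : Finset.image (fun c : Arrow D.1.Pt ℤˣ => c.flat (decide (c = ⟨a, b, ε⟩)))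
      (D.1.arrows ∪ {⟨a, b, ε⟩}) =
        insert (Arrow.dir (decide (ε = 1)) a b true) D.plain.arrows := by
    rw [Finset.union_comm, Finset.singleton_union, Finset.image_insert, decide_eq_true rfl,
      Arrow.flat_mk]
    congr 1
    refine Finset.image_congr fun c hc => ?_
    have : c ≠ ⟨a, b, ε⟩ := by rintro rfl; exact hnot hc
    simp only [decide_eq_false this]
  have key := isotopic_flat (A := D.1.arrows ∪ {⟨a, b, ε⟩}) f hn h.1
    (fun c => decide (c = ⟨a, b, ε⟩)) (fun c => decide (c = (⟨a, b, ε⟩ : Arrow D.1.Pt ℤˣ).map f))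
    (fun c _ => by simp [(Arrow.map_injective f.injective).eq_iff]) (by rw [hA]; exact hV)
  simp only [hA] at key
  exact key.singularEquiv

/-- The two new crossings bound a bigon, and their opposite signs give opposite flat directions. The
singularity switch therefore relates the two glued diagrams, and the summands cancel. -/
theorem glue_mk_reidemeister2 {D D' : KnotDiagram} {a a' b b' : D.1.Pt} {ε : ℤˣ}
    (hd : [a, a', b, b'].Nodup) (hf : ∀ x ∈ [a, a', b, b'], D.1.Free x)
    (haa : D.1.Adj a a') (hbb : D.1.Adj b b') (f : D.1.Pt ≃ D'.1.Pt)
    (hn : ∀ x, D'.1.next (f x) = f (D.1.next x))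
    (h : IsMove D.1 D'.1 f {⟨a, b, ε⟩, ⟨a', b', -ε⟩})
    (hmem : (⟨a, b, ε⟩ : Arrow D.1.Pt ℤˣ).map f ∈ D'.1.arrows)
    (hmem' : (⟨a', b', -ε⟩ : Arrow D.1.Pt ℤˣ).map f ∈ D'.1.arrows) :
    FlatSingularKnot.mk (D'.glue _ hmem) = FlatSingularKnot.mk (D'.glue _ hmem') := by
  have hnot : ∀ c ∈ D.1.arrows, c ≠ ⟨a, b, ε⟩ ∧ c ≠ ⟨a', b', -ε⟩ := by
    intro c hc
    constructor
    · rintro rfl; exact hf a (by simp) _ hc (Or.inl rfl)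
    · rintro rfl; exact hf a' (by simp) _ hc (Or.inl rfl)
  have hne : (⟨a, b, ε⟩ : Arrow D.1.Pt ℤˣ) ≠ ⟨a', b', -ε⟩ := by
    intro h
    exact haa.1 (congrArg Arrow.tail h)
  have hA : ∀ n : Arrow D.1.Pt ℤˣ, n = ⟨a, b, ε⟩ ∨ n = ⟨a', b', -ε⟩ →
      Finset.image (fun c : Arrow D.1.Pt ℤˣ => c.flat (decide (c = n)))
        (D.1.arrows ∪ {⟨a, b, ε⟩, ⟨a', b', -ε⟩}) =
        insert (Arrow.dir (decide (ε = 1)) a b (decide (⟨a, b, ε⟩ = n)))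
          (insert (Arrow.dir (decide (ε = 1)) b' a' (decide (⟨a', b', -ε⟩ = n)))
            D.plain.arrows) := by
    intro n hn
    rw [Finset.union_comm, Finset.insert_union, Finset.singleton_union, Finset.image_insert,
      Finset.image_insert, Arrow.flat_mk, Arrow.flat_mk, decide_eq_decide.2 unit_neg_eq_one,
      decide_not, Arrow.dir_not]
    congr 2
    refine Finset.image_congr fun c hc => ?_
    have : c ≠ n := by
      rcases hn with rfl | rfl
      · exact (hnot c hc).1
      · exact (hnot c hc).2
    simp only [decide_eq_false this]
  have hA1 := hA _ (Or.inl rfl)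
  have hA2 := hA _ (Or.inr rfl)
  rw [decide_eq_true rfl, decide_eq_false hne.symm] at hA1
  rw [decide_eq_true rfl, decide_eq_false hne] at hA2
  have hfree : ∀ x ∈ [a, b', b, a'], D.plain.Free x := fun x hx =>
    free_flatten (g := fun _ => false) (hf x (by simp at hx ⊢; tauto))
  obtain ⟨hV, hV', key⟩ := flatEq_switch (σ := D.1.next) D.plain.valid (r := decide (ε = 1))
    (a := a) (a' := b') (b := b) (b' := a')
    (by simp only [List.nodup_cons, List.mem_cons, List.not_mem_nil, or_false, not_or] at hd ⊢
        grind) hfree haa.2 hbb.2.symm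
  have k1 := isotopic_flat (A := D.1.arrows ∪ {⟨a, b, ε⟩, ⟨a', b', -ε⟩}) f hn h.1
    (fun c => decide (c = ⟨a, b, ε⟩)) (fun c => decide (c = (⟨a, b, ε⟩ : Arrow D.1.Pt ℤˣ).map f))
    (fun c _ => by simp [(Arrow.map_injective f.injective).eq_iff]) (by rw [hA1]; exact hV)
  have k2 := isotopic_flat (A := D.1.arrows ∪ {⟨a, b, ε⟩, ⟨a', b', -ε⟩}) f hn h.1
    (fun c => decide (c = ⟨a', b', -ε⟩))
    (fun c => decide (c = (⟨a', b', -ε⟩ : Arrow D.1.Pt ℤˣ).map f))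
    (fun c _ => by simp [(Arrow.map_injective f.injective).eq_iff]) (by rw [hA2]; exact hV')
  simp only [hA1] at k1
  simp only [hA2] at k2
  exact FlatSingularKnot.mk_eq_mk ((k1.singularEquiv.symm.trans key).trans k2.singularEquiv)

/-- The class of the string glued at `a`, or zero if `a` is not a crossing. -/
noncomputable def KnotDiagram.glueClass (D : KnotDiagram) (a : Arrow D.1.Pt ℤˣ) :
    FreeAbelianGroup FlatSingularKnot :=
  if h : a ∈ D.1.arrows then FreeAbelianGroup.of (FlatSingularKnot.mk (D.glue a h)) else 0

theorem glueClass_of_mem {D : KnotDiagram} {a : Arrow D.1.Pt ℤˣ} (h : a ∈ D.1.arrows) :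
    D.glueClass a = FreeAbelianGroup.of (FlatSingularKnot.mk (D.glue a h)) := dif_pos h

/-- This form has a fixed kink and no membership proofs in the summands, so it can be compared
between diagrams. -/
theorem gluingSum_eq (D : KnotDiagram) (p : D.1.Pt) (r : Bool) (ε : ℤˣ) :
    D.gluingSum p r ε = ∑ a ∈ D.1.arrows, (a.label : ℤ) •
      (D.glueClass a - FreeAbelianGroup.of D.zeroClass) := by
  rw [← Finset.sum_attach, KnotDiagram.gluingSum]
  refine Finset.sum_congr rfl fun a _ => ?_
  rw [glueClass_of_mem a.2, KnotDiagram.zeroClass, singZero_mk_eq D p D.2.1.some r true ε 1]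

/-- The surviving crossings contribute equally on both sides, so only the new ones have to be
examined. -/
theorem sum_of_isMove {D D' : KnotDiagram} {f : D.1.Pt → D'.1.Pt} (hf : Function.Injective f)
    {N : Finset (Arrow D.1.Pt ℤˣ)} (h : IsMove D.1 D'.1 f N)
    (hN : ∑ a ∈ N, (a.label : ℤ) •
      (D'.glueClass (a.map f) - FreeAbelianGroup.of D'.zeroClass) = 0) :
    ∑ a ∈ D.1.arrows, (a.label : ℤ) • (D.glueClass a - FreeAbelianGroup.of D.zeroClass) =
      ∑ a ∈ D'.1.arrows, (a.label : ℤ) • (D'.glueClass a - FreeAbelianGroup.of D'.zeroClass) := by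
  rw [h.1, Finset.sum_image fun _ _ _ _ h => Arrow.map_injective hf h, Finset.sum_union h.2.1]
  change _ = _ + ∑ a ∈ N, (a.label : ℤ) •
    (D'.glueClass (a.map f) - FreeAbelianGroup.of D'.zeroClass)
  rw [hN, add_zero]
  refine Finset.sum_congr rfl fun a ha => ?_
  have ha' : a.map f ∈ D'.1.arrows := by
    rw [h.1]
    exact Finset.mem_image_of_mem _ (Finset.mem_union_left _ ha)
  rw [glueClass_of_mem ha, glueClass_of_mem ha', zeroClass_eq_of_isMove h,
    glue_mk_eq_of_isMove hf h ha ha']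
  rfl

theorem sum_of_gaussMove {D D' : KnotDiagram} (h : GaussMove D.1 D'.1) :
    ∑ a ∈ D.1.arrows, (a.label : ℤ) • (D.glueClass a - FreeAbelianGroup.of D.zeroClass) =
      ∑ a ∈ D'.1.arrows, (a.label : ℤ) •
        (D'.glueClass a - FreeAbelianGroup.of D'.zeroClass) := by
  obtain ⟨D, hD⟩ := D
  obtain ⟨D', hD'⟩ := D'
  cases h with
  | homeo h =>
    obtain ⟨f, hf, h⟩ := isMove_homeo h
    exact sum_of_isMove (D := ⟨D, hD⟩) (D' := ⟨D', hD'⟩) hf h (Finset.sum_empty)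
  | subdivide p =>
    exact sum_of_isMove (D := ⟨D, hD⟩) (D' := ⟨D.subdivide p, hD'⟩) (Option.some_injective _)
      (isMove_subdivide D p) (Finset.sum_empty)
  | reidemeister1 a b ε ha hb hab h =>
    obtain ⟨f, h, hn⟩ := isMove_reidemeister1 ha hb hab h
    have hmem : (⟨a, b, ε⟩ : Arrow D.Pt ℤˣ).map f ∈ D'.arrows := by
      rw [h.1]
      exact Finset.mem_image_of_mem _ (by simp)
    refine sum_of_isMove (D := ⟨D, hD⟩) (D' := ⟨D', hD'⟩) f.injective h ?_
    rw [Finset.sum_singleton, glueClass_of_mem (D := ⟨D', hD'⟩) hmem,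
      glue_mk_reidemeister1 (D := ⟨D, hD⟩) (D' := ⟨D', hD'⟩) ha hb hab f hn h hmem, sub_self,
      smul_zero]
  | reidemeister2 a a' b b' ε hd hf haa hbb h =>
    obtain ⟨f, h, hn⟩ := isMove_reidemeister2 hd hf haa hbb h
    have hmem : (⟨a, b, ε⟩ : Arrow D.Pt ℤˣ).map f ∈ D'.arrows := by
      rw [h.1]
      exact Finset.mem_image_of_mem _ (by simp)
    have hmem' : (⟨a', b', -ε⟩ : Arrow D.Pt ℤˣ).map f ∈ D'.arrows := by
      rw [h.1]
      exact Finset.mem_image_of_mem _ (by simp)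
    have hne : (⟨a, b, ε⟩ : Arrow D.Pt ℤˣ) ≠ ⟨a', b', -ε⟩ := by
      intro h
      exact haa.1 (congrArg Arrow.tail h)
    refine sum_of_isMove (D := ⟨D, hD⟩) (D' := ⟨D', hD'⟩) f.injective h ?_
    rw [Finset.sum_pair hne, glueClass_of_mem (D := ⟨D', hD'⟩) hmem,
      glueClass_of_mem (D := ⟨D', hD'⟩) hmem',
      glue_mk_reidemeister2 (D := ⟨D, hD⟩) (D' := ⟨D', hD'⟩) hd hf haa hbb f hn h hmem hmem',
      ← add_smul]
    simp
  | reidemeister3 x hx o ho ε s hs h =>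
    obtain ⟨f, hf, h⟩ := isMove_reidemeister3 hx hs h
    exact sum_of_isMove (D := ⟨D, hD⟩) (D' := ⟨D', hD'⟩) hf h (Finset.sum_empty)

/-- The gluing invariant. -/
noncomputable def gluingInvariant : VirtualKnot → FreeAbelianGroup FlatSingularKnot :=
  Quot.lift (fun D => ∑ a ∈ D.1.arrows, (a.label : ℤ) •
    (D.glueClass a - FreeAbelianGroup.of D.zeroClass)) fun _ _ h => sum_of_gaussMove h

theorem gluingInvariant_mk (D : KnotDiagram) (p : D.1.Pt) (r : Bool) (ε : ℤˣ) :
    gluingInvariant (VirtualKnot.mk D) = D.gluingSum p r ε :=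
  (gluingSum_eq D p r ε).symm

end Gluing

/-! ### Flat links: the two smoothings of a bigon or of a triangle. -/

section Links

theorem Isotopic.flatLink_eq {D D' : Diagram Unit} (h : Isotopic D D') :
    FlatLink.mk D = FlatLink.mk D' := by
  induction h with
  | rel D D' h =>
    rcases h with h | ⟨p, rfl⟩
    · exact Quot.sound (FlatMove.homeo h)
    · exact Quot.sound (FlatMove.subdivide D p)
  | refl D => rfl
  | symm D D' _ ih => exact ih.symm
  | trans D D' D'' _ _ ih ih' => exact ih.trans ih'

variable {P : Type} [Fintype P] [DecidableEq P]

/-- The arrows of `A` and `B` define the same flat virtual link. -/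
def LinkEq (σ : Equiv.Perm P) (A : Finset (Arrow P Unit)) (τ : Equiv.Perm P)
    (B : Finset (Arrow P Unit)) : Prop :=
  ∃ hA hB, FlatLink.mk (ofPerm σ A hA) = FlatLink.mk (ofPerm τ B hB)

variable {σ τ ρ : Equiv.Perm P} {A B C : Finset (Arrow P Unit)}

theorem LinkEq.symm (h : LinkEq σ A τ B) : LinkEq τ B σ A := by
  obtain ⟨hA, hB, h⟩ := h
  exact ⟨hB, hA, h.symm⟩

theorem LinkEq.trans (h : LinkEq σ A τ B) (h' : LinkEq τ B ρ C) : LinkEq σ A ρ C := by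
  obtain ⟨hA, hB, h⟩ := h
  obtain ⟨hB', hC, h'⟩ := h'
  exact ⟨hA, hC, h.trans h'⟩

theorem LinkEq.right (h : LinkEq σ A τ B) : Valid B := h.symm.choose

theorem linkEq_slide (hA : Valid A) {x y : P} (hxy : σ x = y) (hne : y ≠ x) (hy : FreeIn A y) :
    LinkEq σ A σ (A.image (Arrow.map (Equiv.swap x y))) :=
  ⟨_, _, (isotopic_slide hA hxy hne hy).flatLink_eq⟩

theorem linkEq_homeo (hA : Valid A) (e : Equiv.Perm P) (h : ∀ x, τ (e x) = e (σ x)) :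
    LinkEq σ A τ (A.image (Arrow.map e)) :=
  ⟨hA, hA.map e.injective, (Isotopic.of_equiv e h rfl).flatLink_eq⟩

theorem linkEq_flat1 (hA : Valid A) {r : Bool} {x y : P} (hx : FreeIn A x) (hy : FreeIn A y)
    (hxy : x ≠ y) (h : σ x = y ∨ σ y = x) : LinkEq σ A σ (insert (Arrow.dir r x y ()) A) := by
  have hB : Valid (insert (Arrow.dir r x y ()) A) := hA.insert_dir hxy hx hy
  refine ⟨hA, hB, Quot.sound ?_⟩
  cases r
  · refine FlatMove.flat1 (D := ofPerm σ A hA) y x hy hx ⟨hxy.symm, h.symm⟩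
      (replace_inPlace hA hB (Set.empty_subset _) fun a => ?_)
    simp [Arrow.dir, or_comm]
  · refine FlatMove.flat1 (D := ofPerm σ A hA) x y hx hy ⟨hxy, h⟩
      (replace_inPlace hA hB (Set.empty_subset _) fun a => ?_)
    simp [Arrow.dir, or_comm]

theorem linkEq_flat2 (hA : Valid A) {r : Bool} {a a' b b' : P} (hd : [a, a', b, b'].Nodup)
    (hf : ∀ x ∈ [a, a', b, b'], FreeIn A x) (haa : σ a = a' ∨ σ a' = a)
    (hbb : σ b = b' ∨ σ b' = b) :
    LinkEq σ A σ (insert (Arrow.dir r a b ()) (insert (Arrow.dir (!r) a' b' ()) A)) := by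
  have hd' := hd
  simp only [List.nodup_cons, List.mem_cons, List.not_mem_nil, or_false, not_or] at hd'
  have hfa := hf a (by simp)
  have hfa' := hf a' (by simp)
  have hfb := hf b (by simp)
  have hfb' := hf b' (by simp)
  have hB : Valid (insert (Arrow.dir r a b ()) (insert (Arrow.dir (!r) a' b' ()) A)) := by
    refine Valid.insert_dir (hA.insert_dir ?_ hfa' hfb') ?_ ?_ ?_
    · grind
    · grind
    · rw [freeIn_insert, Arrow.isEnd_dir]; grind
    · rw [freeIn_insert, Arrow.isEnd_dir]; grind
  refine ⟨hA, hB, Quot.sound ?_⟩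
  have hmem : ∀ c, c ∈ insert (Arrow.dir r a b ()) (insert (Arrow.dir (!r) a' b' ()) A) ↔
      (c ∈ A ∧ c ∉ (∅ : Set (Arrow P Unit))) ∨
        c ∈ ({Arrow.dir r a b (), Arrow.dir (!r) a' b' ()} : Set (Arrow P Unit)) := by
    intro c
    simp only [Finset.mem_insert, Set.mem_insert_iff, Set.mem_singleton_iff,
      Set.mem_empty_iff_false, not_false_eq_true, and_true]
    tauto
  have hrep := replace_inPlace (σ := σ) hA hB (Set.empty_subset _) hmem
  cases r
  · refine FlatMove.flat2 (D := ofPerm σ A hA) b b' a a' ?_ ?_ ⟨?_, hbb⟩ ⟨?_, haa⟩ hrep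
    · change [b, b', a, a'].Nodup
      simp only [List.nodup_cons, List.mem_cons, List.not_mem_nil, or_false, not_or]
      grind
    · intro x hx
      exact hf x (by simp at hx ⊢; tauto)
    · grind
    · grind
  · refine FlatMove.flat2 (D := ofPerm σ A hA) a a' b b' hd hf ⟨?_, haa⟩ ⟨?_, hbb⟩ hrep
    · grind
    · grind

/-- Smoothing one or the other of two positions of the crossing of two strands. -/
theorem linkEq_parallel (hA : Valid A) {u u' v v' : P} (hd : [u, u', v, v'].Nodup)
    (hu : σ u = u') (hv : σ v = v') (hu' : FreeIn A u') (hv' : FreeIn A v') :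
    LinkEq (σ * Equiv.swap u' v') A (σ * Equiv.swap u v) (A.image (Arrow.map fun x =>
      Equiv.swap u' v' (Equiv.swap v v' (Equiv.swap u u' x)))) := by
  simp only [List.nodup_cons, List.mem_cons, List.not_mem_nil, or_false, not_or] at hd
  have h1 : LinkEq (σ * Equiv.swap u' v') A (σ * Equiv.swap u' v') _ :=
    linkEq_slide hA (x := u) (y := u') (by
      rw [Equiv.Perm.mul_apply, Equiv.swap_apply_of_ne_of_ne, hu] <;> grind) (by grind) hu'
  have h2 : LinkEq (σ * Equiv.swap u' v') _ (σ * Equiv.swap u' v') _ :=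
    linkEq_slide h1.right (x := v) (y := v') (by
      rw [Equiv.Perm.mul_apply, Equiv.swap_apply_of_ne_of_ne, hv] <;> grind) (by grind) (by
      rw [freeIn_image, Equiv.symm_swap, Equiv.swap_apply_of_ne_of_ne]
      · exact hv'
      · grind
      · grind)
  -- The renaming works because `swap (σ u) (σ v)` followed after `σ` is `σ` after `swap u v`.
  have h3 : LinkEq (σ * Equiv.swap u' v') _ (σ * Equiv.swap u v) _ :=
    linkEq_homeo h2.right (Equiv.swap u' v') (by
      intro x
      rw [Equiv.Perm.mul_apply, Equiv.Perm.mul_apply]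
      generalize Equiv.swap u' v' x = y
      rw [← hu, ← hv, ← Equiv.apply_symm_apply σ (Equiv.swap (σ u) (σ v) (σ y))]
      congr 1
      rw [Equiv.swap_apply_def, Equiv.swap_apply_def]
      simp only [σ.injective.eq_iff]
      split_ifs <;> simp)
  rw [image_map_map, image_map_map] at h3
  rw [image_map_map] at h2
  exact (h1.trans h2).trans h3

theorem linkEq_relocate (hA : Valid A) {y p q : P} (hy : FreeIn A y) (hσp : σ p = y) (hpq : p ≠ q)
    (hpy : p ≠ y) (hqy : q ≠ y) (hτq : τ q = y) (hτy : τ y = σ q) (hτp : τ p = σ y)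
    (hτ : ∀ u, u ≠ p → u ≠ q → u ≠ y → τ u = σ u) : LinkEq σ A τ A :=
  ⟨hA, hA, (isotopic_relocate hA hy hσp hpq hpy hqy hτq hτy hτp hτ).flatLink_eq⟩

/-- Both smoothings lead from `u` to the point behind `v'` and from `v` to the point behind `u'`.
They differ only in which of the two passages contains the free points `u'` and `v'`, and these can
be relocated. -/
theorem linkEq_antiparallel (hA : Valid A) {u u' v v' : P} (hd : [u, u', v, v'].Nodup)
    (hu : σ u = u') (hv : σ v = v') (hu' : FreeIn A u') (hv' : FreeIn A v') :
    LinkEq (σ * Equiv.swap u' v) A (σ * Equiv.swap u v') A := by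
  simp only [List.nodup_cons, List.mem_cons, List.not_mem_nil, or_false, not_or] at hd
  -- the order in which `u'` has been moved behind `v`
  let τ : Equiv.Perm P := σ * Equiv.swap u v
  have hne : u ≠ u' ∧ u ≠ v ∧ u ≠ v' ∧ u' ≠ v ∧ u' ≠ v' ∧ v ≠ v' := by grind
  obtain ⟨n1, n2, n3, n4, n5, n6⟩ := hne
  have a1 : (σ * Equiv.swap u' v) u = u' := by
    rw [Equiv.Perm.mul_apply, Equiv.swap_apply_of_ne_of_ne n1 n2, hu]
  have a2 : (σ * Equiv.swap u' v) v = σ u' := by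
    rw [Equiv.Perm.mul_apply, Equiv.swap_apply_right]
  have a3 : (σ * Equiv.swap u' v) u' = v' := by
    rw [Equiv.Perm.mul_apply, Equiv.swap_apply_left, hv]
  have a4 : ∀ x, x ≠ u' → x ≠ v → (σ * Equiv.swap u' v) x = σ x := fun x h h' => by
    rw [Equiv.Perm.mul_apply, Equiv.swap_apply_of_ne_of_ne h h']
  have b1 : τ u = v' := by
    simp only [τ]; rw [Equiv.Perm.mul_apply, Equiv.swap_apply_left, hv]
  have b2 : τ v = u' := by
    simp only [τ]; rw [Equiv.Perm.mul_apply, Equiv.swap_apply_right, hu]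
  have b4 : ∀ x, x ≠ u → x ≠ v → τ x = σ x := fun x h h' => by
    simp only [τ]; rw [Equiv.Perm.mul_apply, Equiv.swap_apply_of_ne_of_ne h h']
  have c1 : (σ * Equiv.swap u v') u = σ v' := by
    rw [Equiv.Perm.mul_apply, Equiv.swap_apply_left]
  have c2 : (σ * Equiv.swap u v') v' = u' := by
    rw [Equiv.Perm.mul_apply, Equiv.swap_apply_right, hu]
  have c4 : ∀ x, x ≠ u → x ≠ v' → (σ * Equiv.swap u v') x = σ x := fun x h h' => by
    rw [Equiv.Perm.mul_apply, Equiv.swap_apply_of_ne_of_ne h h']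
  have h1 : LinkEq (σ * Equiv.swap u' v) A τ A :=
    linkEq_relocate hA (y := u') (p := u) (q := v) hu' a1 n2 n1 n4.symm b2
      (by rw [b4 _ n1.symm n4, a2]) (by rw [b1, a3])
      (fun x hx hx' hx'' => by rw [b4 x hx hx', a4 x hx'' hx'])
  have h2 : LinkEq τ A (σ * Equiv.swap u v') A :=
    linkEq_relocate hA (y := v') (p := u) (q := v) hv' b1 n2 n3 n6
      (by rw [c4 _ n2.symm n6, hv]) (by rw [c2, b2]) (by rw [c1, b4 _ n3.symm n6.symm])
      (fun x hx hx' hx'' => by rw [c4 x hx hx'', b4 x hx hx'])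
  exact h1.trans h2

theorem linkEq_slide_dir {r : Bool} {x y z : P}
    (hV : Valid (insert (Arrow.dir r x y ()) A)) (hx : FreeIn A x) (hz : FreeIn A z)
    (hxz : σ x = z) (hxy : x ≠ y) (hne : z ≠ x) (hzy : z ≠ y) :
    LinkEq σ (insert (Arrow.dir r x y ()) A) σ (insert (Arrow.dir r z y ()) A) := by
  have key := linkEq_slide hV hxz hne (by
    rw [freeIn_insert, Arrow.isEnd_dir]
    exact ⟨by rintro (h | h); exacts [hne h.symm, hzy h.symm], hz⟩)
  rwa [Finset.image_insert, image_map_swap_eq_self hx hz, Arrow.map_dir,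
    Equiv.swap_apply_left, Equiv.swap_apply_of_ne_of_ne hxy.symm hzy.symm] at key

/-- The smoothing makes `u`, `u'`, `v'` consecutive, so the second crossing of an antiparallel bigon
becomes a kink. -/
theorem linkEq_kink (hA : Valid A) {u u' v v' : P} (hd : [u, u', v, v'].Nodup)
    (hu : σ u = u') (hv : σ v = v') (hf : ∀ x ∈ [u, u', v, v'], FreeIn A x) (r : Bool) :
    LinkEq (σ * Equiv.swap u' v) (insert (Arrow.dir r u v' ()) A) (σ * Equiv.swap u' v) A := by
  simp only [List.nodup_cons, List.mem_cons, List.not_mem_nil, or_false, not_or] at hd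
  have hne : u ≠ u' ∧ u ≠ v ∧ u ≠ v' ∧ u' ≠ v ∧ u' ≠ v' ∧ v ≠ v' := by grind
  obtain ⟨n1, n2, n3, n4, n5, n6⟩ := hne
  have fu := hf u (by simp)
  have fu' := hf u' (by simp)
  have fv' := hf v' (by simp)
  have h1 : LinkEq (σ * Equiv.swap u' v) (insert (Arrow.dir r u v' ()) A) (σ * Equiv.swap u' v)
      (insert (Arrow.dir r u' v' ()) A) :=
    linkEq_slide_dir (hA.insert_dir n3 fu fv') fu fu'
      (by rw [Equiv.Perm.mul_apply, Equiv.swap_apply_of_ne_of_ne n1 n2, hu]) n3 n1.symm n5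
  exact h1.trans (linkEq_flat1 hA fu' fv' n5
    (Or.inl (by rw [Equiv.Perm.mul_apply, Equiv.swap_apply_left, hv]))).symm

theorem linkEq_kinks (hA : Valid A) {u u' v v' : P} (hd : [u, u', v, v'].Nodup)
    (hu : σ u = u') (hv : σ v = v') (hf : ∀ x ∈ [u, u', v, v'], FreeIn A x) (r r' : Bool) :
    LinkEq (σ * Equiv.swap u' v) (insert (Arrow.dir r u v' ()) A) (σ * Equiv.swap u v')
      (insert (Arrow.dir r' v u' ()) A) := by
  have h1 := linkEq_kink hA hd hu hv hf r
  have h2 := linkEq_kink (u := v) (u' := v') (v := u) (v' := u') hA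
    (by simp only [List.nodup_cons, List.mem_cons, List.not_mem_nil, or_false, not_or] at hd ⊢
        grind) hv hu
    (fun x hx => hf x (by simp at hx ⊢; tauto)) r'
  rw [Equiv.swap_comm v' u] at h2
  exact (h1.trans (linkEq_antiparallel hA hd hu hv (hf _ (by simp)) (hf _ (by simp)))).trans h2.symm

/-- In the smoothed diagram `u`, `u'`, `v'` are consecutive. The crossings of these strands with a
third one become the two corners of a bigon, which a second move removes. -/
theorem linkEq_bigon (hA : Valid A) {u u' v v' w w' : P} (hd : [u, u', v, v', w, w'].Nodup)
    (hu : σ u = u') (hv : σ v = v') (hw : σ w = w' ∨ σ w' = w)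
    (hf : ∀ x ∈ [u, u', v, v', w, w'], FreeIn A x) (r : Bool) :
    LinkEq (σ * Equiv.swap u' v)
      (insert (Arrow.dir r u w ()) (insert (Arrow.dir (!r) v' w' ()) A))
      (σ * Equiv.swap u' v) A := by
  simp only [List.nodup_cons, List.mem_cons, List.not_mem_nil, or_false, not_or] at hd
  simp only [List.mem_cons, List.not_mem_nil, or_false, forall_eq_or_imp, forall_eq] at hf
  obtain ⟨fu, fu', fv, fv', fw, fw'⟩ := hf
  have hV : Valid (insert (Arrow.dir r u w ()) (insert (Arrow.dir (!r) v' w' ()) A)) := by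
    refine Valid.insert_dir (hA.insert_dir ?_ fv' fw') ?_ ?_ ?_ <;>
      try rw [freeIn_insert, Arrow.isEnd_dir]
    all_goals grind
  have h1 : LinkEq (σ * Equiv.swap u' v)
      (insert (Arrow.dir r u w ()) (insert (Arrow.dir (!r) v' w' ()) A)) (σ * Equiv.swap u' v)
      (insert (Arrow.dir r u' w ()) (insert (Arrow.dir (!r) v' w' ()) A)) := by
    refine linkEq_slide_dir hV ?_ ?_ ?_ ?_ ?_ ?_
    · rw [freeIn_insert, Arrow.isEnd_dir]; grind
    · rw [freeIn_insert, Arrow.isEnd_dir]; grind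
    · rw [Equiv.Perm.mul_apply, Equiv.swap_apply_of_ne_of_ne, hu] <;> grind
    · grind
    · grind
    · grind
  refine h1.trans (linkEq_flat2 hA ?_ ?_ ?_ ?_).symm
  · simp only [List.nodup_cons, List.mem_cons, List.not_mem_nil, or_false, not_or]; grind
  · simp only [List.mem_cons, List.not_mem_nil, or_false, forall_eq_or_imp, forall_eq]
    exact ⟨fu', fv', fw, fw'⟩
  · left; rw [Equiv.Perm.mul_apply, Equiv.swap_apply_left, hv]
  · have hσ : ∀ z, z ≠ u' → z ≠ v → (σ * Equiv.swap u' v) z = σ z := fun z h h' => by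
      rw [Equiv.Perm.mul_apply, Equiv.swap_apply_of_ne_of_ne h h']
    rwa [hσ w (by grind) (by grind), hσ w' (by grind) (by grind)]

/-- Both sides reduce to the smoothing without the third strand's two crossings, where
`linkEq_antiparallel` compares them. -/
theorem linkEq_bigons (hA : Valid A) {u u' v v' w w' : P} (hd : [u, u', v, v', w, w'].Nodup)
    (hu : σ u = u') (hv : σ v = v') (hw : σ w = w' ∨ σ w' = w)
    (hf : ∀ x ∈ [u, u', v, v', w, w'], FreeIn A x) (s : Bool) :
    LinkEq (σ * Equiv.swap u' v)
      (insert (Arrow.dir s v' w ()) (insert (Arrow.dir s w' u ()) A))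
      (σ * Equiv.swap u v')
      (insert (Arrow.dir s v w' ()) (insert (Arrow.dir s w u' ()) A)) := by
  have hd2 : [u, u', v, v', w', w].Nodup ∧ [v, v', u, u', w', w].Nodup ∧ [u, u', v, v'].Nodup := by
    simp only [List.nodup_cons, List.mem_cons, List.not_mem_nil, or_false, not_or] at hd ⊢
    grind
  have h1 := linkEq_bigon hA hd2.1 hu hv hw.symm
    (fun x hx => hf x (by simp at hx ⊢; tauto)) (!s)
  have h2 := linkEq_bigon hA hd2.2.1 hv hu hw.symm
    (fun x hx => hf x (by simp at hx ⊢; tauto)) s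
  rw [Bool.not_not, Finset.insert_comm, Arrow.dir_not s u w'] at h1
  rw [Equiv.swap_comm v' u, Arrow.dir_not s u' w] at h2
  exact (h1.trans (linkEq_antiparallel hA hd2.2.2 hu hv (hf _ (by simp)) (hf _ (by simp)))).trans
    h2.symm

/-- When the two strands meet in parallel positions no flat move is needed. `linkEq_parallel`
carries the crossing at `u` to `v'` and the one at `v` to `u'`. -/
theorem linkEq_third (hA : Valid A) {u u' v v' w w' : P} (hd : [u, u', v, v', w, w'].Nodup)
    (hu : σ u = u') (hv : σ v = v')
    (hf : ∀ x ∈ [u, u', v, v', w, w'], FreeIn A x) (s : Bool) :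
    LinkEq (σ * Equiv.swap u' v')
      (insert (Arrow.dir s v w' ()) (insert (Arrow.dir (!s) w u ()) A))
      (σ * Equiv.swap u v)
      (insert (Arrow.dir s v' w ()) (insert (Arrow.dir (!s) w' u' ()) A)) := by
  simp only [List.nodup_cons, List.mem_cons, List.not_mem_nil, or_false, not_or] at hd
  simp only [List.mem_cons, List.not_mem_nil, or_false, forall_eq_or_imp, forall_eq] at hf
  obtain ⟨fu, fu', fv, fv', fw, fw'⟩ := hf
  have hV : Valid (insert (Arrow.dir s v w' ()) (insert (Arrow.dir (!s) w u ()) A)) := by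
    refine Valid.insert_dir (hA.insert_dir ?_ fw fu) ?_ ?_ ?_ <;>
      try rw [freeIn_insert, Arrow.isEnd_dir]
    all_goals grind
  have key := linkEq_parallel (σ := σ) hV (u := u) (u' := u') (v := v) (v' := v')
    (by simp only [List.nodup_cons, List.mem_cons, List.not_mem_nil, or_false, not_or]; grind)
    hu hv (by rw [freeIn_insert, freeIn_insert, Arrow.isEnd_dir, Arrow.isEnd_dir]; grind)
    (by rw [freeIn_insert, freeIn_insert, Arrow.isEnd_dir, Arrow.isEnd_dir]; grind)
  have hne : u ≠ u' ∧ u ≠ v ∧ u ≠ v' ∧ u' ≠ v ∧ u' ≠ v' ∧ v ≠ v' := by grind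
  obtain ⟨n1, n2, n3, n4, n5, n6⟩ := hne
  have hmap : ∀ x, x ≠ u → x ≠ v → x ≠ u' → x ≠ v' →
      Equiv.swap u' v' (Equiv.swap v v' (Equiv.swap u u' x)) = x := by
    intro x h1 h2 h3 h4
    rw [Equiv.swap_apply_of_ne_of_ne h1 h3, Equiv.swap_apply_of_ne_of_ne h2 h4,
      Equiv.swap_apply_of_ne_of_ne h3 h4]
  have hmu : Equiv.swap u' v' (Equiv.swap v v' (Equiv.swap u u' u)) = v' := by
    rw [Equiv.swap_apply_left, Equiv.swap_apply_of_ne_of_ne n4 n5, Equiv.swap_apply_left]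
  have hmv : Equiv.swap u' v' (Equiv.swap v v' (Equiv.swap u u' v)) = u' := by
    rw [Equiv.swap_apply_of_ne_of_ne n2.symm n4.symm, Equiv.swap_apply_left,
      Equiv.swap_apply_right]
  rw [Finset.image_insert, Finset.image_insert, Arrow.map_dir, Arrow.map_dir, hmu, hmv,
    hmap w (by grind) (by grind) (by grind) (by grind),
    hmap w' (by grind) (by grind) (by grind) (by grind), image_map_eq_self] at key
  · rw [Finset.insert_comm (Arrow.dir s v' w ()), Arrow.dir_not s w' u', ← Arrow.dir_not s w v']
    exact key
  · intro x hx
    refine hmap x ?_ ?_ ?_ ?_ <;> rintro rfl <;> contradiction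

/-- The two smoothings of a triangle at the crossing of the first two strands. -/
theorem linkEq_triangle (hA : Valid A) {x x' y y' z z' : P} (hd : [x, x', y, y', z, z'].Nodup)
    (hx : σ x = x') (hy : σ y = y') (hz : σ z = z')
    (hf : ∀ u ∈ [x, x', y, y', z, z'], FreeIn A u) (s₀ s₁ s₂ : Bool) :
    LinkEq (σ * Equiv.swap (if s₀ = s₂ then x' else x) (if s₁ = s₀ then y else y'))
      (insert (Arrow.dir s₁ (if s₁ = s₀ then y' else y) (if s₂ = s₁ then z else z') ())
        (insert (Arrow.dir s₂ (if s₂ = s₁ then z' else z) (if s₀ = s₂ then x else x') ()) A))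
      (σ * Equiv.swap (if s₀ = s₂ then x else x') (if s₁ = s₀ then y' else y))
      (insert (Arrow.dir s₁ (if s₁ = s₀ then y else y') (if s₂ = s₁ then z' else z) ())
        (insert (Arrow.dir s₂ (if s₂ = s₁ then z else z') (if s₀ = s₂ then x' else x) ()) A)) := by
  have hd' : [x, x', y, y', z', z].Nodup := by
    simp only [List.nodup_cons, List.mem_cons, List.not_mem_nil, or_false, not_or] at hd ⊢
    grind
  have hf' : ∀ u ∈ [x, x', y, y', z', z], FreeIn A u := fun u hu => hf u (by simp at hu ⊢; tauto)
  have b := linkEq_bigons hA hd hx hy (Or.inl hz) hf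
  have b' := linkEq_bigons hA hd' hx hy (Or.inr hz) hf'
  have t := linkEq_third hA hd hx hy hf
  have t' := linkEq_third hA hd' hx hy hf'
  -- The smoothed strands are antiparallel when `s₁ = s₂` and parallel otherwise. The primed
  -- versions have the third strand reversed, which only exchanges the roles of `z` and `z'`.
  cases s₀ <;> cases s₁ <;> cases s₂
  · simpa using b false
  · simpa using (t' false).symm
  · simpa using t true
  · simpa using (b' true).symm
  · simpa using (b' false).symm
  · simpa using t false
  · simpa using (t' true).symm
  · simpa using b true

end Links

/-! ### Smoothing a flat singular diagram at its double-point. -/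

section Smoothing

/-- Forget the label. -/
def Arrow.unlabel {P L : Type} (a : Arrow P L) : Arrow P Unit := ⟨a.tail, a.head, ()⟩

theorem Arrow.unlabel_dir {P L : Type} (r : Bool) (x y : P) (l : L) :
    (Arrow.dir r x y l).unlabel = Arrow.dir r x y () := by
  cases r <;> rfl

variable {P : Type} [DecidableEq P]

theorem Valid.unlabel {A : Finset (Arrow P Bool)} (h : Valid A) :
    Valid (A.image Arrow.unlabel) := by
  constructor
  · intro a ha
    obtain ⟨b, hb, rfl⟩ := Finset.mem_image.1 ha
    exact h.ne b hb
  · intro a ha a' ha' x hx hx'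
    obtain ⟨b, hb, rfl⟩ := Finset.mem_image.1 ha
    obtain ⟨b', hb', rfl⟩ := Finset.mem_image.1 ha'
    rw [h.disj b hb b' hb' x hx hx']

theorem freeIn_unlabel {A : Finset (Arrow P Bool)} {x : P} (h : FreeIn A x) :
    FreeIn (A.image Arrow.unlabel) x := by
  intro a ha
  obtain ⟨b, hb, rfl⟩ := Finset.mem_image.1 ha
  exact h b hb

/-- The arrows of `A` other than `p`, without labels. -/
def others (A : Finset (Arrow P Bool)) (p : Arrow P Bool) : Finset (Arrow P Unit) :=
  (A.erase p).image Arrow.unlabel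

theorem valid_others {A : Finset (Arrow P Bool)} (h : Valid A) (p : Arrow P Bool) :
    Valid (others A p) := (h.mono (Finset.erase_subset p A)).unlabel

theorem mem_others {A B : Finset (Arrow P Bool)} (hA : Valid A) {p : Arrow P Bool}
    {R T : Set (Arrow P Bool)} (hR : R ⊆ A) (hpT : p ∉ T)
    (h : ∀ a, a ∈ B ↔ (a ∈ A ∧ a ∉ R) ∨ a ∈ T) (c : Arrow P Unit) :
    c ∈ others B p ↔ (c ∈ others A p ∧ c ∉ Arrow.unlabel '' R) ∨ c ∈ Arrow.unlabel '' T := by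
  simp only [others, Finset.mem_image, Finset.mem_erase, h]
  constructor
  · rintro ⟨a, ⟨hap, ⟨ha, haR⟩ | ha⟩, rfl⟩
    · refine Or.inl ⟨⟨a, ⟨hap, ha⟩, rfl⟩, ?_⟩
      rintro ⟨b, hb, hba⟩
      have h1 : a.IsEnd a.unlabel.tail := Or.inl rfl
      have h2 : b.IsEnd a.unlabel.tail := by rw [← hba]; exact Or.inl rfl
      exact haR (hA.disj b (hR hb) a ha _ h2 h1 ▸ hb)
    · exact Or.inr ⟨a, ha, rfl⟩
  · rintro (⟨⟨a, ⟨hap, ha⟩, rfl⟩, haR⟩ | ⟨a, ha, rfl⟩)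
    · exact ⟨a, ⟨hap, Or.inl ⟨ha, fun h => haR ⟨a, h, rfl⟩⟩⟩, rfl⟩
    · exact ⟨a, ⟨fun h => hpT (h ▸ ha), Or.inr ha⟩, rfl⟩

/-- The flat link diagram that is obtained by smoothing at `p`. -/
abbrev Diagram.smoothed (D : Diagram Bool) (p : Arrow D.Pt Bool) : Diagram Unit :=
  ofPerm (D.next * Equiv.swap p.tail p.head) (others D.arrows p) (valid_others D.valid p)

theorem smoothed_homeo {D D' : Diagram Bool} {p : Arrow D.Pt Bool} {p' : Arrow D'.Pt Bool}
    (h : D.Replace D' ∅ ∅) (hp : D.preferred = {p}) (hp' : D'.preferred = {p'}) :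
    FlatLink.mk (D.smoothed p) = FlatLink.mk (D'.smoothed p') := by
  obtain ⟨-, e, hn, hA⟩ := h
  have hpm : p ∈ D.arrows ∧ p.label = true := mem_preferred.1 (by rw [hp]; simp)
  have hpe : p' = p.map e := by
    have : p.map e ∈ D'.preferred := mem_preferred.2 ⟨(hA p).2 (Or.inl ⟨hpm.1, by simp⟩), hpm.2⟩
    rw [hp', Finset.mem_singleton] at this
    exact this.symm
  subst hpe
  refine (Isotopic.of_equiv (D := D.smoothed p) (D' := D'.smoothed (p.map e)) e ?_ ?_).flatLink_eq
  · intro x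
    change D'.next (Equiv.swap (e p.tail) (e p.head) (e x)) =
      e (D.next (Equiv.swap p.tail p.head x))
    rw [← hn, e.injective.map_swap]
  · change others D'.arrows (p.map e) = (others D.arrows p).image (Arrow.map e)
    rw [others, others, Finset.image_image]
    ext c
    simp only [Finset.mem_image, Finset.mem_erase, Function.comp]
    constructor
    · rintro ⟨b, ⟨hb, hb'⟩, rfl⟩
      obtain ⟨a, rfl⟩ : ∃ a : Arrow D.Pt Bool, a.map e = b :=
        ⟨b.map e.symm, by rw [Arrow.map_map, e.self_comp_symm]; rfl⟩
      refine ⟨a, ⟨fun h => hb (by rw [h]), ?_⟩, rfl⟩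
      simpa using (hA a).1 hb'
    · rintro ⟨a, ⟨ha, ha'⟩, rfl⟩
      exact ⟨a.map e, ⟨fun h => ha (Arrow.map_injective e.injective h),
        (hA a).2 (Or.inl ⟨ha', by simp⟩)⟩, rfl⟩

/-- In the smoothed diagram the predecessor of `D.next q` is the image of `q` under the exchange of
the two ends of `p`; the new point has to be inserted there. -/
theorem smoothed_subdivide (D : Diagram Bool) (q : D.Pt) (p : Arrow D.Pt Bool) :
    FlatLink.mk (D.smoothed p) =
      FlatLink.mk ((ofPerm (insertAfter D.next q) (D.arrows.image (Arrow.map some))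
        (D.valid.map (Option.some_injective _))).smoothed (p.map some)) := by
  refine ((Isotopic.subdivide (D.smoothed p) (Equiv.swap p.tail p.head q)).trans
    (Isotopic.of_equiv (D' := (ofPerm (insertAfter D.next q) (D.arrows.image (Arrow.map some))
        (D.valid.map (Option.some_injective _))).smoothed (p.map some))
        (Equiv.refl (Option D.Pt)) ?_ ?_)).flatLink_eq
  · change ∀ x : Option D.Pt, insertAfter D.next q (Equiv.swap (some p.tail) (some p.head) x) =
      insertAfter (D.next * Equiv.swap p.tail p.head) (Equiv.swap p.tail p.head q) x
    rintro (_ | x)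
    · rw [Equiv.swap_apply_of_ne_of_ne (by simp) (by simp), insertAfter_none, insertAfter_none,
        Equiv.Perm.mul_apply, Equiv.swap_apply_self]
    · rw [← (Option.some_injective _).map_swap, insertAfter_some, insertAfter_some,
        Equiv.Perm.mul_apply]
      congr 1
      rw [eq_iff_iff]
      constructor
      · rintro rfl; rw [Equiv.swap_apply_self]
      · rintro rfl; rw [Equiv.swap_apply_self]
  · change others (D.arrows.image (Arrow.map some)) (p.map some) =
      ((others D.arrows p).image (Arrow.map some)).image (Arrow.map fun x => x)
    rw [image_map_id, others, others, ← Finset.image_erase (Arrow.map_injective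
      (Option.some_injective _)), Finset.image_image, Finset.image_image]
    rfl

end Smoothing

/-! ### Smoothing and the singularity switch. -/

section Switch

variable {P : Type} [Fintype P] [DecidableEq P] {σ : Equiv.Perm P} {A : Finset (Arrow P Unit)}

/-- Both strands of the bigon meet the crossing of `a'`, `b'` before that of `a`, `b`. Sliding the
remaining crossing along the two parallel strands of the smoothing turns one position into the
other. -/
theorem linkEq_switch_parallel (hA : Valid A) {a a' b b' : P} (hd : [a, a', b, b'].Nodup)
    (hf : ∀ x ∈ [a, a', b, b'], FreeIn A x) (h₁ : σ b' = a) (h₂ : σ a' = b) :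
    LinkEq (σ * Equiv.swap a b) (insert ⟨a', b', ()⟩ A) (σ * Equiv.swap a' b')
      (insert ⟨a, b, ()⟩ A) := by
  simp only [List.nodup_cons, List.mem_cons, List.not_mem_nil, or_false, not_or] at hd
  simp only [List.mem_cons, List.not_mem_nil, or_false, forall_eq_or_imp, forall_eq] at hf
  obtain ⟨fa, fa', fb, fb'⟩ := hf
  have hne : a ≠ a' ∧ a ≠ b ∧ a ≠ b' ∧ a' ≠ b ∧ a' ≠ b' ∧ b ≠ b' := by grind
  obtain ⟨n1, n2, n3, n4, n5, n6⟩ := hne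
  have hV : Valid (insert (⟨a', b', ()⟩ : Arrow P Unit) A) :=
    hA.insert_dir (r := true) n5 fa' fb'
  have key := linkEq_parallel (σ := σ) hV (u := b') (u' := a) (v := a') (v' := b)
    (by simp only [List.nodup_cons, List.mem_cons, List.not_mem_nil, or_false, not_or]; grind)
    h₁ h₂ (by rw [freeIn_insert]; refine ⟨?_, fa⟩; rintro (h | h) <;> grind)
    (by rw [freeIn_insert]; refine ⟨?_, fb⟩; rintro (h | h) <;> grind)
  have hmap : ∀ x, x ≠ b' → x ≠ a' → x ≠ a → x ≠ b →
      Equiv.swap a b (Equiv.swap a' b (Equiv.swap b' a x)) = x := by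
    intro x h1 h2 h3 h4
    rw [Equiv.swap_apply_of_ne_of_ne h1 h3, Equiv.swap_apply_of_ne_of_ne h2 h4,
      Equiv.swap_apply_of_ne_of_ne h3 h4]
  have hma : Equiv.swap a b (Equiv.swap a' b (Equiv.swap b' a a')) = a := by
    rw [Equiv.swap_apply_of_ne_of_ne n5 n1.symm, Equiv.swap_apply_left, Equiv.swap_apply_right]
  have hmb : Equiv.swap a b (Equiv.swap a' b (Equiv.swap b' a b')) = b := by
    rw [Equiv.swap_apply_left, Equiv.swap_apply_of_ne_of_ne n1 n2, Equiv.swap_apply_left]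
  have harr : (⟨a', b', ()⟩ : Arrow P Unit).map
      (fun x => Equiv.swap a b (Equiv.swap a' b (Equiv.swap b' a x))) = ⟨a, b, ()⟩ :=
    Arrow.ext hma hmb rfl
  rw [Finset.image_insert, harr, image_map_eq_self, Equiv.swap_comm b' a'] at key
  · exact key
  · intro x hx
    refine hmap x ?_ ?_ ?_ ?_ <;> rintro rfl <;> contradiction

/-- The sides of the bigon run in parallel or in opposite directions. In the first case the two
smoothings are isotopic; in the second one each remaining crossing is a kink of its smoothing. -/
theorem linkEq_switch (hA : Valid A) {a a' b b' : P} (hd : [a, a', b, b'].Nodup)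
    (hf : ∀ x ∈ [a, a', b, b'], FreeIn A x) (h₁ : σ a = b' ∨ σ b' = a) (h₂ : σ a' = b ∨ σ b = a') :
    LinkEq (σ * Equiv.swap a b) (insert ⟨a', b', ()⟩ A) (σ * Equiv.swap a' b')
      (insert ⟨a, b, ()⟩ A) := by
  have hd1 : [a', a, b', b].Nodup ∧ [a, b', a', b].Nodup ∧ [b', a, b, a'].Nodup := by
    simp only [List.nodup_cons, List.mem_cons, List.not_mem_nil, or_false, not_or] at hd ⊢
    grind
  rcases h₁ with h₁ | h₁ <;> rcases h₂ with h₂ | h₂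
  · rw [Equiv.swap_comm a' b']
    exact (linkEq_kinks hA hd1.2.1 h₁ h₂ (fun x hx => hf x (by simp at hx ⊢; tauto)) true
      true).symm
  · exact (linkEq_switch_parallel hA hd1.1 (fun x hx => hf x (by simp at hx ⊢; tauto)) h₂ h₁).symm
  · exact linkEq_switch_parallel hA hd hf h₁ h₂
  · rw [Equiv.swap_comm a' b']
    exact linkEq_kinks hA hd1.2.2 h₁ h₂ (fun x hx => hf x (by simp at hx ⊢; tauto)) false false

end Switch

/-! ### The smoothing map on flat singular knots and the smoothing invariant. -/

section Invariance

variable {P : Type} [Fintype P] [DecidableEq P] {σ : Equiv.Perm P}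

theorem smoothing_swap_apply {p : Arrow P Bool} {x : P} (h : ¬ p.IsEnd x) :
    (σ * Equiv.swap p.tail p.head) x = σ x := by
  rw [Equiv.Perm.mul_apply, Equiv.swap_apply_of_ne_of_ne]
  · exact fun h' => h (Or.inl h'.symm)
  · exact fun h' => h (Or.inr h'.symm)

/-- If the double-point is not in the triangle, its ends avoid the strands. The smoothing then
leaves the strands alone, and the same third move applies. -/
theorem smoothed_flat3 {D : Diagram Bool} {B : Finset (Arrow D.Pt Bool)} (hB : Valid B)
    {p : Arrow D.Pt Bool} (hpm : p ∈ D.arrows) {x : Fin 3 → D.Pt} (hx : D.Strands x)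
    {s l : Fin 3 → Bool} (hR : triangle s l (D.toNext x s) (D.toPrev x s) ⊆ D.arrows)
    (hpR : p ∉ triangle s l (D.toNext x s) (D.toPrev x s))
    (hpT : p ∉ triangle s l (D.toPrev x s) (D.toNext x s))
    (h : ∀ a, a ∈ B ↔ (a ∈ D.arrows ∧ a ∉ triangle s l (D.toNext x s) (D.toPrev x s)) ∨
      a ∈ triangle s l (D.toPrev x s) (D.toNext x s)) :
    FlatLink.mk (D.smoothed p) = FlatLink.mk ((ofPerm D.next B hB).smoothed p) := by
  have hend : ∀ i, ¬ p.IsEnd (x i) := by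
    intro i hi
    rcases toNext_or x s i with h | h
    · have hm : _ ∈ triangle s l (D.toNext x s) (D.toPrev x s) := ⟨i, rfl⟩
      exact hpR (D.disjoint _ hpm _ (hR hm) _ hi (isEnd_triangle.2 (Or.inl h.1)) ▸ hm)
    · have hm : _ ∈ triangle s l (D.toNext x s) (D.toPrev x s) := ⟨i + 2, rfl⟩
      have hi3 : i + 2 + 1 = i := by rw [add_assoc]; exact add_zero i
      refine hpR (D.disjoint _ hpm _ (hR hm) _ hi (isEnd_triangle.2 (Or.inr ?_)) ▸ hm)
      rw [hi3, h.2]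
  have hnext : ∀ i, (D.next * Equiv.swap p.tail p.head) (x i) = D.next (x i) :=
    fun i => smoothing_swap_apply (hend i)
  have hN : (D.smoothed p).toNext x s = D.toNext x s := by
    funext i
    change (if _ then (D.next * Equiv.swap p.tail p.head) (x i) else _) = _
    rw [hnext]; rfl
  have hP : (D.smoothed p).toPrev x s = D.toPrev x s := by
    funext i
    change (if _ then _ else (D.next * Equiv.swap p.tail p.head) (x i)) = _
    rw [hnext]; rfl
  have htri : ∀ u v : Fin 3 → D.Pt, Arrow.unlabel '' triangle s l u v =
      triangle s (fun _ => ()) u v := by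
    intro u v
    rw [triangle, triangle, ← Set.range_comp]
    congr 1
    funext i
    simp only [Function.comp]
    split_ifs <;> rfl
  refine Quot.sound (FlatMove.flat3 (D := D.smoothed p) x ⟨hx.1, ?_⟩ s ?_)
  · intro i j
    change (D.next * Equiv.swap p.tail p.head) (x i) ≠ x j
    rw [hnext]
    exact hx.2 i j
  · rw [hN, hP]
    refine replace_inPlace (valid_others D.valid p) (valid_others hB p) ?_ fun c => ?_
    · rw [← htri]
      rintro _ ⟨a, ha, rfl⟩
      exact Finset.mem_image_of_mem _ (Finset.mem_erase.2 ⟨fun h => hpR (h ▸ ha), hR ha⟩)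
    · rw [← htri, ← htri]
      exact mem_others D.valid hR hpT h c

theorem others_eq_insert {A F : Finset (Arrow P Bool)} {T : Fin 3 → Arrow P Bool}
    (h : ∀ a, a ∈ A ↔ a ∈ F ∨ ∃ j, T j = a) {i : Fin 3} (hF : T i ∉ F)
    (hT : ∀ j, j ≠ i → T j ≠ T i) :
    others A (T i) = insert (T (i + 1)).unlabel (insert (T (i + 2)).unlabel
      (F.image Arrow.unlabel)) := by
  have h1 : i + 1 ≠ i ∧ i + 2 ≠ i := (by decide : ∀ i : Fin 3, i + 1 ≠ i ∧ i + 2 ≠ i) i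
  have h2 : ∀ j, j ≠ i → j = i + 1 ∨ j = i + 2 :=
    (by decide : ∀ i j : Fin 3, j ≠ i → j = i + 1 ∨ j = i + 2) i
  ext c
  simp only [others, Finset.mem_image, Finset.mem_erase, Finset.mem_insert]
  constructor
  · rintro ⟨a, ⟨hap, ha⟩, rfl⟩
    rcases (h a).1 ha with ha | ⟨j, rfl⟩
    · exact Or.inr (Or.inr ⟨a, ha, rfl⟩)
    · rcases h2 j (fun hj => hap (by rw [hj])) with rfl | rfl
      · exact Or.inl rfl
      · exact Or.inr (Or.inl rfl)
  · rintro (rfl | rfl | ⟨a, ha, rfl⟩)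
    · exact ⟨_, ⟨hT _ h1.1, (h _).2 (Or.inr ⟨_, rfl⟩)⟩, rfl⟩
    · exact ⟨_, ⟨hT _ h1.2, (h _).2 (Or.inr ⟨_, rfl⟩)⟩, rfl⟩
    · exact ⟨a, ⟨fun h' => hF (h' ▸ ha), (h a).2 (Or.inl ha)⟩, rfl⟩

theorem swap_dir (r : Bool) (x y : P) (l : Bool) :
    Equiv.swap (Arrow.dir r x y l).tail (Arrow.dir r x y l).head = Equiv.swap x y := by
  cases r
  · exact Equiv.swap_comm y x
  · rfl

theorem flatLink_mk_congr {σ τ : Equiv.Perm P} {A B : Finset (Arrow P Unit)} {hA : Valid A}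
    {hB : Valid B} (h : σ = τ) (h' : A = B) :
    FlatLink.mk (ofPerm σ A hA) = FlatLink.mk (ofPerm τ B hB) := by
  subst h h'
  rfl

theorem others_pair {A F : Finset (Arrow P Bool)} {p q : Arrow P Bool}
    (h : ∀ a, a ∈ A ↔ a ∈ F ∨ a = p ∨ a = q) (hp : p ∉ F) (hne : q ≠ p) :
    others A p = insert q.unlabel (F.image Arrow.unlabel) := by
  ext c
  simp only [others, Finset.mem_image, Finset.mem_erase, Finset.mem_insert]
  constructor
  · rintro ⟨a, ⟨hap, ha⟩, rfl⟩
    rcases (h a).1 ha with ha | rfl | rfl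
    · exact Or.inr ⟨a, ha, rfl⟩
    · exact absurd rfl hap
    · exact Or.inl rfl
  · rintro (rfl | ⟨a, ha, rfl⟩)
    · exact ⟨q, ⟨hne, (h q).2 (Or.inr (Or.inr rfl))⟩, rfl⟩
    · exact ⟨a, ⟨fun h' => hp (h' ▸ ha), (h a).2 (Or.inl ha)⟩, rfl⟩

/-- Starting the numbering of the strands at `i` makes the double-point the crossing of the first
two of them. `linkEq_triangle` then compares the smoothings, in the presence of the untouched arrows
`F`. -/
theorem smoothed_triangle {D : Diagram Bool} {B : Finset (Arrow D.Pt Bool)} (hB : Valid B)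
    {x : Fin 3 → D.Pt} (hx : D.Strands x)
    {s l : Fin 3 → Bool} (hR : triangle s l (D.toNext x s) (D.toPrev x s) ⊆ D.arrows)
    (h : ∀ a, a ∈ B ↔ (a ∈ D.arrows ∧ a ∉ triangle s l (D.toNext x s) (D.toPrev x s)) ∨
      a ∈ triangle s l (D.toPrev x s) (D.toNext x s)) (i : Fin 3) (hi : l i = true)
    (hj : ∀ j, j ≠ i → l j = false) :
    FlatLink.mk (D.smoothed (Arrow.dir (s i) (D.toNext x s i) (D.toPrev x s (i + 1)) true)) =
      FlatLink.mk ((ofPerm D.next B hB).smoothed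
        (Arrow.dir (s i) (D.toPrev x s i) (D.toNext x s (i + 1)) true)) := by
  classical
  let F := D.arrows.filter (· ∉ triangle s l (D.toNext x s) (D.toPrev x s))
  let T : Fin 3 → Arrow D.Pt Bool := fun j =>
    Arrow.dir (s j) (D.toNext x s j) (D.toPrev x s (j + 1)) (l j)
  let T' : Fin 3 → Arrow D.Pt Bool := fun j =>
    Arrow.dir (s j) (D.toPrev x s j) (D.toNext x s (j + 1)) (l j)
  have hT : ∀ j, T j ∈ D.arrows := fun j => hR ⟨j, rfl⟩
  have hF : ∀ j, FreeIn F (x j) ∧ FreeIn F (D.next (x j)) := by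
    have hN : ∀ j, FreeIn F (D.toNext x s j) := by
      intro j a ha hax
      rw [Finset.mem_filter] at ha
      refine ha.2 ⟨j, ?_⟩
      exact D.disjoint _ (hT j) _ ha.1 _ (Arrow.isEnd_dir.2 (Or.inl rfl)) hax
    have hP : ∀ j, FreeIn F (D.toPrev x s j) := by
      intro j a ha hax
      rw [Finset.mem_filter] at ha
      refine ha.2 ⟨j + 2, ?_⟩
      have hj3 : j + 2 + 1 = j := by rw [add_assoc]; exact add_zero j
      exact D.disjoint _ (hT (j + 2)) _ ha.1 _ (Arrow.isEnd_dir.2 (Or.inr (by rw [hj3]))) hax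
    intro j
    rcases toNext_or x s j with h | h
    · exact ⟨h.1 ▸ hN j, h.2 ▸ hP j⟩
    · exact ⟨h.2 ▸ hP j, h.1 ▸ hN j⟩
  have hN' : ∀ j, FreeIn F (D.toPrev x s j) := by
    intro j
    rcases toNext_or x s j with h | h <;> rw [h.2]
    · exact (hF j).2
    · exact (hF j).1
  have e1 : others D.arrows (T i) = _ := others_eq_insert (A := D.arrows) (F := F) (T := T)
    (fun a => by
      rw [Finset.mem_filter]
      change _ ↔ _ ∨ a ∈ triangle s l (D.toNext x s) (D.toPrev x s)
      constructor
      · intro ha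
        by_cases h' : a ∈ triangle s l (D.toNext x s) (D.toPrev x s)
        · exact Or.inr h'
        · exact Or.inl ⟨ha, h'⟩
      · rintro (h' | h')
        · exact h'.1
        · exact hR h') (i := i)
    (fun h' => (Finset.mem_filter.1 h').2 ⟨i, rfl⟩)
    (fun j hji h' => by
      have := congrArg Arrow.label h'
      simp [T, hi, hj j hji] at this)
  have e2 : others B (T' i) = _ := others_eq_insert (A := B) (F := F) (T := T')
    (fun a => by rw [h, Finset.mem_filter]; rfl) (i := i)
    (fun h' => hN' i _ h' (Arrow.isEnd_dir.2 (Or.inl rfl)))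
    (fun j hji h' => by
      have := congrArg Arrow.label h'
      simp [T', hi, hj j hji] at this)
  have hV : Valid (F.image Arrow.unlabel) := (D.valid.mono (Finset.filter_subset _ _)).unlabel
  have key := linkEq_triangle (σ := D.next) hV (x := x i) (x' := D.next (x i)) (y := x (i + 1))
    (y' := D.next (x (i + 1))) (z := x (i + 2)) (z' := D.next (x (i + 2))) ?_ rfl rfl rfl ?_
    (s i) (s (i + 1)) (s (i + 2))
  · have i1 : i + 1 + 2 = i := by rw [add_assoc]; exact add_zero i
    have i2 : i + 2 + 1 = i := by rw [add_assoc]; exact add_zero i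
    have i3 : i + 2 + 2 = i + 1 := (by decide : ∀ i : Fin 3, i + 2 + 2 = i + 1) i
    have i4 : i + 1 + 1 = i + 2 := add_assoc i 1 1
    simp only [T, T', hi, Arrow.unlabel_dir, i2, i4] at e1 e2
    have key' : LinkEq (D.next * Equiv.swap (D.toNext x s i) (D.toPrev x s (i + 1)))
        (insert (Arrow.dir (s (i + 1)) (D.toNext x s (i + 1)) (D.toPrev x s (i + 2)) ())
          (insert (Arrow.dir (s (i + 2)) (D.toNext x s (i + 2)) (D.toPrev x s i) ())
            (F.image Arrow.unlabel)))
        (D.next * Equiv.swap (D.toPrev x s i) (D.toNext x s (i + 1)))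
        (insert (Arrow.dir (s (i + 1)) (D.toPrev x s (i + 1)) (D.toNext x s (i + 2)) ())
          (insert (Arrow.dir (s (i + 2)) (D.toPrev x s (i + 2)) (D.toNext x s i) ())
            (F.image Arrow.unlabel))) := by
      simpa only [Diagram.toNext, Diagram.toPrev, i1, i3] using key
    obtain ⟨_, _, key'⟩ := key'
    exact (flatLink_mk_congr (by rw [swap_dir]) e1).trans
      (key'.trans (flatLink_mk_congr (by rw [swap_dir]) e2.symm))
  · have hn : ∀ j k, D.next (x j) ≠ x k := hx.2
    have hij : i ≠ i + 1 ∧ i ≠ i + 2 ∧ i + 1 ≠ i + 2 :=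
      (by decide : ∀ i : Fin 3, i ≠ i + 1 ∧ i ≠ i + 2 ∧ i + 1 ≠ i + 2) i
    have hinj : ∀ {j k}, j ≠ k → x j ≠ x k := fun h h' => h (hx.1 h')
    have hinj' : ∀ {j k}, j ≠ k → D.next (x j) ≠ D.next (x k) :=
      fun h h' => h (hx.1 (D.next.injective h'))
    simp only [List.nodup_cons, List.mem_cons, List.not_mem_nil, or_false, not_or]
    exact ⟨⟨(hn _ _).symm, hinj hij.1, (hn _ _).symm, hinj hij.2.1, (hn _ _).symm⟩,
      ⟨hn _ _, hinj' hij.1, hn _ _, hinj' hij.2.1⟩, ⟨(hn _ _).symm, hinj hij.2.2, (hn _ _).symm⟩,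
      ⟨hn _ _, hinj' hij.2.2⟩, (hn _ _).symm, not_false, List.nodup_nil⟩
  · simp only [List.mem_cons, List.not_mem_nil, or_false, forall_eq_or_imp, forall_eq]
    exact ⟨freeIn_unlabel (hF _).1, freeIn_unlabel (hF _).2, freeIn_unlabel (hF _).1,
      freeIn_unlabel (hF _).2, freeIn_unlabel (hF _).1, freeIn_unlabel (hF _).2⟩

/-- A move away from the double-point survives the smoothing. The two moves that involve it, the
third move and the switch, are covered by `smoothed_triangle` and `linkEq_switch`. -/
theorem smoothed_eq_of_singularMove {D D' : Diagram Bool} (h : SingularMove D D')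
    {p : Arrow D.Pt Bool} {p' : Arrow D'.Pt Bool} (hp : D.preferred = {p})
    (hp' : D'.preferred = {p'}) : FlatLink.mk (D.smoothed p) = FlatLink.mk (D'.smoothed p') := by
  have hpm : p ∈ D.arrows ∧ p.label = true := mem_preferred.1 (by rw [hp]; simp)
  have huniq : ∀ a ∈ D.arrows, a.label = true → a = p := by
    intro a ha hl
    have : a ∈ D.preferred := mem_preferred.2 ⟨ha, hl⟩
    rwa [hp, Finset.mem_singleton] at this
  have inPlace : ∀ {A : Finset (Arrow D.Pt Bool)} (hA : Valid A) {q : Arrow D.Pt Bool},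
      (ofPerm D.next A hA).Replace D' ∅ ∅ → q ∈ A → q.label = true →
      FlatLink.mk ((ofPerm D.next A hA).smoothed q) = FlatLink.mk (D'.smoothed p') := by
    intro A hA q hr hq hl
    refine smoothed_homeo hr (Finset.ext fun a => ?_) hp'
    obtain ⟨-, e, hn, he⟩ := hr
    have key : ∀ a, a ∈ (ofPerm D.next A hA).preferred ↔ a.map e = p' := by
      intro a
      rw [← Finset.mem_singleton, ← hp', mem_preferred, mem_preferred, he]
      simp [Arrow.map]
    have hq' := (key q).1 (mem_preferred.2 ⟨hq, hl⟩)
    rw [key, ← hq', (Arrow.map_injective e.injective).eq_iff, Finset.mem_singleton]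
  cases h with
  | homeo h => exact smoothed_homeo h hp hp'
  | subdivide q =>
    have : p' = p.map some := by
      have : p.map some ∈ (D.subdivide q).preferred :=
        mem_preferred.2 ⟨Finset.mem_image_of_mem _ hpm.1, hpm.2⟩
      exact (Finset.mem_singleton.1 (hp' ▸ this)).symm
    subst this
    exact smoothed_subdivide D q p
  | flat1 a b ha hb hab h =>
    obtain ⟨A, hA, hmem, hr⟩ := h.exists_inPlace
    refine Eq.trans ?_ (inPlace hA hr ((hmem p).2 (Or.inl ⟨hpm.1, by simp⟩)) hpm.2)
    refine Quot.sound (FlatMove.flat1 (D := D.smoothed p) a b ?_ ?_ ⟨hab.1, ?_⟩ ?_)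
    · exact freeIn_unlabel (FreeIn.mono ha (Finset.erase_subset _ _))
    · exact freeIn_unlabel (FreeIn.mono hb (Finset.erase_subset _ _))
    · rw [smoothing_swap_apply (ha p hpm.1), smoothing_swap_apply (hb p hpm.1)]
      exact hab.2
    · refine replace_inPlace (valid_others D.valid p) (valid_others hA p) (Set.empty_subset _)
        fun c => ?_
      have := mem_others D.valid h.1 (p := p)
        (by rintro rfl; simp at hpm) hmem c
      rwa [Set.image_empty, Set.image_singleton] at this
  | flat2 a a' b b' hd hf haa hbb h =>
    obtain ⟨A, hA, hmem, hr⟩ := h.exists_inPlace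
    refine Eq.trans ?_ (inPlace hA hr ((hmem p).2 (Or.inl ⟨hpm.1, by simp⟩)) hpm.2)
    have hne : ∀ x ∈ [a, a', b, b'], (D.next * Equiv.swap p.tail p.head) x = D.next x :=
      fun x hx => smoothing_swap_apply (hf x hx p hpm.1)
    refine Quot.sound (FlatMove.flat2 (D := D.smoothed p) a a' b b' hd ?_ ⟨haa.1, ?_⟩
      ⟨hbb.1, ?_⟩ ?_)
    · exact fun x hx => freeIn_unlabel (FreeIn.mono (hf x hx) (Finset.erase_subset _ _))
    · rw [hne a (by simp), hne a' (by simp)]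
      exact haa.2
    · rw [hne b (by simp), hne b' (by simp)]
      exact hbb.2
    · refine replace_inPlace (valid_others D.valid p) (valid_others hA p) (Set.empty_subset _)
        fun c => ?_
      have := mem_others D.valid h.1 (p := p)
        (by rintro (rfl | rfl) <;> simp at hpm) hmem c
      rwa [Set.image_empty, Set.image_pair] at this
  | flat3 x hx s l hl h =>
    obtain ⟨A, hA, hmem, hr⟩ := h.exists_inPlace
    by_cases hi : ∃ i, l i = true
    · obtain ⟨i, hi⟩ := hi
      have h1 : Arrow.dir (s i) (D.toNext x s i) (D.toPrev x s (i + 1)) true = p :=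
        huniq _ (h.1 ⟨i, by beta_reduce; rw [hi]; rfl⟩) (Arrow.label_dir)
      subst h1
      refine (smoothed_triangle hA hx h.1 hmem i hi fun j hj => ?_).trans
        (inPlace hA hr ((hmem _).2 (Or.inr ⟨i, by beta_reduce; rw [hi]; rfl⟩)) Arrow.label_dir)
      by_contra hj'
      exact hj (hl j i (by simpa using hj') hi)
    · have hlf : ∀ u v : Fin 3 → D.Pt, ∀ a ∈ triangle s l u v, a.label = false := by
        rintro u v _ ⟨i, rfl⟩
        have : l i = false := by by_contra h'; exact hi ⟨i, by simpa using h'⟩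
        beta_reduce
        split_ifs <;> exact this
      have hpR : ∀ u v, p ∉ triangle s l u v := fun u v h' => by
        have := hlf u v p h'
        rw [hpm.2] at this
        cases this
      exact (smoothed_flat3 hA hpm.1 hx h.1 (hpR _ _) (hpR _ _) hmem).trans
        (inPlace hA hr ((hmem p).2 (Or.inl ⟨hpm.1, hpR _ _⟩)) hpm.2)
  | switch a a' b b' hab hba h =>
    obtain ⟨A, hA, hmem, hr⟩ := h.exists_inPlace
    have h1 : (⟨a, b, true⟩ : Arrow D.Pt Bool) = p := huniq _ (h.1 (Or.inl rfl)) rfl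
    have h2 : (⟨a', b', false⟩ : Arrow D.Pt Bool) ∈ D.arrows := h.1 (Or.inr rfl)
    subst h1
    refine Eq.trans ?_ (inPlace hA (q := ⟨a', b', true⟩) hr
      ((hmem _).2 (Or.inr (Or.inr rfl))) rfl)
    classical
    let F := D.arrows.filter
      (· ∉ ({⟨a, b, true⟩, ⟨a', b', false⟩} : Set (Arrow D.Pt Bool)))
    have hd : [a, a', b, b'].Nodup := by
      have h3 : a ≠ b := D.tail_ne_head _ hpm.1
      have h4 : a' ≠ b' := D.tail_ne_head _ h2
      have h5 : ∀ x, (⟨a, b, true⟩ : Arrow D.Pt Bool).IsEnd x →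
          ¬ (⟨a', b', false⟩ : Arrow D.Pt Bool).IsEnd x := fun x hx hx' => by
        have := D.disjoint _ hpm.1 _ h2 x hx hx'
        cases this
      have h6 := h5 a (Or.inl rfl)
      have h7 := h5 b (Or.inr rfl)
      simp only [Arrow.IsEnd, not_or] at h6 h7
      simp only [List.nodup_cons, List.mem_cons, List.not_mem_nil, or_false, not_or]
      grind
    have hF : ∀ x ∈ [a, a', b, b'], FreeIn F x := by
      have hq : ∀ c ∈ ({⟨a, b, true⟩, ⟨a', b', false⟩} : Set (Arrow D.Pt Bool)), ∀ x, c.IsEnd x →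
          FreeIn F x := by
        intro c hc x hx e he hex
        rw [Finset.mem_filter] at he
        exact he.2 (D.disjoint _ (h.1 hc) _ he.1 x hx hex ▸ hc)
      simp only [List.mem_cons, List.not_mem_nil, or_false, forall_eq_or_imp, forall_eq]
      exact ⟨hq _ (Or.inl rfl) _ (Or.inl rfl), hq _ (Or.inr rfl) _ (Or.inl rfl),
        hq _ (Or.inl rfl) _ (Or.inr rfl), hq _ (Or.inr rfl) _ (Or.inr rfl)⟩
    have e1 := others_pair (A := D.arrows) (F := F) (p := ⟨a, b, true⟩) (q := ⟨a', b', false⟩)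
      (fun c => by
        rw [Finset.mem_filter]
        constructor
        · intro hc
          by_cases h' : c ∈ ({⟨a, b, true⟩, ⟨a', b', false⟩} : Set (Arrow D.Pt Bool))
          · exact Or.inr h'
          · exact Or.inl ⟨hc, h'⟩
        · rintro (h' | h')
          · exact h'.1
          · exact h.1 h')
      (fun h' => hF a (by simp) _ h' (Or.inl rfl)) (by simp)
    have e2 := others_pair (A := A) (F := F) (p := ⟨a', b', true⟩) (q := ⟨a, b, false⟩)
      (fun c => by
        rw [hmem, Finset.mem_filter]
        exact or_congr Iff.rfl or_comm)
      (fun h' => hF a' (by simp) _ h' (Or.inl rfl)) (by simp)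
    obtain ⟨_, _, key⟩ := linkEq_switch (σ := D.next)
      ((D.valid.mono (Finset.filter_subset _ _)).unlabel : Valid (F.image Arrow.unlabel)) hd
      (fun x hx => freeIn_unlabel (hF x hx)) hab.2 hba.2
    exact (flatLink_mk_congr rfl e1).trans (key.trans (flatLink_mk_congr rfl e2.symm))

/-- The smoothing of a flat singular virtual knot at its double-point. -/
noncomputable def FlatSingularKnot.smoothing : FlatSingularKnot → FlatLink :=
  Quot.lift (fun α : SingularString => FlatLink.mk (α.diagram.smoothed α.point)) fun α β h => by
    have hp : ∀ α : SingularString, α.diagram.preferred = {α.point} := by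
      intro α
      ext a
      rw [mem_preferred, Finset.mem_singleton]
      constructor
      · rintro ⟨h1, h2⟩
        exact (α.label_iff a h1).1 h2
      · rintro rfl
        exact ⟨α.mem, (α.label_iff _ α.mem).2 rfl⟩
    exact smoothed_eq_of_singularMove h (hp α) (hp β)

theorem smoothing_glue (D : KnotDiagram) (d : Arrow D.1.Pt ℤˣ) (hd : d ∈ D.1.arrows) :
    FlatSingularKnot.smoothing (FlatSingularKnot.mk (D.glue d hd)) =
      FlatLink.mk (D.1.smooth d).shadow := by
  refine flatLink_mk_congr (P := D.1.Pt) (hB := (D.1.smooth d).shadow.valid) ?_ ?_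
  · change D.1.next * _ = D.1.next * _
    congr 1
    change Equiv.swap (d.flat true).tail (d.flat true).head = _
    unfold Arrow.flat
    split_ifs
    · rfl
    · exact Equiv.swap_comm _ _
  · change others (D.1.arrows.image fun a => a.flat (decide (a = d))) (d.flat true) =
      (D.1.arrows.erase d).image fun a => a.flat ()
    ext c
    simp only [others, Finset.mem_image, Finset.mem_erase]
    have hu : ∀ (a : Arrow D.1.Pt ℤˣ) (l : Bool), (a.flat l).unlabel = a.flat () := by
      intro a l
      unfold Arrow.flat
      split_ifs <;> rfl
    constructor
    · rintro ⟨_, ⟨hne, a, ha, rfl⟩, rfl⟩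
      refine ⟨a, ⟨?_, ha⟩, (hu _ _).symm⟩
      rintro rfl
      simp at hne
    · rintro ⟨a, ⟨hne, ha⟩, rfl⟩
      refine ⟨_, ⟨fun h => ?_, a, ha, rfl⟩, hu _ _⟩
      have := congrArg Arrow.label h
      simp [hne] at this

/-- Smoothing the kink closes its second point up to a circle of its own and leaves its first point
as an auxiliary point behind `p`. -/
theorem smoothing_singZero (D : KnotDiagram) (p : D.1.Pt) (r : Bool) (ε : ℤˣ) :
    FlatSingularKnot.smoothing (FlatSingularKnot.mk (D.singZero p r ε)) =
      FlatLink.mk D.1.shadow.addCircle := by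
  refine (smoothing_glue _ _ _).trans ?_
  obtain ⟨k, hk⟩ : ∃ k : Arrow (Option (Option D.1.Pt)) ℤˣ, k = D.kinkArrow p r ε := ⟨_, rfl⟩
  have hswap : Equiv.swap k.tail k.head = Equiv.swap none (some none) := by
    subst hk
    cases r
    · rfl
    · exact Equiv.swap_comm _ _
  have hend : k.IsEnd none := by
    subst hk
    cases r
    · exact Or.inl rfl
    · exact Or.inr rfl
  have harr : ((D.kink p r ε).1.smooth (D.kinkArrow p r ε)).arrows =
      (D.1.arrows.image (Arrow.map some)).image (Arrow.map some) := by
    refine Finset.erase_insert fun h => ?_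
    change D.kinkArrow p r ε ∈ Finset.image (Arrow.map some) _ at h
    rw [← hk] at h
    obtain ⟨b, -, rfl⟩ := Finset.mem_image.1 h
    obtain ⟨x, -, hx⟩ := Arrow.isEnd_map.1 hend
    cases hx
  -- In the circle-added diagram the point added last is the auxiliary one, whereas in the kinked
  -- diagram it is the one that splits off; hence the exchange of the two.
  refine ((Isotopic.of_equiv (D := ((D.kink p r ε).1.smooth (D.kinkArrow p r ε)).shadow)
    (D' := D.1.shadow.addCircle.subdivide (some p : Option D.1.Pt))
    (Equiv.swap (none : Option (Option D.1.Pt)) (some none)) ?_ ?_).trans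
      (Isotopic.subdivide _ _).symm).flatLink_eq
  · suffices H : ∀ x : Option (Option D.1.Pt), insertAfter (Equiv.optionCongr D.1.next) (some p)
        (Equiv.swap none (some none) x) = Equiv.swap none (some none)
          (insertTwo D.1.next p (Equiv.swap none (some none) x)) by
      subst hk
      exact fun x => (H x).trans (congrArg (fun f : Equiv.Perm (Option (Option D.1.Pt)) =>
        Equiv.swap none (some none) (insertTwo D.1.next p (f x))) hswap.symm)
    intro x
    have htw : ∀ y : D.1.Pt, Equiv.swap (none : Option (Option D.1.Pt)) (some none) (twice y) =
        twice y := fun y => Equiv.swap_apply_of_ne_of_ne (by simp [twice]) (by simp [twice])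
    rcases x with _ | _ | x
    · rw [Equiv.swap_apply_left, insertTwo_some_none, Equiv.swap_apply_left,
        insertAfter_of_ne _ (by simp)]
      rfl
    · rw [Equiv.swap_apply_right, insertTwo_none, htw, insertAfter_none]
      rfl
    · change insertAfter _ _ (Equiv.swap none (some none) (twice x)) = Equiv.swap none (some none)
        (insertTwo D.1.next p (Equiv.swap none (some none) (twice x)))
      rw [htw]
      by_cases hx : x = p
      · subst hx
        rw [insertTwo_self, Equiv.swap_apply_right]
        exact insertAfter_self _ _
      · rw [insertTwo_of_ne _ hx, htw]
        exact insertAfter_of_ne _ (by simpa using hx)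
  · change Finset.image (Arrow.map some) (Finset.image (Arrow.map some)
        (D.1.arrows.image fun a => a.flat ())) =
      Finset.image (Arrow.map (Equiv.swap (none : Option (Option D.1.Pt)) (some none)))
        (Finset.image (fun a : Arrow (Option (Option D.1.Pt)) ℤˣ => a.flat ())
          ((D.kink p r ε).1.smooth (D.kinkArrow p r ε)).arrows)
    rw [harr, Finset.image_image, Finset.image_image, Finset.image_image, Finset.image_image,
      Finset.image_image]
    refine Finset.image_congr fun a _ => ?_
    simp only [Function.comp, Arrow.map_flat]
    congr 1

/-- The smoothing invariant. -/
noncomputable def smoothingInvariant (K : VirtualKnot) : FreeAbelianGroup FlatLink :=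
  FreeAbelianGroup.map FlatSingularKnot.smoothing (gluingInvariant K)

/-- The homomorphism induced by smoothing takes the gluing sum to the smoothing sum term by term,
whatever kink is chosen. -/
theorem smoothingInvariant_mk (D : KnotDiagram) :
    smoothingInvariant (VirtualKnot.mk D) = D.smoothingSum := by
  rw [smoothingInvariant, gluingInvariant_mk D D.2.1.some true 1, KnotDiagram.gluingSum,
    KnotDiagram.smoothingSum, map_sum, ← Finset.sum_attach D.1.arrows]
  refine Finset.sum_congr rfl fun d _ => ?_
  rw [map_zsmul, map_sub, FreeAbelianGroup.map_of_apply, FreeAbelianGroup.map_of_apply,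
    smoothing_glue, smoothing_singZero]

end Invariance

/-! ### Arcs as functions on the marked points. -/

section Curves

variable {P : Type} [DecidableEq P]

/-- The interior of the arc from `x` to `y`, for the cyclic order `σ`. -/
def arcOf (σ : Equiv.Perm P) (x y : P) : Set P :=
  {z | ∃ k : ℕ, (σ ^ (k + 1)) x = z ∧ ∀ j ≤ k, (σ ^ (j + 1)) x ≠ y}

variable {σ : Equiv.Perm P}

theorem notMem_arcOf_right (x y : P) : y ∉ arcOf σ x y := by
  rintro ⟨k, hk, h⟩
  exact h k le_rfl hk

theorem apply_mem_arcOf {x y z : P} :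
    σ z ∈ arcOf σ x y ↔ (z = x ∨ z ∈ arcOf σ x y) ∧ σ z ≠ y := by
  constructor
  · rintro ⟨k, hk, h⟩
    refine ⟨?_, hk ▸ h k le_rfl⟩
    rw [pow_succ', Equiv.Perm.mul_apply] at hk
    have hz := σ.injective hk
    rcases k with _ | k
    · exact Or.inl hz.symm
    · exact Or.inr ⟨k, hz, fun j hj => h j (by omega)⟩
  · rintro ⟨rfl | ⟨k, rfl, h⟩, hne⟩
    · refine ⟨0, by simp, fun j hj => ?_⟩
      obtain rfl : j = 0 := by omega
      simpa using hne
    · refine ⟨k + 1, by rw [pow_succ' σ (k + 1), Equiv.Perm.mul_apply], fun j hj => ?_⟩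
      rcases Nat.lt_or_eq_of_le hj with hj | rfl
      · exact h j (by omega)
      · rwa [pow_succ' σ (k + 1), Equiv.Perm.mul_apply]

/-- Twice the arc from `x` to `y` as a function that takes half values at the ends. -/
noncomputable def curve (σ : Equiv.Perm P) (x y z : P) : ℤ :=
  open Classical in
  (if z ∈ arcOf σ x y then 2 else 0) + (if z = x then 1 else 0) + (if z = y then 1 else 0)

/-- The increment of `curve σ x y` between `z` and `σ z`. -/
def jump (σ : Equiv.Perm P) (x y z : P) : ℤ :=
  (if z = x then 1 else 0) + (if σ z = x then 1 else 0) - (if z = y then 1 else 0) -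
    (if σ z = y then 1 else 0)

theorem exists_first (hσ : ∀ x y, σ.SameCycle x y) [Finite P] (x y : P) :
    ∃ t : ℕ, (σ ^ t) x = y ∧ ∀ j < t, (σ ^ j) x ≠ y := by
  classical
  have h : ∃ t : ℕ, (σ ^ t) x = y := (hσ x y).exists_nat_pow_eq
  exact ⟨Nat.find h, Nat.find_spec h, fun j hj => Nat.find_min h hj⟩

/-- A return to `x` after `k + 1` steps makes the orbit periodic, so `y` already appears within
these steps, which the definition of the arc forbids. -/
theorem notMem_arcOf_left [Finite P] (hσ : ∀ x y, σ.SameCycle x y) {x y : P} (hxy : x ≠ y) :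
    x ∉ arcOf σ x y := by
  rintro ⟨k, hk, h⟩
  obtain ⟨t, ht, -⟩ := exists_first hσ x y
  have hper : ∀ m : ℕ, (σ ^ ((k + 1) * m)) x = x := by
    intro m
    induction m with
    | zero => rfl
    | succ m ih => rw [mul_add, mul_one, pow_add, Equiv.Perm.mul_apply, hk, ih]
  have hmod : (σ ^ (t % (k + 1))) x = y := by
    rw [← ht]
    conv_rhs => rw [← Nat.mod_add_div t (k + 1), pow_add, Equiv.Perm.mul_apply, hper]
  have hlt : t % (k + 1) < k + 1 := Nat.mod_lt t (Nat.succ_pos k)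
  rcases Nat.eq_zero_or_pos (t % (k + 1)) with h0 | hpos
  · rw [h0] at hmod
    exact hxy hmod
  · refine h (t % (k + 1) - 1) (by omega) ?_
    rwa [show t % (k + 1) - 1 + 1 = t % (k + 1) by omega]

theorem eq_or_mem_arcOf_of_apply_eq [Finite P] (hσ : ∀ x y, σ.SameCycle x y) {x y z : P}
    (hxy : x ≠ y) (hz : σ z = y) : z = x ∨ z ∈ arcOf σ x y := by
  obtain ⟨t, ht, hmin⟩ := exists_first hσ x y
  rcases t with _ | t
  · exact absurd ht hxy
  · rw [pow_succ', Equiv.Perm.mul_apply, ← hz] at ht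
    have ht' := σ.injective ht
    rcases t with _ | t
    · exact Or.inl ht'.symm
    · exact Or.inr ⟨t, ht', fun j hj => hmin (j + 1) (by omega)⟩

theorem curve_left [Finite P] (hσ : ∀ x y, σ.SameCycle x y) {x y : P} (hxy : x ≠ y) :
    curve σ x y x = 1 := by
  simp [curve, notMem_arcOf_left hσ hxy, hxy]

theorem curve_right {x y : P} (hxy : x ≠ y) : curve σ x y y = 1 := by
  simp [curve, notMem_arcOf_right, hxy.symm]

theorem curve_apply [Finite P] (hσ : ∀ x y, σ.SameCycle x y) {x y : P} (hxy : x ≠ y) (z : P) :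
    curve σ x y (σ z) = curve σ x y z + jump σ x y z := by
  have h1 := apply_mem_arcOf (σ := σ) (x := x) (y := y) (z := z)
  have h2 := notMem_arcOf_left hσ hxy
  have h3 := eq_or_mem_arcOf_of_apply_eq hσ hxy (z := z)
  have h4 : y ∉ arcOf σ x y := notMem_arcOf_right x y
  have h5 : z ∈ arcOf σ x y → z ≠ x ∧ z ≠ y := fun h =>
    ⟨fun h' => h2 (h' ▸ h), fun h' => h4 (h' ▸ h)⟩
  unfold curve jump
  by_cases a : σ z ∈ arcOf σ x y <;> by_cases b : z ∈ arcOf σ x y <;> by_cases c : z = x <;>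
    by_cases d : z = y <;> by_cases e : σ z = x <;> by_cases f : σ z = y <;>
    simp_all

theorem eq_of_jump (hσ : ∀ x y, σ.SameCycle x y) [Finite P] {u v : P → ℤ}
    (h : ∀ z, u (σ z) - u z = v (σ z) - v z) {x : P} (hx : u x = v x) : u = v := by
  funext y
  obtain ⟨k, rfl⟩ := (hσ x y).exists_nat_pow_eq
  induction k with
  | zero => exact hx
  | succ k ih =>
    rw [pow_succ', Equiv.Perm.mul_apply]
    have := h ((σ ^ k) x)
    omega

/-- On one circle a function is determined by its increments and one value. This replaces reasoning
about arcs: identities between curves are checked on `jump`, which is additive and local. -/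
theorem curve_eq [Finite P] (hσ : ∀ x y, σ.SameCycle x y) {x y : P} (hxy : x ≠ y) {u : P → ℤ}
    (h : ∀ z, u (σ z) = u z + jump σ x y z) (hx : u x = 1) : curve σ x y = u :=
  eq_of_jump hσ (fun z => by rw [curve_apply hσ hxy, h]; ring) (hx ▸ curve_left hσ hxy)

theorem curve_swap [Finite P] (hσ : ∀ x y, σ.SameCycle x y) {x y : P} (hxy : x ≠ y) (z : P) :
    curve σ y x z = 2 - curve σ x y z := by
  refine congrFun (curve_eq hσ hxy.symm (u := fun z => 2 - curve σ x y z) (fun z => ?_) ?_) z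
  · simp only [curve_apply hσ hxy, jump]
    ring
  · simp only [curve_right hxy]
    norm_num

theorem mem_arcOf_swap [Finite P] (hσ : ∀ x y, σ.SameCycle x y) {x y : P} (hxy : x ≠ y) {z : P}
    (hx : z ≠ x) (hy : z ≠ y) : z ∈ arcOf σ y x ↔ z ∉ arcOf σ x y := by
  have h := curve_swap hσ hxy z
  unfold curve at h
  simp only [if_neg hx, if_neg hy] at h
  by_cases a : z ∈ arcOf σ x y <;> by_cases b : z ∈ arcOf σ y x <;> simp_all

end Curves

/-! ### The matrix as a bilinear form. -/

section Pairing

variable {P L : Type} [DecidableEq P]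

/-- The intersection pairing of two functions on the marked points. -/
def pairing (A : Finset (Arrow P L)) (u v : P → ℤ) : ℤ :=
  ∑ a ∈ A, (u a.tail * v a.head - v a.tail * u a.head)

variable {A : Finset (Arrow P L)}

theorem pairing_skew (u v : P → ℤ) : pairing A u v = -pairing A v u := by
  rw [pairing, pairing, ← Finset.sum_neg_distrib]
  exact Finset.sum_congr rfl fun _ _ => by ring

theorem pairing_add_left (u u' v : P → ℤ) :
    pairing A (fun x => u x + u' x) v = pairing A u v + pairing A u' v := by
  rw [pairing, pairing, pairing, ← Finset.sum_add_distrib]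
  exact Finset.sum_congr rfl fun _ _ => by ring

variable [DecidableEq L]

theorem pairing_insert {a : Arrow P L} (ha : a ∉ A) (u v : P → ℤ) :
    pairing (insert a A) u v = u a.tail * v a.head - v a.tail * u a.head + pairing A u v :=
  Finset.sum_insert ha

/-- The function on the marked points that represents a row of the matrix of a diagram. -/
noncomputable def Diagram.crv (D : Diagram L) : Option {a // a ∈ D.arrows} → D.Pt → ℤ
  | none => fun _ => 2
  | some e => curve D.next e.1.tail e.1.head

open Classical in
theorem dot_eq_sum (D : Diagram L) (X Y : Set D.Pt) :
    D.dot X Y = ∑ a ∈ D.arrows, ((if a.tail ∈ X then 1 else 0) * (if a.head ∈ Y then 1 else 0) -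
      (if a.tail ∈ Y then 1 else 0) * (if a.head ∈ X then 1 else 0)) := by
  have key : ∀ X Y : Set D.Pt, (({e | e ∈ D.arrows ∧ e.tail ∈ X ∧ e.head ∈ Y}.ncard : ℕ) : ℤ) =
      ∑ a ∈ D.arrows, (if a.tail ∈ X then 1 else 0) * (if a.head ∈ Y then 1 else 0) := by
    intro X Y
    have : {e | e ∈ D.arrows ∧ e.tail ∈ X ∧ e.head ∈ Y} =
        ((D.arrows.filter fun e => e.tail ∈ X ∧ e.head ∈ Y : Finset _) : Set (Arrow D.Pt L)) := by
      ext; simp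
    rw [this, Set.ncard_coe_finset, Finset.card_filter]
    push_cast
    refine Finset.sum_congr rfl fun a _ => ?_
    split_ifs <;> simp_all
  rw [Diagram.dot, key, key, ← Finset.sum_sub_distrib]

/-- The factor is four because both functions are doubled. Arrows other than `e` and `f` contribute
the intersection number of the arcs. The arrows `e` and `f` themselves, on whose own ends the curve
has the middle value, contribute twice the linking number each. -/
theorem four_mul_matrix (D : Diagram L) (hD : D.IsKnot) (g h : Option {a // a ∈ D.arrows}) :
    4 * D.matrix g h = pairing D.arrows (D.crv g) (D.crv h) := by
  classical
  -- The complementary arc is the core minus the arc, up to the ends, so pairing with the constant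
  -- `2` counts the arrows between the two arcs.
  have base : ∀ e : {a // a ∈ D.arrows}, 4 * D.matrix (some e) none =
      pairing D.arrows (D.crv (some e)) (D.crv none) := by
    rintro ⟨e, he⟩
    have hne := D.tail_ne_head e he
    change 4 * D.dot _ _ = _
    rw [dot_eq_sum, Finset.mul_sum, pairing]
    refine Finset.sum_congr rfl fun a ha => ?_
    simp only [Diagram.crv]
    by_cases hae : a = e
    · subst hae
      rw [curve_left hD.2 hne, curve_right hne]
      have h1 : a.tail ∉ D.arc a.tail a.head := notMem_arcOf_left hD.2 hne
      have h2 : a.head ∉ D.arc a.tail a.head := notMem_arcOf_right _ _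
      simp [h1, h2]
    · have ht : ¬ e.IsEnd a.tail := fun h' => hae (D.disjoint a ha e he _ (Or.inl rfl) h')
      have hh : ¬ e.IsEnd a.head := fun h' => hae (D.disjoint a ha e he _ (Or.inr rfl) h')
      simp only [Arrow.IsEnd, not_or] at ht hh
      have h1 : a.tail ∈ D.arc e.head e.tail ↔ a.tail ∉ D.arc e.tail e.head :=
        mem_arcOf_swap hD.2 hne (Ne.symm ht.1) (Ne.symm ht.2)
      have h2 : a.head ∈ D.arc e.head e.tail ↔ a.head ∉ D.arc e.tail e.head :=
        mem_arcOf_swap hD.2 hne (Ne.symm hh.1) (Ne.symm hh.2)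
      have h3 : ∀ z, z ∈ arcOf D.next e.tail e.head ↔ z ∈ D.arc e.tail e.head := fun _ => Iff.rfl
      simp only [curve, h1, h2, h3, if_neg (Ne.symm ht.1), if_neg (Ne.symm ht.2),
        if_neg (Ne.symm hh.1), if_neg (Ne.symm hh.2)]
      split_ifs <;> simp_all
  rcases g with _ | e <;> rcases h with _ | f
  · simp [Diagram.matrix, pairing, Diagram.crv]
  · rw [pairing_skew, ← base]
    simp [Diagram.matrix]
  · exact base e
  · obtain ⟨e, he⟩ := e
    obtain ⟨f, hf⟩ := f
    have hne := D.tail_ne_head e he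
    have hnf := D.tail_ne_head f hf
    change 4 * (D.dot (D.arc e.tail e.head) (D.arc f.tail f.head) + D.linking e f) = _
    -- On the diagonal every term vanishes by skew-symmetry.
    by_cases hef : e = f
    · subst hef
      have h1 := D.dot_skew (D.arc e.tail e.head) (D.arc e.tail e.head)
      have h2 := D.linking_skew hD he he
      have h3 := pairing_skew (A := D.arrows) (D.crv (some ⟨e, he⟩)) (D.crv (some ⟨e, he⟩))
      omega
    have hfe : ∀ x, e.IsEnd x → ¬ f.IsEnd x := fun x hx hx' => hef (D.disjoint e he f hf x hx hx')
    have e1 := hfe _ (Or.inl rfl)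
    have e2 := hfe _ (Or.inr rfl)
    simp only [Arrow.IsEnd, not_or] at e1 e2
    have hl : ∀ e f : Arrow D.Pt L, e.tail ≠ e.head → f.tail ≠ e.tail → f.tail ≠ e.head →
        f.head ≠ e.tail → f.head ≠ e.head → D.linking e f =
          (if f.tail ∈ arcOf D.next e.tail e.head then 1 else 0) -
            (if f.head ∈ arcOf D.next e.tail e.head then 1 else 0) := by
      intro e f hne h1 h2 h3 h4
      have k1 : f.tail ∈ D.arc e.head e.tail ↔ f.tail ∉ arcOf D.next e.tail e.head :=
        mem_arcOf_swap hD.2 hne h1 h2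
      have k2 : f.head ∈ D.arc e.head e.tail ↔ f.head ∉ arcOf D.next e.tail e.head :=
        mem_arcOf_swap hD.2 hne h3 h4
      have k3 : ∀ z, z ∈ D.arc e.tail e.head ↔ z ∈ arcOf D.next e.tail e.head := fun _ => Iff.rfl
      rw [Diagram.linking, Diagram.LinksPos, Diagram.LinksNeg, k1, k2, k3, k3]
      by_cases a : f.tail ∈ arcOf D.next e.tail e.head <;>
        by_cases b : f.head ∈ arcOf D.next e.tail e.head <;> simp [a, b]
    have l1 := hl e f hne e1.1 e2.1 e1.2 e2.2
    have l2 := hl f e hnf (Ne.symm e1.1) (Ne.symm e1.2) (Ne.symm e2.1) (Ne.symm e2.2)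
    have l3 := D.linking_skew hD he hf
    -- The two extra sums pick out the arrows `e` and `f`, where the arcs are open and the curves
    -- take the value 1.
    have hsum : pairing D.arrows (D.crv (some ⟨e, he⟩)) (D.crv (some ⟨f, hf⟩)) =
        4 * D.dot (D.arc e.tail e.head) (D.arc f.tail f.head) +
          (∑ a ∈ D.arrows, if a = e then -2 * D.linking f e else 0) +
          ∑ a ∈ D.arrows, if a = f then 2 * D.linking e f else 0 := by
      rw [dot_eq_sum, Finset.mul_sum, pairing, ← Finset.sum_add_distrib, ← Finset.sum_add_distrib]
      refine Finset.sum_congr rfl fun a ha => ?_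
      simp only [Diagram.crv]
      have h3 : ∀ x y z, z ∈ D.arc x y ↔ z ∈ arcOf D.next x y := fun _ _ _ => Iff.rfl
      simp only [h3]
      by_cases hae : a = e
      · subst hae
        rw [curve_left hD.2 hne, curve_right hne, if_pos rfl, if_neg hef, l2]
        simp only [curve, if_neg (Ne.symm e1.1), if_neg (Ne.symm e1.2), if_neg (Ne.symm e2.1),
          if_neg (Ne.symm e2.2), if_neg (notMem_arcOf_left hD.2 hne),
          if_neg (notMem_arcOf_right (σ := D.next) a.tail a.head)]
        split_ifs <;> norm_num
      · by_cases haf : a = f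
        · subst haf
          rw [curve_left hD.2 hnf, curve_right hnf, if_pos rfl, if_neg hae, l1]
          simp only [curve, if_neg e1.1, if_neg e1.2, if_neg e2.1,
            if_neg e2.2, if_neg (notMem_arcOf_left hD.2 hnf),
            if_neg (notMem_arcOf_right (σ := D.next) a.tail a.head)]
          split_ifs <;> norm_num
        · have t1 : ¬ e.IsEnd a.tail := fun h' => hae (D.disjoint a ha e he _ (Or.inl rfl) h')
          have t2 : ¬ e.IsEnd a.head := fun h' => hae (D.disjoint a ha e he _ (Or.inr rfl) h')
          have t3 : ¬ f.IsEnd a.tail := fun h' => haf (D.disjoint a ha f hf _ (Or.inl rfl) h')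
          have t4 : ¬ f.IsEnd a.head := fun h' => haf (D.disjoint a ha f hf _ (Or.inr rfl) h')
          simp only [Arrow.IsEnd, not_or] at t1 t2 t3 t4
          simp only [curve, if_neg hae, if_neg haf, if_neg (Ne.symm t1.1), if_neg (Ne.symm t1.2),
            if_neg (Ne.symm t2.1), if_neg (Ne.symm t2.2), if_neg (Ne.symm t3.1),
            if_neg (Ne.symm t3.2), if_neg (Ne.symm t4.1), if_neg (Ne.symm t4.2)]
          split_ifs <;> norm_num
    rw [hsum, Finset.sum_ite_eq', Finset.sum_ite_eq', if_pos he, if_pos hf]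
    omega

end Pairing

/-! ### Curves at adjacent points. -/

section AdjacentPoints

variable {P : Type} [DecidableEq P] [Finite P] {σ : Equiv.Perm P}

/-- The indicator function of two points. -/
def pairInd (x x' z : P) : ℤ := (if z = x then 1 else 0) + (if z = x' then 1 else 0)

theorem curve_move_left (hσ : ∀ x y, σ.SameCycle x y) {x x' y : P} (h : σ x = x')
    (hxy : x ≠ y) (hxy' : x' ≠ y) (z : P) :
    curve σ x y z = curve σ x' y z + pairInd x x' z := by
  refine congrFun (eq_of_jump (u := curve σ x y)
    (v := fun z => curve σ x' y z + pairInd x x' z) hσ (fun z => ?_) (x := y) ?_) z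
  · have h1 : σ z = x' ↔ z = x := by rw [← h, σ.injective.eq_iff]
    simp only [curve_apply hσ hxy, curve_apply hσ hxy', jump, pairInd, h1]
    ring
  · simp only [curve_right hxy, curve_right hxy', pairInd, if_neg hxy.symm, if_neg hxy'.symm]
    norm_num

/-- The effect of moving an end of a curve to an adjacent point. -/
def AdjSign (σ : Equiv.Perm P) (a a' : P) (ε : ℤ) : Prop :=
  a ≠ a' ∧ (∀ y, a ≠ y → a' ≠ y → ∀ z, curve σ a y z = curve σ a' y z + ε * pairInd a a' z) ∧
    (∀ y, a ≠ y → a' ≠ y → ∀ z, curve σ y a z = curve σ y a' z - ε * pairInd a a' z) ∧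
    ∀ x y, x ≠ y → a ≠ x → a' ≠ x → a ≠ y → a' ≠ y → curve σ x y a = curve σ x y a'

theorem adjSign_one (hσ : ∀ x y, σ.SameCycle x y) {a a' : P} (h : σ a = a') (hne : a ≠ a') :
    AdjSign σ a a' 1 := by
  refine ⟨hne, fun y h1 h2 z => ?_, fun y h1 h2 z => ?_, fun x y h0 h1 h2 h3 h4 => ?_⟩
  · rw [one_mul]
    exact curve_move_left hσ h h1 h2 z
  · rw [curve_swap hσ h1, curve_swap hσ h2, curve_move_left hσ h h1 h2 z]
    ring
  · have := curve_apply hσ h0 a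
    rw [h, jump, h, if_neg h1, if_neg h2, if_neg h3, if_neg h4] at this
    rw [this]
    ring

theorem AdjSign.symm {a a' : P} {ε : ℤ} (h : AdjSign σ a a' ε) : AdjSign σ a' a (-ε) := by
  obtain ⟨hne, h1, h2, h3⟩ := h
  have hp : ∀ z, pairInd a' a z = pairInd a a' z := fun z => add_comm _ _
  refine ⟨hne.symm, fun y k1 k2 z => ?_, fun y k1 k2 z => ?_, fun x y h0 k1 k2 k3 k4 => ?_⟩
  · rw [h1 y k2 k1, hp]; ring
  · rw [h2 y k2 k1, hp]; ring
  · exact (h3 x y h0 k2 k1 k4 k3).symm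

theorem exists_adjSign (hσ : ∀ x y, σ.SameCycle x y) {a a' : P} (h : σ a = a' ∨ σ a' = a)
    (hne : a ≠ a') : ∃ ε, AdjSign σ a a' ε := by
  rcases h with h | h
  · exact ⟨1, adjSign_one hσ h hne⟩
  · exact ⟨_, (adjSign_one hσ h hne.symm).symm⟩

theorem AdjSign.left_apply (hσ : ∀ x y, σ.SameCycle x y) {a a' : P} {ε : ℤ}
    (h : AdjSign σ a a' ε) {y : P} (h1 : a ≠ y) (h2 : a' ≠ y) :
    curve σ a y a' = 1 + ε := by
  rw [h.2.1 y h1 h2, curve_left hσ h2, pairInd, if_neg h.1.symm, if_pos rfl]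
  ring

theorem AdjSign.right_apply {a a' : P} {ε : ℤ} (h : AdjSign σ a a' ε) {y : P}
    (h1 : a ≠ y) (h2 : a' ≠ y) : curve σ y a a' = 1 - ε := by
  rw [h.2.2.1 y h1 h2, curve_right h2.symm, pairInd, if_neg h.1.symm, if_pos rfl]
  ring

end AdjacentPoints

/-! ### Rows of the matrix at kinks and bigons. -/

section Matrices

variable {L L' : Type} [DecidableEq L] [DecidableEq L']

/-- The matrix of a diagram with a preferred arrow. -/
noncomputable def Diagram.matrixAt (D : Diagram L) (hD : D.IsKnot) (p : {a // a ∈ D.arrows}) :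
    SingularBasedMatrix ℤ where
  G := Option {a // a ∈ D.arrows}
  finite := inferInstance
  s := none
  d := some p
  s_ne_d := by simp
  b := D.matrix
  skew := fun g h => by
    have h1 := four_mul_matrix D hD g h
    have h2 := four_mul_matrix D hD h g
    rw [pairing_skew] at h1
    omega

theorem matrixAt_extends {D : Diagram L} {D' : Diagram L'} (hD : D.IsKnot) (hD' : D'.IsKnot)
    (φ : {a // a ∈ D.arrows} → {a // a ∈ D'.arrows}) (hφ : Function.Injective φ)
    (p : {a // a ∈ D.arrows}) (hb : ∀ g h, pairing D'.arrows (D'.crv (Option.map φ g))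
      (D'.crv (Option.map φ h)) = pairing D.arrows (D.crv g) (D.crv h))
    {N : Set (Option {a // a ∈ D'.arrows})} (hN : (Set.range (Option.map φ))ᶜ = N) :
    (D.matrixAt hD p).Extends (D'.matrixAt hD' (φ p)) (Option.map φ) N := by
  refine ⟨Option.map_injective hφ, rfl, rfl, fun g h => ?_, hN⟩
  have h1 := four_mul_matrix D hD g h
  have h2 := (four_mul_matrix D' hD' (Option.map φ g) (Option.map φ h)).trans (hb g h)
  change D'.matrix (Option.map φ g) (Option.map φ h) = D.matrix g h
  omega

theorem step_iso {D : Diagram L} {D' : Diagram L'} (hD : D.IsKnot) (hD' : D'.IsKnot)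
    (φ : {a // a ∈ D.arrows} → {a // a ∈ D'.arrows}) (hφ : Function.Bijective φ)
    (p : {a // a ∈ D.arrows}) (hb : ∀ g h, pairing D'.arrows (D'.crv (Option.map φ g))
      (D'.crv (Option.map φ h)) = pairing D.arrows (D.crv g) (D.crv h)) :
    SingularBasedMatrix.Step (D.matrixAt hD p) (D'.matrixAt hD' (φ p)) := by
  refine SingularBasedMatrix.Step.iso (Option.map φ) (matrixAt_extends hD hD' φ hφ.1 p hb ?_)
  refine Set.compl_empty_iff.2 (Set.range_eq_univ.2 ?_)
  rintro (_ | b)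
  · exact ⟨none, rfl⟩
  · obtain ⟨a, rfl⟩ := hφ.2 b
    exact ⟨some a, rfl⟩

/-- Covers every change that preserves the curves on the old points: homeomorphism, subdivision, and
the relabelling of arrows. -/
theorem step_of_map {D : Diagram L} {D' : Diagram L'} (hD : D.IsKnot) (hD' : D'.IsKnot)
    (f : D.Pt → D'.Pt) (hf : Function.Injective f) (φ : Arrow D.Pt L → Arrow D'.Pt L')
    (ht : ∀ a, (φ a).tail = f a.tail) (hh : ∀ a, (φ a).head = f a.head)
    (hA : D'.arrows = D.arrows.image φ)
    (hc : ∀ x y z, x ≠ y → curve D'.next (f x) (f y) (f z) = curve D.next x y z)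
    (p : {a // a ∈ D.arrows}) (p' : {a // a ∈ D'.arrows}) (hp : φ p = p') :
    SingularBasedMatrix.Step (D.matrixAt hD p) (D'.matrixAt hD' p') := by
  have hinj : Set.InjOn φ D.arrows := by
    intro a ha b hb hab
    refine D.disjoint a ha b hb a.tail (Or.inl rfl) (Or.inl ?_)
    exact (hf ((ht a).symm.trans ((congrArg Arrow.tail hab).trans (ht b)))).symm
  have hmem : ∀ a ∈ D.arrows, φ a ∈ D'.arrows := fun a ha => hA ▸ Finset.mem_image_of_mem _ ha
  obtain rfl : (⟨φ p, hmem p p.2⟩ : {a // a ∈ D'.arrows}) = p' := Subtype.ext hp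
  refine step_iso hD hD' (fun a => ⟨φ a, hmem a a.2⟩) ⟨fun a b h => ?_, fun b => ?_⟩ p
    fun g h => ?_
  · exact Subtype.ext (hinj a.2 b.2 (Subtype.ext_iff.1 h))
  · obtain ⟨a, ha, hab⟩ := Finset.mem_image.1 ((Finset.ext_iff.1 hA _).1 b.2)
    exact ⟨⟨a, ha⟩, Subtype.ext hab⟩
  · have hcrv : ∀ g z, D'.crv (Option.map (fun a : {a // a ∈ D.arrows} =>
        (⟨φ a, hmem a a.2⟩ : {a // a ∈ D'.arrows})) g) (f z) = D.crv g z := by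
      rintro (_ | ⟨a, ha⟩) z
      · rfl
      · simp only [Option.map_some, Diagram.crv, ht, hh]
        exact hc _ _ _ (D.tail_ne_head a ha)
    rw [pairing, pairing]
    refine (Finset.sum_congr hA fun _ _ => rfl).trans ?_
    rw [Finset.sum_image hinj]
    refine Finset.sum_congr rfl fun a _ => ?_
    rw [ht, hh, hcrv, hcrv, hcrv, hcrv]

/-- A function that vanishes off the ends of a few arrows pairs through these arrows only. Thus the
effect of a move is a finite computation. -/
theorem pairing_eq_of_support {P : Type} [DecidableEq P] {A S : Finset (Arrow P L)} (hA : Valid A)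
    (hS : S ⊆ A) {w v : P → ℤ} (hw : ∀ x, FreeIn S x → w x = 0) :
    pairing A w v = pairing S w v := by
  refine (Finset.sum_subset hS fun a ha haS => ?_).symm
  have hf : ∀ x, a.IsEnd x → w x = 0 := fun x hx => hw x fun b hb hbx =>
    haS (hA.disj b (hS hb) a ha x hbx hx ▸ hb)
  rw [hf _ (Or.inl rfl), hf _ (Or.inr rfl)]
  ring

theorem matrix_add_matrix {D : Diagram L} (hD : D.IsKnot) {g g' h : Option {a // a ∈ D.arrows}}
    {w : D.Pt → ℤ} (hw : ∀ z, D.crv g z + D.crv g' z = 2 + w z)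
    (h0 : pairing D.arrows w (D.crv h) = 0) : D.matrix g h + D.matrix g' h = D.matrix none h := by
  have h1 := four_mul_matrix D hD g h
  have h2 := four_mul_matrix D hD g' h
  have h3 := four_mul_matrix D hD none h
  have h4 : pairing D.arrows (D.crv g) (D.crv h) + pairing D.arrows (D.crv g') (D.crv h) =
      pairing D.arrows (D.crv none) (D.crv h) + pairing D.arrows w (D.crv h) := by
    rw [← pairing_add_left, ← pairing_add_left]
    congr 1
    funext z
    exact hw z
  omega

theorem crv_congr {D : Diagram L} {x x' : D.Pt} {ε : ℤ}
    (h : AdjSign D.next x x' ε) {g : Option {a // a ∈ D.arrows}}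
    (hg : ∀ a, g = some a → ¬ a.1.IsEnd x ∧ ¬ a.1.IsEnd x') : D.crv g x = D.crv g x' := by
  rcases g with _ | a
  · rfl
  · have h1 := hg a rfl
    simp only [Arrow.IsEnd, not_or] at h1
    exact h.2.2.2 _ _ (D.tail_ne_head _ a.2) (Ne.symm h1.1.1) (Ne.symm h1.2.1) (Ne.symm h1.1.2)
      (Ne.symm h1.2.2)

theorem crv_tail_eq_crv_head {D : Diagram L} (hD : D.IsKnot) {n : Arrow D.Pt L}
    (hn : n ∈ D.arrows) (h : D.next n.tail = n.head ∨ D.next n.head = n.tail)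
    (g : Option {a // a ∈ D.arrows}) : D.crv g n.tail = D.crv g n.head := by
  have hne := D.tail_ne_head n hn
  by_cases hg : g = some ⟨n, hn⟩
  · subst hg
    exact (curve_left hD.2 hne).trans (curve_right hne).symm
  · obtain ⟨ε, hε⟩ := exists_adjSign hD.2 h hne
    refine crv_congr hε fun a ha => ?_
    have hna : a.1 ≠ n := by
      rintro rfl
      exact hg ha
    exact ⟨fun h' => hna (D.disjoint _ a.2 n hn _ h' (Or.inl rfl)),
      fun h' => hna (D.disjoint _ a.2 n hn _ h' (Or.inr rfl))⟩

/-- The curve of the kink is 1 at its two ends and 0 elsewhere, and every curve takes equal values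
at these ends, so the only term of the pairing cancels. -/
theorem kink_row {D : Diagram L} (hD : D.IsKnot) {n : Arrow D.Pt L} (hn : n ∈ D.arrows)
    (h : D.next n.tail = n.head) (g : Option {a // a ∈ D.arrows}) :
    D.matrix (some ⟨n, hn⟩) g = 0 := by
  have hne := D.tail_ne_head n hn
  have hc : D.crv (some ⟨n, hn⟩) = pairInd n.tail n.head := by
    refine curve_eq hD.2 hne (fun z => ?_) ?_
    · have h1 : D.next z = n.head ↔ z = n.tail := by rw [← h, D.next.injective.eq_iff]
      simp only [jump, pairInd, h1]
      ring
    · simp [pairInd, hne]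
  have h1 := four_mul_matrix D hD (some ⟨n, hn⟩) g
  rw [pairing_eq_of_support (S := {n}) D.valid (Finset.singleton_subset_iff.2 hn), pairing,
    Finset.sum_singleton, crv_tail_eq_crv_head hD hn (Or.inl h) g, hc] at h1
  · simp only [pairInd, if_pos, if_neg hne, if_neg hne.symm] at h1
    omega
  · intro x hx
    have := hx n (Finset.mem_singleton_self _)
    simp only [Arrow.IsEnd, not_or] at this
    rw [hc, pairInd, if_neg (Ne.symm this.1), if_neg (Ne.symm this.2)]
    rfl

/-- When the head precedes the tail, the arc is the rest of the circle. The curve is the core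
function minus the previous one, which pairs to zero. -/
theorem kink_row' {D : Diagram L} (hD : D.IsKnot) {n : Arrow D.Pt L} (hn : n ∈ D.arrows)
    (h : D.next n.head = n.tail) (g : Option {a // a ∈ D.arrows}) :
    D.matrix (some ⟨n, hn⟩) g = D.matrix none g := by
  have hne := D.tail_ne_head n hn
  have hc : ∀ z, curve D.next n.tail n.head z = 2 - pairInd n.tail n.head z := by
    refine congrFun (curve_eq hD.2 hne (fun z => ?_) ?_)
    · have h1 : D.next z = n.tail ↔ z = n.head := by rw [← h, D.next.injective.eq_iff]
      simp only [jump, pairInd, h1]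
      ring
    · simp [pairInd, hne]
  have h1 := four_mul_matrix D hD (some ⟨n, hn⟩) g
  have h2 := four_mul_matrix D hD none g
  have h3 : D.crv (some ⟨n, hn⟩) = fun z => D.crv none z + -pairInd n.tail n.head z := by
    funext z
    exact (hc z).trans (sub_eq_add_neg _ _)
  have h4 : pairing D.arrows (fun z => -pairInd n.tail n.head z) (D.crv g) = 0 := by
    rw [pairing_eq_of_support (S := {n}) D.valid (Finset.singleton_subset_iff.2 hn), pairing,
      Finset.sum_singleton, crv_tail_eq_crv_head hD hn (Or.inr h) g]
    · simp only [pairInd, if_pos, if_neg hne, if_neg hne.symm]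
      ring
    · intro x hx
      have := hx n (Finset.mem_singleton_self _)
      simp only [Arrow.IsEnd, not_or] at this
      simp [pairInd, Ne.symm this.1, Ne.symm this.2]
  rw [h3, pairing_add_left, h4] at h1
  omega

/-- The rows of two crossings that bound a bigon add up to the row of the core element. -/
theorem bigon_rows {D : Diagram L} (hD : D.IsKnot) {a a' b b' : D.Pt} {l l' : L}
    (h₁ : ⟨a, b, l⟩ ∈ D.arrows) (h₂ : ⟨b', a', l'⟩ ∈ D.arrows)
    (hd : [a, a', b, b'].Nodup) (haa : D.next a = a' ∨ D.next a' = a)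
    (hbb : D.next b = b' ∨ D.next b' = b) (h : Option {a // a ∈ D.arrows}) :
    D.matrix (some ⟨⟨a, b, l⟩, h₁⟩) h + D.matrix (some ⟨⟨b', a', l'⟩, h₂⟩) h = D.matrix none h := by
  simp only [List.nodup_cons, List.mem_cons, List.not_mem_nil, or_false, not_or] at hd
  have hne : a ≠ a' ∧ a ≠ b ∧ a ≠ b' ∧ a' ≠ b ∧ a' ≠ b' ∧ b ≠ b' := by grind
  obtain ⟨n1, n2, n3, n4, n5, n6⟩ := hne
  obtain ⟨ε, hε⟩ := exists_adjSign hD.2 haa n1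
  obtain ⟨δ, hδ⟩ := exists_adjSign hD.2 hbb n6
  have hdisj : (⟨a, b, l⟩ : Arrow D.Pt L) ≠ ⟨b', a', l'⟩ := fun h => n3 (congrArg Arrow.tail h)
  -- Moving the ends of the first curve across the two sides of the bigon turns it into the
  -- complement of the second one. The sum is therefore the core function plus corrections on the
  -- sides.
  refine matrix_add_matrix hD (w := fun z => ε * pairInd a a' z - δ * pairInd b b' z)
    (fun z => ?_) ?_
  · change curve D.next a b z + curve D.next b' a' z = _
    rw [hε.2.1 b n2 n4, hδ.2.2.1 a' n4.symm n5.symm, curve_swap hD.2 n5]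
    ring
  · rw [pairing_eq_of_support (S := {⟨a, b, l⟩, ⟨b', a', l'⟩}) D.valid, pairing,
      Finset.sum_pair hdisj]
    · simp only [pairInd, if_pos, if_neg n1, if_neg n2, if_neg n3, if_neg n4, if_neg n5, if_neg n6,
        if_neg n1.symm, if_neg n2.symm, if_neg n3.symm, if_neg n4.symm, if_neg n5.symm,
        if_neg n6.symm]
      -- With `v` the curve of `h`, the pairing is `ε (v b - v b') + δ (v a - v a')`. Both
      -- differences vanish for a curve that ends elsewhere; for the two crossings of the bigon the
      -- products of `ε` and `δ` cancel.
      by_cases e1 : h = some ⟨⟨a, b, l⟩, h₁⟩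
      · subst e1
        have k1 : D.crv (some ⟨⟨a, b, l⟩, h₁⟩) a = 1 := curve_left hD.2 n2
        have k2 : D.crv (some ⟨⟨a, b, l⟩, h₁⟩) b = 1 := curve_right n2
        have k3 : D.crv (some ⟨⟨a, b, l⟩, h₁⟩) a' = 1 + ε := hε.left_apply hD.2 n2 n4
        have k4 : D.crv (some ⟨⟨a, b, l⟩, h₁⟩) b' = 1 - δ := hδ.right_apply n2.symm n3.symm
        rw [k1, k2, k3, k4]
        ring
      · by_cases e2 : h = some ⟨⟨b', a', l'⟩, h₂⟩
        · subst e2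
          have k1 : D.crv (some ⟨⟨b', a', l'⟩, h₂⟩) a' = 1 := curve_right n5.symm
          have k2 : D.crv (some ⟨⟨b', a', l'⟩, h₂⟩) b' = 1 := curve_left hD.2 n5.symm
          have k3 : D.crv (some ⟨⟨b', a', l'⟩, h₂⟩) a = 1 - -ε :=
            hε.symm.right_apply n5 n3
          have k4 : D.crv (some ⟨⟨b', a', l'⟩, h₂⟩) b = 1 + -δ :=
            hδ.symm.left_apply hD.2 n5.symm n4.symm
          rw [k1, k2, k3, k4]
          ring
        · have hfree : ∀ c, h = some c → ¬ c.1.IsEnd a ∧ ¬ c.1.IsEnd a' ∧ ¬ c.1.IsEnd b ∧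
              ¬ c.1.IsEnd b' := by
            rintro c rfl
            have c1 : c.1 ≠ ⟨a, b, l⟩ := fun h' => e1 (congrArg some (Subtype.ext h'))
            have c2 : c.1 ≠ ⟨b', a', l'⟩ := fun h' => e2 (congrArg some (Subtype.ext h'))
            exact ⟨fun h' => c1 (D.disjoint _ c.2 _ h₁ _ h' (Or.inl rfl)),
              fun h' => c2 (D.disjoint _ c.2 _ h₂ _ h' (Or.inr rfl)),
              fun h' => c1 (D.disjoint _ c.2 _ h₁ _ h' (Or.inr rfl)),
              fun h' => c2 (D.disjoint _ c.2 _ h₂ _ h' (Or.inl rfl))⟩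
          rw [crv_congr hε fun c hc => ⟨(hfree c hc).1, (hfree c hc).2.1⟩,
            crv_congr hδ fun c hc => ⟨(hfree c hc).2.2.1, (hfree c hc).2.2.2⟩]
          ring
    · intro c hc
      simp only [Finset.mem_insert, Finset.mem_singleton] at hc
      rcases hc with rfl | rfl
      · exact h₁
      · exact h₂
    · intro x hx
      have x1 := hx _ (Finset.mem_insert_self _ _)
      have x2 := hx _ (Finset.mem_insert_of_mem (Finset.mem_singleton_self _))
      simp only [Arrow.IsEnd, not_or] at x1 x2
      simp [pairInd, Ne.symm x1.1, Ne.symm x1.2, Ne.symm x2.1, Ne.symm x2.2]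

end Matrices

/-! ### The third move preserves the bilinear form. -/

section Triangles

variable {P L : Type} [DecidableEq P]

/-- The sign `1` or `-1`. -/
def sgn (r : Bool) : ℤ := if r then 1 else -1

theorem sgn_mul_self (r : Bool) : sgn r * sgn r = 1 := by cases r <;> rfl

theorem pairing_add_right {A : Finset (Arrow P L)} (u v v' : P → ℤ) :
    pairing A u (fun x => v x + v' x) = pairing A u v + pairing A u v' := by
  rw [pairing, pairing, pairing, ← Finset.sum_add_distrib]
  exact Finset.sum_congr rfl fun _ _ => by ring

theorem pairing_term_dir (r : Bool) (x y : P) (l : L) (u v : P → ℤ) :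
    u (Arrow.dir r x y l).tail * v (Arrow.dir r x y l).head -
      v (Arrow.dir r x y l).tail * u (Arrow.dir r x y l).head =
        sgn r * (u x * v y - v x * u y) := by
  cases r
  · simp only [Arrow.dir, sgn, Bool.false_eq_true, if_false]
    ring
  · simp only [Arrow.dir, sgn, if_true]
    ring

variable [DecidableEq L]

theorem pairing_image_map {A : Finset (Arrow P L)} (τ : Equiv.Perm P) (u v : P → ℤ) :
    pairing (A.image (Arrow.map τ)) u v = pairing A (fun x => u (τ x)) fun x => v (τ x) := by
  rw [pairing, Finset.sum_image fun _ _ _ _ h => Arrow.map_injective τ.injective h]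
  rfl

/-- Three pairs of adjacent points `N k`, `Q k` and three arrows that join `N k` and `Q (k + 1)`. -/
structure IsTriangle (D : Diagram L) (N Q : Fin 3 → D.Pt) (s : Fin 3 → Bool) (l : Fin 3 → L) :
    Prop where
  mem : ∀ k, Arrow.dir (s k) (N k) (Q (k + 1)) (l k) ∈ D.arrows
  adj : ∀ k, AdjSign D.next (N k) (Q k) (-(sgn (s k) * sgn (s (k + 2))))
  injN : Function.Injective N
  injQ : Function.Injective Q
  ne : ∀ j k, N j ≠ Q k

variable {D : Diagram L} {N Q : Fin 3 → D.Pt} {s : Fin 3 → Bool} {l : Fin 3 → L}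

/-- The difference of two curves before and after the move. -/
def triangleCorrection (s : Fin 3 → Bool) (N Q : Fin 3 → P) (i : Fin 3) (z : P) : ℤ :=
  2 * ((if z = Q i then sgn (s (i + 2)) else 0) + (if z = N (i + 1) then sgn (s (i + 1)) else 0))

theorem add_one_add_two (i : Fin 3) : i + 1 + 2 = i := by rw [add_assoc]; exact add_zero i

theorem add_two_add_one (i : Fin 3) : i + 2 + 1 = i := by rw [add_assoc]; exact add_zero i

theorem add_one_add_one (i : Fin 3) : i + 1 + 1 = i + 2 := add_assoc i 1 1

theorem IsTriangle.ne_dir (h : IsTriangle D N Q s l) {i j : Fin 3} (hij : i ≠ j) :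
    Arrow.dir (s i) (N i) (Q (i + 1)) (l i) ≠ Arrow.dir (s j) (N j) (Q (j + 1)) (l j) := by
  intro h'
  have h1 : (Arrow.dir (s i) (N i) (Q (i + 1)) (l i)).IsEnd (N i) := Arrow.isEnd_dir.2 (Or.inl rfl)
  rw [h', Arrow.isEnd_dir] at h1
  rcases h1 with h1 | h1
  · exact hij (h.injN h1).symm
  · exact h.ne _ _ h1.symm

/-- The correction lives at the two points where strands `i` and `i + 1` meet strand `i + 2`. Since
the squares of the signs are 1, what remains is the increment of `v` along strand `i + 2`. -/
theorem IsTriangle.pairing_correction (h : IsTriangle D N Q s l) (i : Fin 3) (v : D.Pt → ℤ) :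
    pairing D.arrows (triangleCorrection s N Q i) v = 2 * (v (Q (i + 2)) - v (N (i + 2))) := by
  have hi : i + 1 ≠ i + 2 ∧ i + 2 ≠ i ∧ i + 1 ≠ i :=
    (by decide : ∀ i : Fin 3, i + 1 ≠ i + 2 ∧ i + 2 ≠ i ∧ i + 1 ≠ i) i
  have hm := h.mem (i + 2)
  have hne := h.ne_dir hi.1
  rw [add_two_add_one] at hm hne
  rw [pairing_eq_of_support (S := {Arrow.dir (s (i + 1)) (N (i + 1)) (Q (i + 1 + 1)) (l (i + 1)),
    Arrow.dir (s (i + 2)) (N (i + 2)) (Q i) (l (i + 2))}) D.valid, pairing, Finset.sum_pair hne,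
    pairing_term_dir, pairing_term_dir, add_one_add_one]
  · simp only [triangleCorrection, if_neg (h.ne _ _), if_neg (h.ne _ _).symm, if_pos,
      if_neg (h.injN.ne hi.1.symm), if_neg (h.injQ.ne hi.2.1)]
    linear_combination 2 * v (Q (i + 2)) * sgn_mul_self (s (i + 1)) -
      2 * v (N (i + 2)) * sgn_mul_self (s (i + 2))
  · intro c hc
    simp only [Finset.mem_insert, Finset.mem_singleton] at hc
    rcases hc with rfl | rfl
    · exact h.mem _
    · exact hm
  · intro x hx
    have x1 := hx _ (Finset.mem_insert_self _ _)
    have x2 := hx _ (Finset.mem_insert_of_mem (Finset.mem_singleton_self _))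
    rw [Arrow.isEnd_dir, not_or] at x1 x2
    simp [triangleCorrection, Ne.symm x1.1, Ne.symm x2.2]

/-- The increments of the curves of a triangle along the strands. -/
theorem IsTriangle.increment (h : IsTriangle D N Q s l) (hD : D.IsKnot) (i k : Fin 3) :
    D.crv (some ⟨_, h.mem i⟩) (Q k) - D.crv (some ⟨_, h.mem i⟩) (N k) =
      if k = i then -sgn (s (i + 2)) else if k = i + 1 then sgn (s (i + 1)) else 0 := by
  have hi : i ≠ i + 1 := (by decide : ∀ i : Fin 3, i ≠ i + 1) i
  have hk : ∀ k, k ≠ i → k ≠ i + 1 → k = i + 2 :=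
    (by decide : ∀ i k : Fin 3, k ≠ i → k ≠ i + 1 → k = i + 2) i
  have a0 := h.adj i
  have a1 := h.adj (i + 1)
  have a2 := h.adj (i + 2)
  rw [add_one_add_two] at a1
  have n1 := h.ne i (i + 1)
  have n2 := h.ne (i + 1) i
  have n3 := h.injN.ne hi
  have n4 := h.injQ.ne hi
  have hc : D.crv (some ⟨_, h.mem i⟩) = curve D.next (Arrow.dir (s i) (N i) (Q (i + 1)) (l i)).tail
    (Arrow.dir (s i) (N i) (Q (i + 1)) (l i)).head := rfl
  rw [hc]
  split_ifs with h1 h2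
  · subst h1
    cases hs : s k <;> simp only [Arrow.dir, if_true, if_false, Bool.false_eq_true]
    · rw [a0.right_apply n1 n4, curve_right n1.symm]
      cases s (k + 2) <;> simp [sgn, hs]
    · rw [a0.left_apply hD.2 n1 n4, curve_left hD.2 n1]
      cases s (k + 2) <;> simp [sgn, hs]
  · subst h2
    cases hs : s i <;> simp only [Arrow.dir, if_true, if_false, Bool.false_eq_true]
    · rw [a1.symm.left_apply hD.2 n1.symm n3.symm, curve_left hD.2 n1.symm]
      cases s (i + 1) <;> simp [sgn, hs]
    · rw [a1.symm.right_apply n1.symm n3.symm, curve_right n1]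
      cases s (i + 1) <;> simp [sgn, hs]
  · obtain rfl := hk k h1 h2
    rw [sub_eq_zero]
    have hi2 : i + 2 ≠ i ∧ i + 2 ≠ i + 1 := ⟨h1, h2⟩
    refine (crv_congr (g := some ⟨_, h.mem i⟩) a2 ?_).symm
    intro a ha
    obtain rfl := Option.some.inj ha
    rw [Arrow.isEnd_dir, Arrow.isEnd_dir]
    constructor
    · rintro (h' | h')
      · exact h1 (h.injN h').symm
      · exact h.ne _ _ h'.symm
    · rintro (h' | h')
      · exact h.ne _ _ h'
      · exact h2 (h.injQ h').symm

/-- The curve of an arrow of the triangle after the move. -/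
theorem IsTriangle.curve_after (h : IsTriangle D N Q s l) (hD : D.IsKnot) (i : Fin 3) {L' : Type}
    (l' : L') {τ : Equiv.Perm D.Pt} (hN : ∀ k, τ (N k) = Q k) (hQ : ∀ k, τ (Q k) = N k)
    (hτ : ∀ z, (∀ k, z ≠ N k ∧ z ≠ Q k) → τ z = z) (z : D.Pt) :
    curve D.next (Arrow.dir (s i) (Q i) (N (i + 1)) l').tail
        (Arrow.dir (s i) (Q i) (N (i + 1)) l').head (τ z) =
      D.crv (some ⟨_, h.mem i⟩) z + triangleCorrection s N Q i z := by
  have hi : i ≠ i + 1 := (by decide : ∀ i : Fin 3, i ≠ i + 1) i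
  have a0 := h.adj i
  have a1 := h.adj (i + 1)
  rw [add_one_add_two] at a1
  have n1 := h.ne i (i + 1)
  have n2 := h.ne (i + 1) i
  have n3 := h.injN.ne hi
  have n4 := h.injQ.ne hi
  have hc : ∀ z, D.crv (some ⟨_, h.mem i⟩) z =
    curve D.next (Arrow.dir (s i) (N i) (Q (i + 1)) (l i)).tail
      (Arrow.dir (s i) (N i) (Q (i + 1)) (l i)).head z := fun _ => rfl
  -- Both ends of the curve move to adjacent points, each adding a signed indicator of its strand.
  -- Evaluating at `τ z` then brings in the increments along the strands, which turn these
  -- indicators into the correction.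
  have key : ∀ z, curve D.next (Arrow.dir (s i) (Q i) (N (i + 1)) l').tail
        (Arrow.dir (s i) (Q i) (N (i + 1)) l').head z = D.crv (some ⟨_, h.mem i⟩) z +
      sgn (s (i + 2)) * pairInd (N i) (Q i) z +
        sgn (s (i + 1)) * pairInd (N (i + 1)) (Q (i + 1)) z := by
    intro z
    rw [hc]
    cases hs : s i <;> simp only [Arrow.dir, if_true, if_false, Bool.false_eq_true]
    · rw [a1.2.1 _ n2 n4.symm, a0.2.2.1 _ n1 n4, hs]
      simp only [sgn, Bool.false_eq_true, if_false]
      ring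
    · rw [a0.2.1 _ n1 n4, a1.2.2.1 _ n2 n4.symm, hs]
      simp only [sgn, if_true]
      ring
  rw [key]
  have inc := h.increment hD i
  by_cases hz : ∀ k, z ≠ N k ∧ z ≠ Q k
  · rw [hτ z hz]
    simp [pairInd, triangleCorrection, hz]
  · obtain ⟨k, hk⟩ : ∃ k, z = N k ∨ z = Q k := by
      by_contra hcon
      push Not at hcon
      exact hz hcon
    have inc := inc k
    rcases hk with rfl | rfl
    · rw [hN]
      simp only [pairInd, triangleCorrection, h.injN.eq_iff, h.injQ.eq_iff, if_neg (h.ne _ _),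
        if_neg (h.ne _ _).symm]
      by_cases k1 : k = i
      · subst k1
        simp only [if_true, if_neg hi] at inc ⊢
        linarith
      · by_cases k2 : k = i + 1
        · subst k2
          simp only [if_true, if_neg hi.symm] at inc ⊢
          linarith
        · simp only [if_neg k1, if_neg k2] at inc ⊢
          linarith
    · rw [hQ]
      simp only [pairInd, triangleCorrection, h.injN.eq_iff, h.injQ.eq_iff, if_neg (h.ne _ _),
        if_neg (h.ne _ _).symm]
      by_cases k1 : k = i
      · subst k1
        simp only [if_true, if_neg hi] at inc ⊢
        linarith
      · by_cases k2 : k = i + 1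
        · subst k2
          simp only [if_true, if_neg hi.symm] at inc ⊢
          linarith
        · simp only [if_neg k1, if_neg k2] at inc ⊢
          linarith

/-- Curves of arrows outside the triangle are constant along its strands, so they are unaffected and
pair to zero with the corrections. For two arrows of the triangle the terms with corrections cancel.
-/
theorem IsTriangle.pairing_eq (h : IsTriangle D N Q s l) (hD : D.IsKnot) {τ : Equiv.Perm D.Pt}
    (hN : ∀ k, τ (N k) = Q k) (hQ : ∀ k, τ (Q k) = N k)
    (hτ : ∀ z, (∀ k, z ≠ N k ∧ z ≠ Q k) → τ z = z)
    {c : Option {a // a ∈ D.arrows} → D.Pt → ℤ} (hc : ∀ g z, c g z = match g with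
      | none => 2
      | some a => curve D.next (τ a.1.tail) (τ a.1.head) (τ z))
    (g g' : Option {a // a ∈ D.arrows}) :
    pairing D.arrows (c g) (c g') = pairing D.arrows (D.crv g) (D.crv g') := by
  have htri : ∀ i, c (some ⟨_, h.mem i⟩) =
      fun z => D.crv (some ⟨_, h.mem i⟩) z + triangleCorrection s N Q i z := by
    intro i
    funext z
    rw [← h.curve_after hD i (l i) hN hQ hτ z, hc]
    change curve D.next ((Arrow.dir (s i) (N i) (Q (i + 1)) (l i)).map τ).tail
      ((Arrow.dir (s i) (N i) (Q (i + 1)) (l i)).map τ).head (τ z) = _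
    rw [Arrow.map_dir, hN, hQ]
  have hother : ∀ g, (∀ i, g ≠ some ⟨_, h.mem i⟩) →
      c g = D.crv g ∧ ∀ k, D.crv g (Q k) = D.crv g (N k) := by
    intro g hg
    have hk : ∀ a, g = some a → ∀ k, ¬ a.1.IsEnd (N k) ∧ ¬ a.1.IsEnd (Q k) := by
      rintro a rfl k
      refine ⟨fun h' => hg k (congrArg some (Subtype.ext ?_)),
        fun h' => hg (k + 2) (congrArg some (Subtype.ext ?_))⟩
      · exact D.disjoint _ a.2 _ (h.mem k) _ h' (Arrow.isEnd_dir.2 (Or.inl rfl))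
      · exact D.disjoint _ a.2 _ (h.mem (k + 2)) _ h'
          (Arrow.isEnd_dir.2 (Or.inr (by rw [add_two_add_one])))
    have hcrv : ∀ k, D.crv g (Q k) = D.crv g (N k) := fun k =>
      (crv_congr (h.adj k) fun a ha => hk a ha k).symm
    refine ⟨?_, hcrv⟩
    funext z
    have hz : D.crv g (τ z) = D.crv g z := by
      by_cases hz : ∀ k, z ≠ N k ∧ z ≠ Q k
      · rw [hτ z hz]
      · obtain ⟨k, rfl | rfl⟩ : ∃ k, z = N k ∨ z = Q k := by
          by_contra hcon
          push Not at hcon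
          exact hz hcon
        · rw [hN, hcrv]
        · rw [hQ, hcrv]
    rw [hc, ← hz]
    rcases g with _ | a
    · rfl
    · have hfix : ∀ x, a.1.IsEnd x → τ x = x := fun x hx => hτ x fun k =>
        ⟨fun h' => (hk a rfl k).1 (h' ▸ hx), fun h' => (hk a rfl k).2 (h' ▸ hx)⟩
      change curve D.next (τ a.1.tail) (τ a.1.head) (τ z) = curve D.next a.1.tail a.1.head (τ z)
      rw [hfix _ (Or.inl rfl), hfix _ (Or.inr rfl)]
  by_cases hg : ∃ i, g = some ⟨_, h.mem i⟩ <;> by_cases hg' : ∃ j, g' = some ⟨_, h.mem j⟩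
  · obtain ⟨i, rfl⟩ := hg
    obtain ⟨j, rfl⟩ := hg'
    rw [htri, htri, pairing_add_left, pairing_add_right, pairing_add_right,
      pairing_skew (D.crv _) (triangleCorrection s N Q j), h.pairing_correction,
      h.pairing_correction, h.pairing_correction]
    have i1 := h.increment hD j (i + 2)
    have i2 := h.increment hD i (j + 2)
    simp only [triangleCorrection, h.injN.eq_iff, h.injQ.eq_iff, if_neg (h.ne _ _),
      if_neg (h.ne _ _).symm]
    -- For the same arrow all corrections vanish. For consecutive arrows the two mixed terms are
    -- equal, and the pairing of the two corrections is the opposite of their sum.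
    obtain rfl | rfl | rfl := (by decide : ∀ i j : Fin 3, j = i ∨ j = i + 1 ∨ i = j + 1) i j
    · have e := (by decide : ∀ i : Fin 3, i + 2 ≠ i + 1 ∧ i + 2 ≠ i) j
      simp only [if_neg e.1, if_neg e.2] at i1 ⊢
      linarith
    · have e := (by decide : ∀ i : Fin 3, i + 2 ≠ i + 1 ∧ i + 2 = i + 1 + 1 ∧ i + 1 + 2 = i ∧
        i ≠ i + 1) i
      simp only [e.2.2.1, if_neg e.1, ← e.2.1, if_true, if_neg e.2.2.2] at i1 i2 ⊢
      linarith
    · have e := (by decide : ∀ i : Fin 3, i + 2 ≠ i + 1 ∧ i + 2 = i + 1 + 1 ∧ i + 1 + 2 = i ∧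
        i ≠ i + 1) j
      simp only [e.2.2.1, if_neg e.1, ← e.2.1, if_true, if_neg e.2.2.2] at i1 i2 ⊢
      linarith
  · obtain ⟨i, rfl⟩ := hg
    push Not at hg'
    obtain ⟨h1, h2⟩ := hother g' hg'
    rw [htri, h1, pairing_add_left, h.pairing_correction, h2]
    ring
  · obtain ⟨j, rfl⟩ := hg'
    push Not at hg
    obtain ⟨h1, h2⟩ := hother g hg
    rw [htri, h1, pairing_add_right, pairing_skew _ (triangleCorrection s N Q j),
      h.pairing_correction, h2]
    ring
  · push Not at hg hg'
    rw [(hother g hg).1, (hother g' hg').1]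

end Triangles

/-! ### Homology invariance of the singular based matrix. -/

section Invariance

theorem curve_equiv {P Q : Type} [DecidableEq P] [DecidableEq Q] [Finite P] [Finite Q]
    {σ : Equiv.Perm P} {τ : Equiv.Perm Q} (hσ : ∀ x y, σ.SameCycle x y)
    (hτ : ∀ x y, τ.SameCycle x y) {e : P → Q} (he : Function.Injective e)
    (h : ∀ z, τ (e z) = e (σ z)) {x y : P} (hxy : x ≠ y) (z : P) :
    curve τ (e x) (e y) (e z) = curve σ x y z := by
  refine (congrFun (curve_eq hσ hxy (u := fun z => curve τ (e x) (e y) (e z)) (fun z => ?_) ?_)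
    z).symm
  · simp only [← h, curve_apply hτ (he.ne hxy), jump]
    simp only [h, he.eq_iff]
  · exact curve_left hτ (he.ne hxy)

/-- The jump over the new point is split into two jumps with the same sum, because no curve
considered ends there. -/
theorem curve_insertAfter {P : Type} [DecidableEq P] [Finite P] {σ : Equiv.Perm P}
    (hσ : ∀ x y, σ.SameCycle x y) (p : P) {x y : P} (hxy : x ≠ y) (z : P) :
    curve (insertAfter σ p) (some x) (some y) (some z) = curve σ x y z := by
  have hτ := KnotDiagram.sameCycle_insertAfter σ hσ p
  have he : some x ≠ some y := fun h => hxy (Option.some.inj h)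
  refine (congrFun (curve_eq hσ hxy (u := fun z => curve (insertAfter σ p) (some x) (some y)
    (some z)) (fun z => ?_) ?_) z).symm
  · by_cases hz : z = p
    · subst hz
      have h1 := curve_apply hτ he (some z)
      have h2 := curve_apply hτ he none
      rw [insertAfter_self] at h1
      rw [insertAfter_none] at h2
      simp only [h2, h1, jump, insertAfter_self, insertAfter_none, Option.some.injEq,
        reduceCtorEq, if_false]
      ring
    · have h1 := curve_apply hτ he (some z)
      rw [insertAfter_of_ne σ hz] at h1
      simp only [h1, jump, insertAfter_of_ne σ hz, Option.some.injEq]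
  · exact curve_left hτ he

theorem arrows_of_homeo {L : Type} [DecidableEq L] {D D' : Diagram L} (e : D.Pt ≃ D'.Pt)
    (hA : ∀ a : Arrow D.Pt L, a.map e ∈ D'.arrows ↔
      (a ∈ D.arrows ∧ a ∉ (∅ : Set (Arrow D.Pt L))) ∨ a ∈ (∅ : Set (Arrow D.Pt L))) :
    D'.arrows = D.arrows.image (Arrow.map e) := by
  ext b
  have hb : (b.map e.symm).map e = b := by
    rw [Arrow.map_map, Equiv.self_comp_symm]
    rfl
  rw [Finset.mem_image]
  constructor
  · intro h
    refine ⟨b.map e.symm, ?_, hb⟩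
    have := (hA (b.map e.symm)).1 (hb.symm ▸ h)
    simpa using this
  · rintro ⟨a, ha, rfl⟩
    exact (hA a).2 (Or.inl ⟨ha, fun h => h⟩)

variable {D D' : Diagram Bool}

theorem homologous_homeo (h : D.Replace D' ∅ ∅) (hD : D.IsKnot) (hD' : D'.IsKnot)
    {p : {a // a ∈ D.arrows}} {p' : {a // a ∈ D'.arrows}} (hp : p.1.label = true)
    (hp' : ∀ a ∈ D'.arrows, a.label = true → a = p') :
    (D.matrixAt hD p).Homologous (D'.matrixAt hD' p') := by
  obtain ⟨-, e, hn, hA⟩ := h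
  have hA := arrows_of_homeo e hA
  refine Relation.EqvGen.rel _ _ (step_of_map hD hD' e e.injective (Arrow.map e) (fun _ => rfl)
    (fun _ => rfl) hA (fun x y z hxy => curve_equiv hD.2 hD'.2 e.injective hn hxy z) p p' ?_)
  exact hp' _ (hA ▸ Finset.mem_image_of_mem _ p.2) hp

theorem homologous_subdivide (q : D.Pt) (hD : D.IsKnot) (hD' : (D.subdivide q).IsKnot)
    {p : {a // a ∈ D.arrows}} {p' : {a // a ∈ (D.subdivide q).arrows}} (hp : p.1.label = true)
    (hp' : ∀ a ∈ (D.subdivide q).arrows, a.label = true → a = p') :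
    (D.matrixAt hD p).Homologous ((D.subdivide q).matrixAt hD' p') := by
  refine Relation.EqvGen.rel _ _ (step_of_map hD hD' some (Option.some_injective _)
    (Arrow.map some) (fun _ => rfl) (fun _ => rfl) rfl
    (fun x y z hxy => curve_insertAfter hD.2 q hxy z) p p' ?_)
  exact hp' _ (Finset.mem_image_of_mem _ p.2) hp

/-- The elements of a set of arrows as elements of a larger set. -/
def inclusion {P L : Type} {B A : Finset (Arrow P L)} (hs : B ⊆ A) (a : {a // a ∈ B}) :
    {a // a ∈ A} := ⟨a.1, hs a.2⟩

theorem inclusion_injective {P L : Type} {B A : Finset (Arrow P L)} (hs : B ⊆ A) :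
    Function.Injective (inclusion hs) :=
  fun _ _ h => Subtype.ext (congrArg (fun c : {a // a ∈ A} => c.1) h)

theorem compl_range_inclusion {P L : Type} {B A : Finset (Arrow P L)} (hs : B ⊆ A)
    (g : Option {a // a ∈ A}) :
    g ∈ (Set.range (Option.map (inclusion hs)))ᶜ ↔ ∃ a, g = some a ∧ a.1 ∉ B := by
  rw [Set.mem_compl_iff, Set.mem_range]
  rcases g with _ | a
  · simp
  · constructor
    · intro h
      exact ⟨a, rfl, fun ha => h ⟨some ⟨a.1, ha⟩, rfl⟩⟩
    · rintro ⟨b, hb, hbA⟩ ⟨_ | c, hc⟩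
      · simp at hc
      · obtain rfl := Option.some.inj hb
        obtain rfl := Option.some.inj hc
        exact hbA c.2

theorem crv_inclusion {A : Finset (Arrow D.Pt Bool)} {hA : Valid A} (hs : D.arrows ⊆ A)
    (g : Option {a // a ∈ D.arrows}) :
    (ofPerm D.next A hA).crv (Option.map (inclusion hs) g) = D.crv g := by
  rcases g with _ | a <;> rfl

/-- The new arrow does not change the pairing of old curves, which agree at its two adjacent ends.
Its row is zero or the core row according to which of its ends comes first. -/
theorem homologous_insert {n : Arrow D.Pt Bool} (hA : Valid (insert n D.arrows))
    (hn : n ∉ D.arrows) (h : D.next n.tail = n.head ∨ D.next n.head = n.tail) (hD : D.IsKnot)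
    {p : {a // a ∈ D.arrows}} :
    (D.matrixAt hD p).Homologous ((ofPerm D.next (insert n D.arrows) hA).matrixAt hD
      (inclusion (B := D.arrows) (Finset.subset_insert _ _) p)) := by
  have hnA : n ∈ insert n D.arrows := Finset.mem_insert_self _ _
  have hs : D.arrows ⊆ insert n D.arrows := Finset.subset_insert _ _
  have hext : (D.matrixAt hD p).Extends ((ofPerm D.next (insert n D.arrows) hA).matrixAt hD
      (inclusion hs p)) (Option.map (inclusion hs)) {some ⟨n, hnA⟩} := by
    refine matrixAt_extends (D' := ofPerm D.next (insert n D.arrows) hA) hD hD (inclusion hs)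
      (inclusion_injective hs) p (fun g g' => ?_) ?_
    · refine (pairing_insert hn _ _).trans ?_
      have h1 := crv_tail_eq_crv_head (D := ofPerm D.next (insert n D.arrows) hA) hD hnA h
      rw [h1, h1, crv_inclusion, crv_inclusion]
      ring
    · ext g
      refine (compl_range_inclusion hs g).trans ⟨?_, ?_⟩
      · rintro ⟨a, rfl, ha⟩
        exact congrArg some (Subtype.ext ((Finset.mem_insert.1 a.2).resolve_right ha))
      · rintro rfl
        exact ⟨_, rfl, hn⟩
  have hne : (some ⟨n, hnA⟩ : Option {a // a ∈ insert n D.arrows}) ≠ some (inclusion hs p) :=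
    fun h => hn <| by
      have h1 : n = p.1 :=
        congrArg (fun c : {a // a ∈ insert n D.arrows} => c.1) (Option.some.inj h)
      exact h1 ▸ p.2
  rcases h with h | h
  · exact Relation.EqvGen.rel _ _ (SingularBasedMatrix.Step.ext1 _ _ hext
      ⟨Option.some_ne_none _, hne, kink_row (D := ofPerm D.next (insert n D.arrows) hA) hD hnA h⟩)
  · exact Relation.EqvGen.rel _ _ (SingularBasedMatrix.Step.ext2 _ _ hext
      ⟨Option.some_ne_none _, hne, kink_row' (D := ofPerm D.next (insert n D.arrows) hA) hD hnA h⟩)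

/-- Old curves are constant along both sides of the bigon and the two arrows are opposite, so their
contributions cancel. `bigon_rows` gives the relation between the new rows. -/
theorem homologous_insert_pair {a a' b b' : D.Pt}
    (hA : Valid (insert (⟨a, b, false⟩ : Arrow D.Pt Bool) (insert ⟨b', a', false⟩ D.arrows)))
    (hd : [a, a', b, b'].Nodup) (hf : ∀ x ∈ [a, a', b, b'], D.Free x)
    (haa : D.Adj a a') (hbb : D.Adj b b') (hD : D.IsKnot)
    {p : {a // a ∈ D.arrows}} :
    (D.matrixAt hD p).Homologous ((ofPerm D.next
      (insert (⟨a, b, false⟩ : Arrow D.Pt Bool) (insert ⟨b', a', false⟩ D.arrows)) hA).matrixAt hD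
        (inclusion (B := D.arrows) ((Finset.subset_insert _ _).trans
          (Finset.subset_insert _ _)) p)) := by
  set n : Arrow D.Pt Bool := ⟨a, b, false⟩ with hn
  set n' : Arrow D.Pt Bool := ⟨b', a', false⟩ with hn'
  have hnA : n ∈ insert n (insert n' D.arrows) := Finset.mem_insert_self _ _
  have hnA' : n' ∈ insert n (insert n' D.arrows) :=
    Finset.mem_insert_of_mem (Finset.mem_insert_self _ _)
  have hs : D.arrows ⊆ insert n (insert n' D.arrows) :=
    (Finset.subset_insert _ _).trans (Finset.subset_insert _ _)
  have hnD : n ∉ D.arrows := fun h => hf a (by simp) _ h (Or.inl rfl)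
  have hnD' : n' ∉ D.arrows := fun h => hf b' (by simp) _ h (Or.inl rfl)
  have hnn : n ≠ n' := fun h => by
    have : a = b' := congrArg Arrow.tail h
    simp [this] at hd
  obtain ⟨ε, hε⟩ := exists_adjSign hD.2 haa.2 haa.1
  obtain ⟨δ, hδ⟩ := exists_adjSign hD.2 hbb.2 hbb.1
  have hca : ∀ g, D.crv g a = D.crv g a' := fun g => crv_congr hε fun c _ =>
    ⟨hf a (by simp) _ c.2, hf a' (by simp) _ c.2⟩
  have hcb : ∀ g, D.crv g b = D.crv g b' := fun g => crv_congr hδ fun c _ =>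
    ⟨hf b (by simp) _ c.2, hf b' (by simp) _ c.2⟩
  refine Relation.EqvGen.rel _ _ (SingularBasedMatrix.Step.ext3 (Option.map (inclusion hs))
    (some ⟨n, hnA⟩) (some ⟨n', hnA'⟩)
    (fun h => hnn (Subtype.ext_iff.1 (Option.some.inj h))) ?_
    (bigon_rows (D := ofPerm D.next (insert n (insert n' D.arrows)) hA) hD hnA hnA' hd haa.2 hbb.2))
  refine matrixAt_extends (D' := ofPerm D.next (insert n (insert n' D.arrows)) hA) hD hD
    (inclusion hs) (inclusion_injective hs) p (fun g g' => ?_) ?_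
  · refine (pairing_insert (by simp [hnn, hnD]) _ _).trans ?_
    rw [pairing_insert hnD', crv_inclusion, crv_inclusion]
    simp only [hn, hn', hca, hcb]
    ring
  · ext g
    refine (compl_range_inclusion hs g).trans ⟨?_, ?_⟩
    · rintro ⟨c, rfl, hc⟩
      rcases Finset.mem_insert.1 c.2 with h | h
      · exact Or.inl (congrArg some (Subtype.ext h))
      · exact Or.inr (congrArg some (Subtype.ext ((Finset.mem_insert.1 h).resolve_right hc)))
    · rintro (rfl | rfl)
      · exact ⟨_, rfl, hnD⟩
      · exact ⟨_, rfl, hnD'⟩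

/-- The flags decide which point of a strand comes first, and this is recorded by the sign of the
adjacency. -/
theorem isTriangle_of_subset {L : Type} [DecidableEq L] {D : Diagram L} (hD : D.IsKnot)
    {x : Fin 3 → D.Pt} (hx : D.Strands x) {s : Fin 3 → Bool} {l : Fin 3 → L}
    (h : triangle s l (D.toNext x s) (D.toPrev x s) ⊆ (D.arrows : Set (Arrow D.Pt L))) :
    IsTriangle D (D.toNext x s) (D.toPrev x s) s l := by
  have hne : ∀ k, x k ≠ D.next (x k) := fun k => (hx.2 k k).symm
  refine ⟨fun k => h ⟨k, rfl⟩, fun k => ?_, fun j k hjk => ?_, fun j k hjk => ?_,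
    fun j k hjk => ?_⟩
  · have h1 := adjSign_one hD.2 (rfl : D.next (x k) = D.next (x k)) (hne k)
    unfold Diagram.toNext Diagram.toPrev
    by_cases hs : s k = s (k + 2)
    · rw [if_pos hs, if_pos hs, hs, sgn_mul_self]
      exact h1.symm
    · rw [if_neg hs, if_neg hs]
      have : -(sgn (s k) * sgn (s (k + 2))) = 1 := by
        cases h2 : s k <;> cases h3 : s (k + 2) <;> simp_all [sgn]
      rw [this]
      exact h1
  · rcases toNext_or x s j with h1 | h1 <;> rcases toNext_or x s k with h2 | h2 <;>
      rw [h1.1, h2.1] at hjk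
    · exact hx.1 hjk
    · exact absurd hjk.symm (hx.2 _ _)
    · exact absurd hjk (hx.2 _ _)
    · exact hx.1 (D.next.injective hjk)
  · rcases toNext_or x s j with h1 | h1 <;> rcases toNext_or x s k with h2 | h2 <;>
      rw [h1.2, h2.2] at hjk
    · exact hx.1 (D.next.injective hjk)
    · exact absurd hjk (hx.2 _ _)
    · exact absurd hjk.symm (hx.2 _ _)
    · exact hx.1 hjk
  · rcases toNext_or x s j with h1 | h1 <;> rcases toNext_or x s k with h2 | h2 <;>
      rw [h1.1, h2.2] at hjk
    · exact absurd hjk.symm (hx.2 _ _)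
    · obtain rfl := hx.1 hjk
      exact hne j (h1.1.symm.trans h2.1)
    · obtain rfl := hx.1 (D.next.injective hjk)
      exact hne j (h2.1.symm.trans h1.1)
    · exact absurd hjk (hx.2 _ _)

/-- The moves correspond to the generators of homology: a first move adds a zero row or a core row,
a second move a complementary pair, a third move is an isomorphism, and the switch exchanges the
distinguished elements. -/
theorem homologous_of_singularMove (h : SingularMove D D') (hD : D.IsKnot) (hD' : D'.IsKnot)
    {p : {a // a ∈ D.arrows}} {p' : {a // a ∈ D'.arrows}} (hp : p.1.label = true)
    (hu : ∀ a ∈ D.arrows, a.label = true → a = p)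
    (hp' : ∀ a ∈ D'.arrows, a.label = true → a = p') :
    (D.matrixAt hD p).Homologous (D'.matrixAt hD' p') := by
  cases h with
  | homeo h => exact homologous_homeo h hD hD' hp hp'
  | subdivide q => exact homologous_subdivide q hD hD' hp hp'
  | flat1 a b ha hb hab h =>
    obtain ⟨A, hA, hmem, hr⟩ := h.exists_inPlace
    obtain rfl : A = insert ⟨a, b, false⟩ D.arrows := by
      ext c
      simp [hmem, or_comm]
    exact Relation.EqvGen.trans _ _ _
      (homologous_insert hA (fun h => ha _ h (Or.inl rfl)) hab.2 hD)
      (homologous_homeo hr hD hD' hp hp')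
  | flat2 a a' b b' hd hf haa hbb h =>
    obtain ⟨A, hA, hmem, hr⟩ := h.exists_inPlace
    obtain rfl : A = insert ⟨a, b, false⟩ (insert ⟨b', a', false⟩ D.arrows) := by
      ext c
      simp only [hmem, Finset.mem_insert, Set.mem_insert_iff, Set.mem_singleton_iff,
        Set.mem_empty_iff_false, not_false_eq_true, and_true]
      tauto
    exact Relation.EqvGen.trans _ _ _ (homologous_insert_pair hA hd hf haa hbb hD)
      (homologous_homeo hr hD hD' hp hp')
  | flat3 x hx s l hl h =>
    obtain ⟨hR, e, hn, hA⟩ := h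
    obtain ⟨τ, h1, h2, h3⟩ := exists_strandSwap D.next hx.2
    have harr := arrows_of_triangle h1 h2 h3 e hR hA
    have htri := isTriangle_of_subset hD hx hR
    have hV := D.valid.map τ.injective
    have hmem : ∀ a : {a // a ∈ D.arrows}, a.1.map τ ∈ D.arrows.image (Arrow.map τ) :=
      fun a => Finset.mem_image_of_mem _ a.2
    have hτN : ∀ k, τ (D.toNext x s k) = D.toPrev x s k := by
      intro k
      rcases toNext_or x s k with h | h <;> simp [h.1, h.2, h1, h2]
    have hτQ : ∀ k, τ (D.toPrev x s k) = D.toNext x s k := by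
      intro k
      rcases toNext_or x s k with h | h <;> simp [h.1, h.2, h1, h2]
    have hτ : ∀ z, (∀ k, z ≠ D.toNext x s k ∧ z ≠ D.toPrev x s k) → τ z = z := by
      refine fun z hz => h3 z fun k => ?_
      rcases toNext_or x s k with h | h
      · exact ⟨h.1 ▸ (hz k).1, h.2 ▸ (hz k).2⟩
      · exact ⟨h.2 ▸ (hz k).2, h.1 ▸ (hz k).1⟩
    let φ : {a // a ∈ D.arrows} → {a // a ∈ D.arrows.image (Arrow.map τ)} :=
      fun a => ⟨a.1.map τ, hmem a⟩
    have hstep := step_iso (D' := ofPerm D.next (D.arrows.image (Arrow.map τ)) hV) hD hD φ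
      ⟨fun a b hab => Subtype.ext (Arrow.map_injective τ.injective
        (congrArg (fun c : {a // a ∈ D.arrows.image (Arrow.map τ)} => c.1) hab)), fun b => by
          obtain ⟨a, ha, hab⟩ := Finset.mem_image.1 b.2
          exact ⟨⟨a, ha⟩, Subtype.ext hab⟩⟩ p fun g g' => by
      refine (pairing_image_map τ _ _).trans ?_
      refine htri.pairing_eq hD hτN hτQ hτ (c := fun g z =>
        (ofPerm D.next (D.arrows.image (Arrow.map τ)) hV).crv (Option.map φ g) (τ z))
        (fun g z => ?_) g g'
      rcases g with _ | a <;> rfl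
    refine Relation.EqvGen.trans _ _ _ (Relation.EqvGen.rel _ _ hstep)
      (homologous_homeo (D := ofPerm D.next (D.arrows.image (Arrow.map τ)) hV) (p := φ p)
        (replace_empty e hn ?_) hD hD' hp hp')
    refine harr.trans ?_
    exact (image_map_map (e : D.Pt → D'.Pt) τ).symm
  | switch a a' b b' hab hba h =>
    obtain ⟨A, hA, hmem, hr⟩ := h.exists_inPlace
    have m1 : (⟨a, b, true⟩ : Arrow D.Pt Bool) ∈ D.arrows := h.1 (Or.inl rfl)
    have m2 : (⟨a', b', false⟩ : Arrow D.Pt Bool) ∈ D.arrows := h.1 (Or.inr rfl)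
    have m3 : (⟨a', b', true⟩ : Arrow D.Pt Bool) ∈ A := (hmem _).2 (Or.inr (Or.inr rfl))
    have n1 : a ≠ b := D.tail_ne_head _ m1
    have n2 : a' ≠ b' := D.tail_ne_head _ m2
    have hne : (⟨a, b, true⟩ : Arrow D.Pt Bool) ≠ ⟨a', b', false⟩ := by simp
    have n3 : a ≠ a' := fun h' => hne (D.disjoint _ m1 _ m2 a (Or.inl rfl) (Or.inl h'.symm))
    have n4 : b ≠ b' := fun h' => hne (D.disjoint _ m1 _ m2 b (Or.inr rfl) (Or.inr h'.symm))
    obtain rfl : p = ⟨_, m1⟩ := Subtype.ext (hu _ m1 rfl).symm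
    have hsum := bigon_rows (a' := b') (b' := a') hD m1 m2
      (by simp [hab.1, n1, n3, n4.symm, n2.symm, hba.1.symm]) hab.2 (Or.symm hba.2)
    -- The double-point and the other crossing bound a bigon, so their rows are complementary, as
    -- the algebraic switch requires.
    have hsw : SingularBasedMatrix.Step (D.matrixAt hD ⟨_, m1⟩) (D.matrixAt hD ⟨_, m2⟩) :=
      SingularBasedMatrix.Step.switch (M := D.matrixAt hD ⟨_, m1⟩) (some ⟨_, m2⟩)
        (Option.some_ne_none _).symm fun g =>
        (add_comm _ _).trans (hsum g)
    -- The tails are distinct, so they suffice to tell which labels have to be exchanged; the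
    -- points, and with them the curves, stay.
    let ψ : Arrow D.Pt Bool → Arrow D.Pt Bool := fun c =>
      ⟨c.tail, c.head, if c.tail = a then false else if c.tail = a' then true else c.label⟩
    have hψ1 : ψ ⟨a, b, true⟩ = ⟨a, b, false⟩ := by simp [ψ]
    have hψ2 : ψ ⟨a', b', false⟩ = ⟨a', b', true⟩ := by simp [ψ, n3.symm]
    have hψ3 : ∀ c ∈ D.arrows, c ≠ ⟨a, b, true⟩ → c ≠ ⟨a', b', false⟩ → ψ c = c := by
      intro c hc c1 c2
      have t1 : c.tail ≠ a := fun h' => c1 (D.disjoint _ hc _ m1 a (Or.inl h') (Or.inl rfl))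
      have t2 : c.tail ≠ a' := fun h' => c2 (D.disjoint _ hc _ m2 a' (Or.inl h') (Or.inl rfl))
      simp [ψ, t1, t2]
    have hAψ : A = D.arrows.image ψ := by
      ext c
      rw [hmem, Finset.mem_image]
      constructor
      · rintro (⟨hc, hc'⟩ | rfl | rfl)
        · simp only [Set.mem_insert_iff, Set.mem_singleton_iff, not_or] at hc'
          exact ⟨c, hc, hψ3 c hc hc'.1 hc'.2⟩
        · exact ⟨_, m1, hψ1⟩
        · exact ⟨_, m2, hψ2⟩
      · rintro ⟨c, hc, rfl⟩
        by_cases c1 : c = ⟨a, b, true⟩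
        · rw [c1, hψ1]
          exact Or.inr (Or.inl rfl)
        by_cases c2 : c = ⟨a', b', false⟩
        · rw [c2, hψ2]
          exact Or.inr (Or.inr rfl)
        rw [hψ3 c hc c1 c2]
        exact Or.inl ⟨hc, by simp [c1, c2]⟩
    have hrel : SingularBasedMatrix.Step (D.matrixAt hD ⟨_, m2⟩)
        ((ofPerm D.next A hA).matrixAt hD ⟨_, m3⟩) :=
      step_of_map (D' := ofPerm D.next A hA) hD hD id Function.injective_id ψ (fun _ => rfl)
        (fun _ => rfl) hAψ (fun _ _ _ _ => rfl) _ _ hψ2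
    exact Relation.EqvGen.trans _ _ _ (Relation.EqvGen.trans _ _ _ (Relation.EqvGen.rel _ _ hsw)
      (Relation.EqvGen.rel _ _ hrel)) (homologous_homeo hr hD hD' rfl hp')

theorem homologous_of_mk_eq {α β : SingularString}
    (h : FlatSingularKnot.mk α = FlatSingularKnot.mk β) :
    SingularBasedMatrix.Homologous α.sbm β.sbm := by
  have key := Quot.eqvGen_exact h
  clear h
  induction key with
  | rel α β h =>
    exact homologous_of_singularMove h α.isKnot β.isKnot (p := ⟨α.point, α.mem⟩)
      (p' := ⟨β.point, β.mem⟩) ((α.label_iff _ α.mem).2 rfl)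
      (fun a ha => (α.label_iff a ha).1) fun a ha => (β.label_iff a ha).1
  | refl α => exact Relation.EqvGen.refl _
  | symm α β _ ih => exact Relation.EqvGen.symm _ _ ih
  | trans α β γ _ _ ih1 ih2 =>
    exact Relation.EqvGen.trans _ _ _ ih1 ih2

end Invariance

/-! ### An integer invariant of homology. -/

namespace SingularBasedMatrix

/-- The summand of `cubicSum` at `g`. -/
def cubicTerm (M : SingularBasedMatrix ℤ) (g : M.G) : ℤ :=
  M.b M.d M.s * M.b g M.s ^ 2 * (2 * M.b M.d g + M.b g M.s - M.b M.d M.s)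

/-- An integer that depends only on the homology class of a singular based matrix. -/
noncomputable def cubicSum (M : SingularBasedMatrix ℤ) : ℤ := ∑ᶠ g, M.cubicTerm g

theorem b_self (M : SingularBasedMatrix ℤ) (g : M.G) : M.b g g = 0 := by
  have := M.skew g g
  omega

theorem Extends.cubicSum_eq {M M' : SingularBasedMatrix ℤ} {f : M.G → M'.G} {A : Set M'.G}
    (h : M.Extends M' f A) (hA : ∑ᶠ g ∈ A, M'.cubicTerm g = 0) : M.cubicSum = M'.cubicSum := by
  obtain ⟨hf, hs, hd, hb, rfl⟩ := h
  have := M'.finite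
  have hterm : ∀ g, M'.cubicTerm (f g) = M.cubicTerm g := by
    intro g
    simp only [cubicTerm, ← hs, ← hd, hb]
  have h1 : M'.cubicSum = ∑ᶠ g ∈ Set.range f ∪ (Set.range f)ᶜ, M'.cubicTerm g := by
    rw [Set.union_compl_self, finsum_mem_univ]
    rfl
  rw [h1, finsum_mem_union disjoint_compl_right (Set.toFinite _) (Set.toFinite _), hA, add_zero,
    finsum_mem_range hf]
  exact finsum_congr fun g => (hterm g).symm

/-- The last factor of `cubicTerm` changes sign when `g` is replaced by its complement and when `d`
is replaced by its complement. The even power of `b g s` makes complementary pairs cancel and also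
kills zero and core elements, for which `b g s = 0`. The odd power of `b d s` compensates the sign
under the switch. -/
theorem Step.cubicSum_eq {M M' : SingularBasedMatrix ℤ} (h : Step M M') :
    M.cubicSum = M'.cubicSum := by
  cases h with
  | iso f h => exact h.cubicSum_eq finsum_mem_empty
  | ext1 f g h hg =>
    refine h.cubicSum_eq ?_
    rw [finsum_mem_singleton, cubicTerm, hg.2.2]
    ring
  | ext2 f g h hg =>
    refine h.cubicSum_eq ?_
    rw [finsum_mem_singleton, cubicTerm, hg.2.2, b_self]
    ring
  | ext3 f g₁ g₂ hne h hg =>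
    refine h.cubicSum_eq ?_
    rw [finsum_mem_pair hne, cubicTerm, cubicTerm]
    have h1 := hg M'.s
    have h2 := hg M'.d
    rw [b_self] at h1
    rw [M'.skew g₁, M'.skew g₂, M'.skew M'.s] at h2
    have h3 : M'.b g₂ M'.s = -M'.b g₁ M'.s := by omega
    have h4 : M'.b M'.d g₂ = M'.b M'.d M'.s - M'.b M'.d g₁ := by omega
    rw [h3, h4]
    ring
  | switch g hs hg =>
    refine finsum_congr fun x => ?_
    have h1 : M.b g M.s = -M.b M.d M.s := by
      have := hg M.s
      rw [b_self] at this
      omega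
    have h2 : M.b g x = -M.b x M.s - M.b M.d x := by
      have := hg x
      rw [M.skew M.s] at this
      omega
    simp only [cubicTerm, h1, h2]
    ring

theorem Homologous.cubicSum_eq {M M' : SingularBasedMatrix ℤ} (h : M.Homologous M') :
    M.cubicSum = M'.cubicSum := by
  induction h with
  | rel _ _ h => exact h.cubicSum_eq
  | refl _ => rfl
  | symm _ _ _ ih => exact ih.symm
  | trans _ _ _ _ _ ih ih' => exact ih.trans ih'

end SingularBasedMatrix

/-! ### Evaluation on the circle with eight points. -/

section Computation

/-- The function `curve` for the rotation of `Fin 8`. -/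
def rotateCurve (x y z : Fin 8) : ℤ :=
  (if 0 < z - x ∧ z - x < y - x then 2 else 0) + (if z = x then 1 else 0) +
    (if z = y then 1 else 0)

/-- Subtraction in `Fin 8` is modulo 8, so `z - x` counts the steps from `x` to `z`. Unlike `curve`,
this form can be evaluated by the kernel. -/
theorem curve_finRotate {x y : Fin 8} (hxy : x ≠ y) :
    curve (finRotate 8) x y = rotateCurve x y := by
  have key : ∀ x y : Fin 8, x ≠ y → (∀ z, rotateCurve x y (finRotate 8 z) =
      rotateCurve x y z + jump (finRotate 8) x y z) ∧ rotateCurve x y x = 1 := by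
    decide +kernel
  exact curve_eq isKnot_finRotate hxy (key x y hxy).1 (key x y hxy).2

/-- The invariant `cubicSum` in terms of the arrows, multiplied by `256`. -/
def rotateSum (A : Finset (Arrow (Fin 8) Bool)) (p : Arrow (Fin 8) Bool) : ℤ :=
  ∑ a ∈ A, pairing A (rotateCurve p.tail p.head) (fun _ => 2) *
    pairing A (rotateCurve a.tail a.head) (fun _ => 2) ^ 2 *
      (2 * pairing A (rotateCurve p.tail p.head) (rotateCurve a.tail a.head) +
        pairing A (rotateCurve a.tail a.head) (fun _ => 2) -
          pairing A (rotateCurve p.tail p.head) (fun _ => 2))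

/-- A term has degree four in the matrix entries, each of which is a quarter of a pairing, and `256
= 4 ^ 4`. The core element contributes nothing. -/
theorem cubicSum_eq_rotateSum {A : Finset (Arrow (Fin 8) Bool)} (hA : Valid A)
    (hD : (ofPerm (finRotate 8) A hA).IsKnot) (p : {a // a ∈ A}) :
    256 * ((ofPerm (finRotate 8) A hA).matrixAt hD p).cubicSum = rotateSum A p := by
  have hc : ∀ a : {a // a ∈ A}, (ofPerm (finRotate 8) A hA).crv (some a) =
      rotateCurve a.1.tail a.1.head := fun a => curve_finRotate (hA.ne _ a.2)
  have hm := four_mul_matrix (ofPerm (finRotate 8) A hA) hD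
  have h1 : ∀ g h : {a // a ∈ A}, 4 * (ofPerm (finRotate 8) A hA).matrix (some g) (some h) =
      pairing A (rotateCurve g.1.tail g.1.head) (rotateCurve h.1.tail h.1.head) := by
    intro g h
    rw [← hc, ← hc]
    exact hm _ _
  have h2 : ∀ g : {a // a ∈ A}, 4 * (ofPerm (finRotate 8) A hA).matrix (some g) none =
      pairing A (rotateCurve g.1.tail g.1.head) (fun _ => 2) := by
    intro g
    rw [← hc]
    exact hm _ _
  let T : Option {a // a ∈ A} → ℤ := ((ofPerm (finRotate 8) A hA).matrixAt hD p).cubicTerm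
  have h3 : ((ofPerm (finRotate 8) A hA).matrixAt hD p).cubicSum =
      T none + ∑ a : {a // a ∈ A}, T (some a) :=
    (finsum_eq_sum_of_fintype T).trans (Fintype.sum_option T)
  have h4 : T none = 0 := by
    change _ * (0 : ℤ) ^ 2 * _ = 0
    ring
  rw [h3, h4, zero_add, rotateSum, ← Finset.sum_coe_sort A, Finset.mul_sum]
  refine Finset.sum_congr rfl fun a _ => ?_
  rw [← h1, ← h2, ← h2]
  change 256 * ((ofPerm (finRotate 8) A hA).matrix (some p) none *
    (ofPerm (finRotate 8) A hA).matrix (some a) none ^ 2 *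
      (2 * (ofPerm (finRotate 8) A hA).matrix (some p) (some a) +
        (ofPerm (finRotate 8) A hA).matrix (some a) none -
          (ofPerm (finRotate 8) A hA).matrix (some p) none)) = _
  ring

/-- The values of `cubicSum` at the crossings 3 and 4 are 16 and -16. -/
theorem not_homologous_glue :
    ¬ SingularBasedMatrix.Homologous knotOneGlue3.sbm knotOneGlue4.sbm := by
  intro h
  have h3 : 256 * knotOneGlue3.sbm.cubicSum =
      rotateSum knotOneGlue3.diagram.arrows knotOneGlue3.point :=
    cubicSum_eq_rotateSum knotOneGlue3.diagram.valid knotOneGlue3.isKnot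
      ⟨knotOneGlue3.point, knotOneGlue3.mem⟩
  have h4 : 256 * knotOneGlue4.sbm.cubicSum =
      rotateSum knotOneGlue4.diagram.arrows knotOneGlue4.point :=
    cubicSum_eq_rotateSum knotOneGlue4.diagram.valid knotOneGlue4.isKnot
      ⟨knotOneGlue4.point, knotOneGlue4.mem⟩
  have hne : rotateSum knotOneGlue3.diagram.arrows knotOneGlue3.point ≠
      rotateSum knotOneGlue4.diagram.arrows knotOneGlue4.point := by
    decide +kernel
  rw [← h3, ← h4, h.cubicSum_eq] at hne
  exact hne rfl

end Computation

/-! ### The two knots. -/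

section Example

/-- The invariant `SingularBasedMatrix.cubicSum` of flat singular virtual knots. -/
noncomputable def FlatSingularKnot.cubicSum : FlatSingularKnot → ℤ :=
  Quot.lift (fun α : SingularString => α.sbm.cubicSum) fun _ _ h =>
    (homologous_of_mk_eq (Quot.sound h)).cubicSum_eq

/-- The diagram with the crossing `3` of the second knot and the crossing `4` of the first one. -/
def knotBetween : KnotDiagram :=
  ⟨{ Pt := Fin 8
     next := finRotate 8
     arrows := exampleArrows ⟨5, 2, 1⟩ ⟨6, 1, 1⟩
     tail_ne_head := by decide
     disjoint := by unfold Arrow.IsEnd; decide },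
    ⟨(0 : Fin 8)⟩, isKnot_finRotate⟩

theorem crossingChange_knotOne : CrossingChange knotOne.1 knotBetween.1 := by
  have key : ∀ (x y : Fin 8) (ε : ℤˣ),
      (⟨x, y, ε⟩ : Arrow (Fin 8) ℤˣ) ∈ exampleArrows ⟨5, 2, 1⟩ ⟨6, 1, 1⟩ ↔
        ((⟨x, y, ε⟩ : Arrow (Fin 8) ℤˣ) ∈ exampleArrows ⟨2, 5, -1⟩ ⟨6, 1, 1⟩ ∧
          ¬ (⟨x, y, ε⟩ : Arrow (Fin 8) ℤˣ) = ⟨2, 5, -1⟩) ∨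
        (⟨x, y, ε⟩ : Arrow (Fin 8) ℤˣ) = ⟨5, 2, - -1⟩ := by
    decide +kernel
  have hm : (⟨2, 5, -1⟩ : Arrow (Fin 8) ℤˣ) ∈ exampleArrows ⟨2, 5, -1⟩ ⟨6, 1, 1⟩ := by decide
  exact ⟨_, hm, Set.singleton_subset_iff.2 hm, Equiv.refl _, fun _ => rfl,
    fun ⟨x, y, ε⟩ => key x y ε⟩

theorem crossingChange_knotBetween : CrossingChange knotBetween.1 knotTwo.1 := by
  have key : ∀ (x y : Fin 8) (ε : ℤˣ),
      (⟨x, y, ε⟩ : Arrow (Fin 8) ℤˣ) ∈ exampleArrows ⟨5, 2, 1⟩ ⟨1, 6, -1⟩ ↔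
        ((⟨x, y, ε⟩ : Arrow (Fin 8) ℤˣ) ∈ exampleArrows ⟨5, 2, 1⟩ ⟨6, 1, 1⟩ ∧
          ¬ (⟨x, y, ε⟩ : Arrow (Fin 8) ℤˣ) = ⟨6, 1, 1⟩) ∨
        (⟨x, y, ε⟩ : Arrow (Fin 8) ℤˣ) = ⟨1, 6, -1⟩ := by
    decide +kernel
  have hm : (⟨6, 1, 1⟩ : Arrow (Fin 8) ℤˣ) ∈ exampleArrows ⟨5, 2, 1⟩ ⟨6, 1, 1⟩ := by decide
  exact ⟨_, hm, Set.singleton_subset_iff.2 hm, Equiv.refl _, fun _ => rfl,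
    fun ⟨x, y, ε⟩ => key x y ε⟩

theorem homotopic_knotOne_knotTwo :
    Homotopic (VirtualKnot.mk knotOne) (VirtualKnot.mk knotTwo) :=
  ⟨knotOne, knotTwo, rfl, rfl, Relation.EqvGen.trans _ knotBetween _
    (Relation.EqvGen.rel _ _ (Or.inr crossingChange_knotOne))
    (Relation.EqvGen.rel _ _ (Or.inr crossingChange_knotBetween))⟩

/-- The knot diagram with the given arrows on the circle with the points `0, …, 7`. -/
abbrev rotateKnot (A : Finset (Arrow (Fin 8) ℤˣ)) (hA : Valid A) : KnotDiagram :=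
  ⟨ofPerm (finRotate 8) A hA, ⟨(0 : Fin 8)⟩, isKnot_finRotate⟩

/-- The signs add up to zero, so the kink terms drop out and the linear extension of `cubicSum`
becomes a computable sum over the crossings. -/
theorem mul_cubicSum_gluingSum {A : Finset (Arrow (Fin 8) ℤˣ)} (hA : Valid A)
    (h0 : ∑ d ∈ A, (d.label : ℤ) = 0) (p : Fin 8) :
    256 * FreeAbelianGroup.lift FlatSingularKnot.cubicSum
        ((rotateKnot A hA).gluingSum p true 1) =
      ∑ d ∈ A, (d.label : ℤ) * rotateSum (A.image fun a => a.flat (decide (a = d)))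
        (d.flat true) := by
  have hsum : (rotateKnot A hA).gluingSum p true 1 = ∑ d ∈ A.attach, (d.1.label : ℤ) •
      (FreeAbelianGroup.of (FlatSingularKnot.mk ((rotateKnot A hA).glue d.1 d.2)) -
        FreeAbelianGroup.of (FlatSingularKnot.mk ((rotateKnot A hA).singZero p true 1))) := rfl
  have hlift : ∀ d ∈ A.attach, 256 * FreeAbelianGroup.lift FlatSingularKnot.cubicSum
      ((d.1.label : ℤ) •
        (FreeAbelianGroup.of (FlatSingularKnot.mk ((rotateKnot A hA).glue d.1 d.2)) -
          FreeAbelianGroup.of (FlatSingularKnot.mk ((rotateKnot A hA).singZero p true 1)))) =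
      (d.1.label : ℤ) * rotateSum (A.image fun a => a.flat (decide (a = d.1))) (d.1.flat true) -
        (d.1.label : ℤ) * (256 * FlatSingularKnot.cubicSum
          (FlatSingularKnot.mk ((rotateKnot A hA).singZero p true 1))) := by
    intro d _
    have h : 256 * FlatSingularKnot.cubicSum
        (FlatSingularKnot.mk ((rotateKnot A hA).glue d.1 d.2)) =
          rotateSum (A.image fun a => a.flat (decide (a = d.1))) (d.1.flat true) :=
      cubicSum_eq_rotateSum (valid_flat (ofPerm (finRotate 8) A hA) fun a => decide (a = d.1))
        (rotateKnot A hA).2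
        ⟨d.1.flat true, Finset.mem_image.2 ⟨d.1, d.2, congrArg d.1.flat (decide_eq_true rfl)⟩⟩
    rw [← h, map_zsmul, map_sub, FreeAbelianGroup.lift_apply_of, FreeAbelianGroup.lift_apply_of,
      smul_eq_mul]
    ring
  rw [hsum, map_sum, Finset.mul_sum, Finset.sum_congr rfl hlift, Finset.sum_sub_distrib,
    ← Finset.sum_mul, Finset.sum_attach A fun d => (d.label : ℤ), h0, zero_mul, sub_zero,
    Finset.sum_attach A fun d => (d.label : ℤ) *
      rotateSum (A.image fun a => a.flat (decide (a = d))) (d.flat true)]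

/-- The glued shadows of the two knots agree, but the signs at the crossings 3 and 4 are opposite.
The linear extension of `cubicSum` takes different values on the two sums because it separates these
two crossings. -/
theorem gluingInvariant_knotOne_ne :
    gluingInvariant (VirtualKnot.mk knotOne) ≠ gluingInvariant (VirtualKnot.mk knotTwo) := by
  intro h
  rw [gluingInvariant_mk knotOne (0 : Fin 8) true 1, gluingInvariant_mk knotTwo (0 : Fin 8) true 1]
    at h
  have h1 := mul_cubicSum_gluingSum knotOne.1.valid (by decide +kernel) 0
  have h2 := mul_cubicSum_gluingSum knotTwo.1.valid (by decide +kernel) 0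
  have h3 := h1.symm.trans ((congrArg (fun z => 256 *
    FreeAbelianGroup.lift FlatSingularKnot.cubicSum z) h).trans h2)
  revert h3
  decide +kernel

/-- The two arrows that remain after a smoothing and the removal of a kink. -/
def remainingArrows : Finset (Arrow (Fin 8) Unit) := {⟨7, 4, ()⟩, ⟨0, 3, ()⟩}

theorem valid_remainingArrows : Valid remainingArrows :=
  ⟨by decide, by unfold Arrow.IsEnd; decide⟩

/-- After smoothing at either of the crossings 3 and 4 the other one becomes a kink. What remains
are two circles, one with the points 0 and 7 and one with the points 3 and 4, joined by the arrows
of the crossings 1 and 2. -/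
theorem linkEq_smoothing : LinkEq (finRotate 8 * Equiv.swap 2 5)
    (insert ⟨6, 1, ()⟩ remainingArrows) (finRotate 8 * Equiv.swap 6 1)
    (insert ⟨5, 2, ()⟩ remainingArrows) := by
  have hf : ∀ x ∈ ({1, 2, 5, 6} : Finset (Fin 8)), FreeIn remainingArrows x := by
    unfold FreeIn Arrow.IsEnd
    decide
  have f1 := hf 1 (by decide)
  have f2 := hf 2 (by decide)
  have f5 := hf 5 (by decide)
  have f6 := hf 6 (by decide)
  have hV := valid_remainingArrows
  have h1 : LinkEq (finRotate 8 * Equiv.swap 2 5) (insert ⟨6, 1, ()⟩ remainingArrows)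
      (finRotate 8 * Equiv.swap 2 5) remainingArrows :=
    (linkEq_slide_dir (r := false) (x := 1) (y := 6) (z := 2) (hV.insert_dir (by decide) f1 f6)
      f1 f2 (by decide) (by decide) (by decide) (by decide)).trans
      (linkEq_flat1 hV f2 f6 (by decide) (by decide)).symm
  have h2 : LinkEq (finRotate 8 * Equiv.swap 6 1) (insert ⟨5, 2, ()⟩ remainingArrows)
      (finRotate 8 * Equiv.swap 6 1) remainingArrows :=
    (linkEq_slide_dir (r := true) (x := 5) (y := 2) (z := 6) (hV.insert_dir (by decide) f5 f2)
      f5 f6 (by decide) (by decide) (by decide) (by decide)).trans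
      (linkEq_flat1 hV f6 f2 (by decide) (by decide)).symm
  -- The two orders differ by the place of the free points 6 and 2, which are relocated one after
  -- the other.
  have h3 : LinkEq (finRotate 8 * Equiv.swap 2 5) remainingArrows (finRotate 8 * Equiv.swap 2 6)
      remainingArrows :=
    linkEq_relocate (p := 2) (q := 5) hV f6 (by decide) (by decide) (by decide) (by decide)
      (by decide) (by decide) (by decide) (by decide)
  have h4 : LinkEq (finRotate 8 * Equiv.swap 2 6) remainingArrows (finRotate 8 * Equiv.swap 6 1)
      remainingArrows :=
    linkEq_relocate (p := 1) (q := 6) hV f2 (by decide) (by decide) (by decide) (by decide)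
      (by decide) (by decide) (by decide) (by decide)
  exact h1.trans (h3.trans (h4.trans h2.symm))

/-- The arrows of the shadow of a smoothing. -/
def smoothArrows (A : Finset (Arrow (Fin 8) ℤˣ)) (d : Arrow (Fin 8) ℤˣ) :
    Finset (Arrow (Fin 8) Unit) :=
  (A.erase d).image fun a => a.flat ()

theorem flatLink_smooth_three_eq_four :
    FlatLink.mk (knotOne.1.smooth (⟨2, 5, -1⟩ : Arrow (Fin 8) ℤˣ)).shadow =
      FlatLink.mk (knotOne.1.smooth (⟨6, 1, 1⟩ : Arrow (Fin 8) ℤˣ)).shadow := by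
  obtain ⟨_, _, h⟩ := linkEq_smoothing
  have h3 : smoothArrows (exampleArrows ⟨2, 5, -1⟩ ⟨6, 1, 1⟩) ⟨2, 5, -1⟩ =
      insert ⟨6, 1, ()⟩ remainingArrows := by decide +kernel
  have h4 : smoothArrows (exampleArrows ⟨2, 5, -1⟩ ⟨6, 1, 1⟩) ⟨6, 1, 1⟩ =
      insert ⟨5, 2, ()⟩ remainingArrows := by decide +kernel
  exact (flatLink_mk_congr (P := Fin 8)
    (hA := (knotOne.1.smooth (⟨2, 5, -1⟩ : Arrow (Fin 8) ℤˣ)).shadow.valid) rfl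
    h3).trans (h.trans (flatLink_mk_congr (P := Fin 8)
    (hB := (knotOne.1.smooth (⟨6, 1, 1⟩ : Arrow (Fin 8) ℤˣ)).shadow.valid) rfl
    h4.symm))

theorem flatLink_smooth_congr {d d' : Arrow (Fin 8) ℤˣ}
    (h : Equiv.swap d.tail d.head = Equiv.swap d'.tail d'.head)
    (h' : smoothArrows (exampleArrows ⟨2, 5, -1⟩ ⟨6, 1, 1⟩) d =
      smoothArrows (exampleArrows ⟨5, 2, 1⟩ ⟨1, 6, -1⟩) d') :
    FlatLink.mk (knotOne.1.smooth d).shadow = FlatLink.mk (knotTwo.1.smooth d').shadow :=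
  flatLink_mk_congr (P := Fin 8) (hA := (knotOne.1.smooth d).shadow.valid)
    (hB := (knotTwo.1.smooth d').shadow.valid) (congrArg (finRotate 8 * ·) h) h'

/-- The shadows agree, so only the exchanged signs at the crossings 3 and 4 could matter; but the
smoothings there define the same flat link, and in both knots the two terms cancel. -/
theorem smoothingSum_knotOne : knotOne.smoothingSum = knotTwo.smoothingSum := by
  have h1 : knotOne.smoothingSum = ∑ d ∈ exampleArrows ⟨2, 5, -1⟩ ⟨6, 1, 1⟩, (d.label : ℤ) •
      (FreeAbelianGroup.of (FlatLink.mk (knotOne.1.smooth d).shadow) -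
        FreeAbelianGroup.of (FlatLink.mk knotOne.1.shadow.addCircle)) := rfl
  have h2 : knotTwo.smoothingSum = ∑ d ∈ exampleArrows ⟨5, 2, 1⟩ ⟨1, 6, -1⟩, (d.label : ℤ) •
      (FreeAbelianGroup.of (FlatLink.mk (knotTwo.1.smooth d).shadow) -
        FreeAbelianGroup.of (FlatLink.mk knotTwo.1.shadow.addCircle)) := rfl
  rw [h1, h2, exampleArrows, exampleArrows, Finset.sum_insert (by decide),
    Finset.sum_insert (by decide), Finset.sum_insert (by decide), Finset.sum_singleton,
    Finset.sum_insert (by decide), Finset.sum_insert (by decide), Finset.sum_insert (by decide),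
    Finset.sum_singleton, flatLink_smooth_congr (d := ⟨4, 7, -1⟩) (d' := ⟨4, 7, -1⟩) rfl
      (by decide +kernel),
    flatLink_smooth_congr (d := ⟨0, 3, 1⟩) (d' := ⟨0, 3, 1⟩) rfl (by decide +kernel),
    flatLink_smooth_three_eq_four, flatLink_smooth_congr (d := ⟨6, 1, 1⟩) (d' := ⟨1, 6, -1⟩)
      (Equiv.swap_comm _ _) (by decide +kernel),
    ← flatLink_smooth_congr (d := ⟨2, 5, -1⟩) (d' := ⟨5, 2, 1⟩) (Equiv.swap_comm _ _)
      (by decide +kernel), flatLink_smooth_three_eq_four,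
    flatLink_smooth_congr (d := ⟨6, 1, 1⟩) (d' := ⟨1, 6, -1⟩)
      (Equiv.swap_comm _ _) (by decide +kernel)]
  simp only [Units.val_neg, Units.val_one, neg_smul, one_smul]
  abel

end Example

end VirtualKnots

theorem mainTheorem2 :
    -- the smoothing invariant and the gluing invariant: the defining sums do not depend on the
    -- diagram, nor on the place and the type of the kink
    ∃ (S : VirtualKnot → FreeAbelianGroup FlatLink)
      (G : VirtualKnot → FreeAbelianGroup FlatSingularKnot),
      (∀ D : KnotDiagram, S (VirtualKnot.mk D) = D.smoothingSum) ∧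
      (∀ (D : KnotDiagram) (p : D.1.Pt) (r : Bool) (ε : ℤˣ),
        G (VirtualKnot.mk D) = D.gluingSum p r ε) ∧
      -- (1)
      (∀ K K' : VirtualKnot, Homotopic K K' → S K ≠ S K' → G K ≠ G K') ∧
      -- (2)
      (Homotopic (VirtualKnot.mk knotOne) (VirtualKnot.mk knotTwo) ∧
        S (VirtualKnot.mk knotOne) = S (VirtualKnot.mk knotTwo) ∧
        G (VirtualKnot.mk knotOne) ≠ G (VirtualKnot.mk knotTwo)) ∧
      -- the homology class of the singular based matrix is an invariant, and it distinguishes the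
      -- strings that are glued at the crossings 3 and 4
      (∀ α β : SingularString, FlatSingularKnot.mk α = FlatSingularKnot.mk β →
        SingularBasedMatrix.Homologous α.sbm β.sbm) ∧
      ¬ SingularBasedMatrix.Homologous knotOneGlue3.sbm knotOneGlue4.sbm := by
  refine ⟨smoothingInvariant, gluingInvariant, smoothingInvariant_mk, gluingInvariant_mk,
    -- The smoothing invariant is the image of the gluing invariant under a homomorphism, so
    -- equality of the latter forces equality of the former.
    fun K K' _ h h' => h (congrArg (FreeAbelianGroup.map FlatSingularKnot.smoothing) h'),
    ⟨homotopic_knotOne_knotTwo, ?_, gluingInvariant_knotOne_ne⟩, fun α β => homologous_of_mk_eq,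
    not_homologous_glue⟩
  rw [smoothingInvariant_mk, smoothingInvariant_mk, smoothingSum_knotOne]
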